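/- Fix $n\ge 0$ and work in $\mathbb{Q}[\mathfrak S_n]$, with product $(\sigma\tau)(i)=\sigma(\tau(i))$ and $\sigma=\sigma_1\cdots\sigma_n$. \emph{The spaces.} An alternating run of $\sigma$ is a maximal monotone factor of $\sigma_1,\dots,\sigma_n$, and $\mathrm{run}(\sigma)$ is the number of these; $\mathrm{run}^\circ(\sigma)$ is the number of maximal monotone factors of $\sigma_0,\sigma_1,\dots,\sigma_n$ with $\sigma_0=0$. A peak is an $i$ with $2\le i\le n-1$ and $\sigma_{i-1}<\sigma_i>\sigma_{i+1}$; a left peak is an $i$ with $1\le i\le n-1$ and the same inequalities, with $\sigma_0=0$. Let $W_k$, $W_k^\circ$, $P_k$, $P_k^\circ$ be the sums of all $\sigma\in\mathfrak S_n$ with, respectively, $\mathrm{run}(\sigma)=k$, $\mathrm{run}^\circ(\sigma)=k$, $k$ peaks, $k$ left peaks, and let $W_k^+$ (resp. $W_k^-$) be the sum of all $\sigma$ with $\mathrm{run}(\sigma)=k$ whose first run is ascending (resp. descending). Let $$\mathcal W_n=\mathrm{Vect}(W_k:1\le k\le n-1),\qquad \mathcal W_n^\circ=\mathrm{Vect}(W_k^\circ:1\le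 k\le n),$$ $$\mathcal C_n=\mathrm{Vect}(W_{2k}:1\le k\le\lfloor\tfrac{n-1}2\rfloor)\oplus\mathrm{Vect}(W_{2k-1}^+,W_{2k-1}^-:1\le k\le\lfloor\tfrac n2\rfloor),$$ $$\mathcal P_n=\mathrm{Vect}(P_k:0\le k\le\lfloor\tfrac{n-1}2\rfloor),\qquad \mathcal P_n^\circ=\mathrm{Vect}(P_k^\circ:0\le k\le\lfloor\tfrac n2\rfloor).$$ \emph{Noncommutative symmetric functions.} Let $\mathbf{Sym}$ be the free associative $\mathbb Q$-algebra, with product $\star$, on generators $S_1,S_2,\dots$, with $\deg S_i=i$ and $S_0=1$. For a composition $I=(i_1,\dots,i_r)$ put $S^I=S_{i_1}\star\cdots\star S_{i_r}$, $\mathrm{Des}(I)=\{i_1,i_1+i_2,\dots,i_1+\cdots+i_{r-1}\}$, and $R_I=\sum_J(-1)^{\ell(J)-\ell(I)}S^J$, summed over the compositions $J$ of $|I|$ with $\mathrm{Des}(J)\subseteq\mathrm{Des}(I)$. The degree $n$ part of $\mathbf{Sym}$ is identified with the descent algebra in $\mathbb Q[\mathfrak S_n]$ by identifying $S^I$ with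 the sum of all $\sigma$ with $\mathrm{Des}(\sigma)\subseteq\mathrm{Des}(I)$. In the completion $\widehat{\mathbf{Sym}}$ put $$V_1^+=\sum_{m\ge0}R_{(m)},\quad V_1^-=\sum_{m\ge0}R_{(1^m)},\quad V_2^+=V_1^+\star V_1^-,\quad V_2^-=V_1^-\star V_1^+,$$ and, with $\log_\star$, $\exp_\star$ the usual power series for the product $\star$ and $G^{\star a}=\exp_\star(a\log_\star G)$, $$I_k^\pm=\frac1{k!}\Big(\tfrac12\log_\star V_2^\pm\Big)^{\star k},\qquad J_k^+=V_1^+\star(V_2^-)^{\star(-1/2)}\star I_k^-,\qquad J_k^-=V_1^-\star(V_2^+)^{\star(-1/2)}\star I_k^+ .$$ Let $I_{k,n}^\pm$, $J_{k,n}^\pm$ be their degree $n$ parts. Let $\Gamma:\mathbf{Sym}\to Sym$ be the algebra morphism to the ring of symmetric functions over $\mathbb{Q}$ with $\Gamma(S_i)=h_i$. For a partition $\lambda$ let $\ell_o(\lambda)$, $\ell_e(\lambda)$ be its numbers of odd and even parts, $p_\lambda$ the product of the power sums $p_i$ over the parts $i$ of $\lambda$, and $z_\lambda=\prod_r r^{i_r}i_r!$,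 where $i_r$ is the number of parts of size $r$. \textbf{Theorem.} Products are taken in $\mathbb Q[\mathfrak S_n]$, all sums are over partitions $\lambda$ of $n$, and each index $k,l,m$ is an integer congruent to $n$ modulo $2$ in the range shown. (i) If $n\ge2$, then $\tfrac12(I_{k,n}^++I_{k,n}^-)$ $(1\le k\le n)$ together with $\tfrac12(J_{l,n}^++J_{l,n}^--I_{l,n}^+-I_{l,n}^-)$ $(0\le l\le n-4)$ form a basis of pairwise orthogonal idempotents of $\mathcal W_n$. Their images under $\Gamma$ are $\sum_{\ell_o(\lambda)=k,\ \ell_e(\lambda)=0}p_\lambda/z_\lambda$ and $\sum_{\ell_o(\lambda)=l,\ \ell_e(\lambda)>0\text{ even}}p_\lambda/z_\lambda$. (ii) $I_{k,n}^+$ $(1\le k\le n)$ together with $J_{l,n}^+-I_{l,n}^+$ $(0\le l\le n-2)$ form a basis of pairwise orthogonal idempotents of $\mathcal W_n^\circ$. Their images under $\Gamma$ are $\sum_{\ell_o(\lambda)=k,\ \ell_e(\lambda)=0}p_\lambda/z_\lambda$ and $\sum_{\ell_o(\lambda)=l,\ \ell_e(\lambda)>0}p_\lambda/z_\lambda$.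 (iii) If $n\ge2$, then $\tfrac12(I_{k,n}^++I_{k,n}^-)$ $(1\le k\le n)$, $\tfrac12(J_{l,n}^++J_{l,n}^--I_{l,n}^+-I_{l,n}^-)$ $(0\le l\le n-4)$ and $\tfrac12(J_{m,n}^+-J_{m,n}^-)$ $(0\le m\le n-2)$ together form a basis of pairwise orthogonal idempotents of $\mathcal C_n$. Their images under $\Gamma$ are $\sum_{\ell_o(\lambda)=k,\ \ell_e(\lambda)=0}p_\lambda/z_\lambda$, $\sum_{\ell_o(\lambda)=l,\ \ell_e(\lambda)>0\text{ even}}p_\lambda/z_\lambda$ and $\sum_{\ell_o(\lambda)=m,\ \ell_e(\lambda)\text{ odd}}p_\lambda/z_\lambda$. (iv) $I_{k,n}^-$ $(1\le k\le n)$ form a basis of pairwise orthogonal idempotents of $\mathcal P_n$. Their images under $\Gamma$ are $\sum_{\ell_o(\lambda)=k,\ \ell_e(\lambda)=0}p_\lambda/z_\lambda$. (v) $J_{k,n}^+$ $(0\le k\le n)$ form a basis of pairwise orthogonal idempotents of $\mathcal P_n^\circ$. Their images under $\Gamma$ are $\sum_{\ell_o(\lambda)=k}p_\lambda/z_\lambda$.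 -/

import Mathlib

namespace RunAlgebra

noncomputable section

/-! Runs and peaks of sequences and permutations. -/

/-- The factor `w a, …, w b` is monotone (increasing or decreasing). -/
def MonotoneFactor {m : ℕ} (w : Fin m → ℕ) (a b : Fin m) : Prop :=
  StrictMonoOn w (Set.Icc a b) ∨ StrictAntiOn w (Set.Icc a b)

/-- The pair `(a, b)` delimits an alternating run of `w`: a maximal monotone factor. -/
def IsRun {m : ℕ} (w : Fin m → ℕ) (r : Fin m × Fin m) : Prop :=
  r.1 ≤ r.2 ∧ MonotoneFactor w r.1 r.2 ∧
    ∀ c d : Fin m, c ≤ r.1 → r.2 ≤ d → MonotoneFactor w c d → c = r.1 ∧ d = r.2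

/-- The number of alternating runs of a sequence. -/
def runCount {m : ℕ} (w : Fin m → ℕ) : ℕ :=
  Set.ncard {r : Fin m × Fin m | IsRun w r}

/-- The number of (interior) peaks of a sequence: `w (i - 1) < w i > w (i + 1)`. -/
def peakCount {m : ℕ} (w : Fin m → ℕ) : ℕ :=
  Set.ncard {i : Fin m | ∃ (a b : Fin m), (a : ℕ) + 1 = i ∧ (i : ℕ) + 1 = b ∧ w a < w i ∧ w b < w i}

/-- The sequence `σ₁, …, σₙ` of values in `{1, …, n}`. -/
def word {n : ℕ} (σ : Equiv.Perm (Fin n)) : Fin n → ℕ := fun i => (σ i : ℕ) + 1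

/-- The sequence `σ₀ = 0, σ₁, …, σₙ`. -/
def leftWord {n : ℕ} (σ : Equiv.Perm (Fin n)) : Fin (n + 1) → ℕ :=
  Fin.cons (α := fun _ => ℕ) 0 (word σ)

/-- Number of alternating runs. -/
def run {n : ℕ} (σ : Equiv.Perm (Fin n)) : ℕ := runCount (word σ)

/-- Number of left runs. -/
def leftRun {n : ℕ} (σ : Equiv.Perm (Fin n)) : ℕ := runCount (leftWord σ)

/-- Number of peaks. -/
def pk {n : ℕ} (σ : Equiv.Perm (Fin n)) : ℕ := peakCount (word σ)

/-- Number of left peaks. -/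
def leftPk {n : ℕ} (σ : Equiv.Perm (Fin n)) : ℕ := peakCount (leftWord σ)

/-- The first run of `σ` is ascending. -/
def FirstRunAscending {n : ℕ} (σ : Equiv.Perm (Fin n)) : Prop :=
  ∃ r : Fin n × Fin n, IsRun (word σ) r ∧ (r.1 : ℕ) = 0 ∧
    StrictMonoOn (word σ) (Set.Icc r.1 r.2)

/-- The first run of `σ` is descending. -/
def FirstRunDescending {n : ℕ} (σ : Equiv.Perm (Fin n)) : Prop :=
  ∃ r : Fin n × Fin n, IsRun (word σ) r ∧ (r.1 : ℕ) = 0 ∧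
    StrictAntiOn (word σ) (Set.Icc r.1 r.2)

/-! The group algebra of the symmetric group, and the spaces spanned by run and peak sums. -/

/-- The group algebra `ℚ[𝔖ₙ]`, with `(σ τ)(i) = σ (τ i)`. -/
abbrev GroupAlg (n : ℕ) : Type := MonoidAlgebra ℚ (Equiv.Perm (Fin n))

open Classical in
/-- The sum in `ℚ[𝔖ₙ]` of all permutations with property `p`. -/
def permSum {n : ℕ} (p : Equiv.Perm (Fin n) → Prop) : GroupAlg n :=
  ∑ σ : Equiv.Perm (Fin n), if p σ then MonoidAlgebra.single σ 1 else 0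

def Wplus (n k : ℕ) : GroupAlg n := permSum fun σ => run σ = k ∧ FirstRunAscending σ

def Wminus (n k : ℕ) : GroupAlg n := permSum fun σ => run σ = k ∧ FirstRunDescending σ

def Wrun (n k : ℕ) : GroupAlg n := permSum fun σ => run σ = k

def Wleft (n k : ℕ) : GroupAlg n := permSum fun σ => leftRun σ = k

def Ppeak (n k : ℕ) : GroupAlg n := permSum fun σ => pk σ = k

def Pleft (n k : ℕ) : GroupAlg n := permSum fun σ => leftPk σ = k

/-- `𝒲ₙ = Vect(W_k : 1 ≤ k ≤ n - 1)`. -/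
def runAlg (n : ℕ) : Submodule ℚ (GroupAlg n) :=
  Submodule.span ℚ {x | ∃ k, 1 ≤ k ∧ k + 1 ≤ n ∧ x = Wrun n k}

/-- `𝒲ₙ° = Vect(W_k° : 1 ≤ k ≤ n)`. -/
def leftRunAlg (n : ℕ) : Submodule ℚ (GroupAlg n) :=
  Submodule.span ℚ {x | ∃ k, 1 ≤ k ∧ k ≤ n ∧ x = Wleft n k}

/-- `𝒞ₙ`, spanned by the `W_{2k}` with `1 ≤ 2k ≤ n - 1` and the `W_{2k-1}^+`, `W_{2k-1}^-` with
`1 ≤ 2k - 1 ≤ n - 1`. -/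
def commAlg (n : ℕ) : Submodule ℚ (GroupAlg n) :=
  Submodule.span ℚ {x | ∃ k, 1 ≤ k ∧ 2 * k + 1 ≤ n ∧ x = Wrun n (2 * k)} ⊔
  Submodule.span ℚ {x | ∃ k, 1 ≤ k ∧ 2 * k ≤ n ∧ (x = Wplus n (2 * k - 1) ∨ x = Wminus n (2 * k - 1))}

/-- The Eulerian peak algebra `𝒫ₙ = Vect(P_k : 0 ≤ k ≤ ⌊(n - 1) / 2⌋)`. -/
def peakAlg (n : ℕ) : Submodule ℚ (GroupAlg n) :=
  Submodule.span ℚ {x | ∃ k, 2 * k + 1 ≤ n ∧ x = Ppeak n k}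

/-- The Eulerian left peak algebra `𝒫ₙ° = Vect(P_k° : 0 ≤ k ≤ ⌊n / 2⌋)`. -/
def leftPeakAlg (n : ℕ) : Submodule ℚ (GroupAlg n) :=
  Submodule.span ℚ {x | ∃ k, 2 * k ≤ n ∧ x = Pleft n k}

/-! Noncommutative symmetric functions. -/

/-- `𝐒𝐲𝐦` with its external product: the free associative `ℚ`-algebra on `S₁, S₂, …`. The basis
`S^I` is indexed by words in the positive integers, and words multiply by concatenation. -/
abbrev NSym : Type := MonoidAlgebra ℚ (FreeMonoid ℕ+)

/-- A composition of `n`, as a word in the positive integers. -/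
def compWord {n : ℕ} (I : Composition n) : FreeMonoid ℕ+ :=
  FreeMonoid.ofList (I.blocks.pmap (fun i hi => (⟨i, hi⟩ : ℕ+)) fun _ hi => I.blocks_pos hi)

/-- The complete noncommutative symmetric function `S^I`. -/
def completeS {n : ℕ} (I : Composition n) : NSym := MonoidAlgebra.single (compWord I) 1

/-- The descent set `{i₁, i₁ + i₂, …, i₁ + ⋯ + i_{r-1}}` of `(i₁, …, i_r)`. -/
def compDes {n : ℕ} (I : Composition n) : Finset ℕ :=
  (Finset.Ico 1 I.length).image I.sizeUpTo

/-- The ribbon `R_I = ∑_{J ≼ I} (-1)^{ℓ(J) - ℓ(I)} S^J`, where `J ≼ I` means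
`Des(J) ⊆ Des(I)`. -/
def ribbonR {n : ℕ} (I : Composition n) : NSym :=
  ∑ J : Composition n with compDes J ⊆ compDes I,
    (-1 : ℚ) ^ ((J.length : ℤ) - (I.length : ℤ)) • completeS J

/-- The descents of `σ`: the `i` with `1 ≤ i ≤ n - 1` and `σᵢ > σᵢ₊₁`. -/
def permDes {n : ℕ} (σ : Equiv.Perm (Fin n)) : Set ℕ :=
  {i | ∃ a b : Fin n, (a : ℕ) + 1 = i ∧ (b : ℕ) = i ∧ word σ b < word σ a}

/-- The element `S^I` of the descent algebra: the sum of all `σ` with `Des(σ) ⊆ Des(I)`. -/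
def descentS {n : ℕ} (I : Composition n) : GroupAlg n :=
  permSum fun σ => permDes σ ⊆ (compDes I : Set ℕ)

/-- The identification of the degree `n` part of `𝐒𝐲𝐦` with the descent algebra
`𝒟ₙ ⊆ ℚ[𝔖ₙ]`, sending `S^I` to `S^I` (and killing the other degrees). -/
def toDescent (n : ℕ) : NSym →ₗ[ℚ] GroupAlg n where
  toFun F := ∑ I : Composition n, F.coeff (compWord I) • descentS I
  map_add' F G := by simp [add_smul, Finset.sum_add_distrib]
  map_smul' c F := by simp [mul_smul, Finset.smul_sum]

/-! The completion of `𝐒𝐲𝐦`: a series `∑ₙ Fₙ`, with `Fₙ` of degree `n`, is encoded as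
`∑ₙ Fₙ tⁿ`, the central variable `t` recording the degree. The product of power series is then the
external product. -/

/-- Power series over `𝐒𝐲𝐦`, containing the completion of `𝐒𝐲𝐦`. -/
abbrev NSymHat : Type := PowerSeries NSym

/-- The composition `(n)` with at most one part (empty when `n = 0`). -/
def rowComp : (n : ℕ) → Composition n
  | 0 => Composition.ones 0
  | n + 1 => Composition.single (n + 1) n.succ_pos

/-- `V₁⁺ = ∑ₙ R_{(n)}`. -/
def V1plus : NSymHat := PowerSeries.mk fun n => ribbonR (rowComp n)

/-- `V₁⁻ = ∑ₙ R_{(1ⁿ)}`. -/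
def V1minus : NSymHat := PowerSeries.mk fun n => ribbonR (Composition.ones n)

def V2plus : NSymHat := V1plus * V1minus

def V2minus : NSymHat := V1minus * V1plus

/-- `log_⋆ G = ∑_{k ≥ 1} (-1)^{k-1} (G - 1)^{⋆k} / k`, for `G` with constant term `1` (only the
terms with `k ≤ n` contribute in degree `n`). -/
def logStar (G : NSymHat) : NSymHat :=
  PowerSeries.mk fun n => ∑ k ∈ Finset.Icc 1 n,
    ((-1 : ℚ) ^ (k - 1) / (k : ℚ)) • PowerSeries.coeff n ((G - 1) ^ k)

/-- `exp_⋆ F = ∑_{k ≥ 0} F^{⋆k} / k!`, for `F` with constant term `0` (only the terms with `k ≤ n`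
contribute in degree `n`). -/
def expStar (F : NSymHat) : NSymHat :=
  PowerSeries.mk fun n => ∑ k ∈ Finset.range (n + 1),
    (1 / (k.factorial : ℚ)) • PowerSeries.coeff n (F ^ k)

/-- `G^{⋆a} = exp_⋆ (a log_⋆ G)`, for `G` with constant term `1` and `a` rational. -/
def powStar (G : NSymHat) (a : ℚ) : NSymHat := expStar (a • logStar G)

def Iplus (k : ℕ) : NSymHat := (1 / (k.factorial : ℚ)) • ((1 / 2 : ℚ) • logStar V2plus) ^ k

def Iminus (k : ℕ) : NSymHat := (1 / (k.factorial : ℚ)) • ((1 / 2 : ℚ) • logStar V2minus) ^ k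

def Jplus (k : ℕ) : NSymHat := V1plus * powStar V2minus (-1 / 2) * Iminus k

def Jminus (k : ℕ) : NSymHat := V1minus * powStar V2plus (-1 / 2) * Iplus k

/-- `I_{k,n}^+`, the degree `n` part of `I_k^+`; similarly for the next three. -/
def Iplusn (n k : ℕ) : NSym := PowerSeries.coeff n (Iplus k)

def Iminusn (n k : ℕ) : NSym := PowerSeries.coeff n (Iminus k)

def Jplusn (n k : ℕ) : NSym := PowerSeries.coeff n (Jplus k)

def Jminusn (n k : ℕ) : NSym := PowerSeries.coeff n (Jminus k)

/-! Symmetric functions. -/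

/-- The ring `Sym` of symmetric functions over `ℚ`: formal power series in `x₀, x₁, …` of bounded
degree that are invariant under all permutations of the variables. -/
def SymFun : Subalgebra ℚ (MvPowerSeries ℕ ℚ) where
  carrier := {f | (∀ e : Equiv.Perm ℕ, MvPowerSeries.renameEquiv ℚ e f = f) ∧
    ∃ d : ℕ, ∀ m : ℕ →₀ ℕ, MvPowerSeries.coeff m f ≠ 0 → m.degree ≤ d}
  mul_mem' := by
    rintro f g ⟨hf, d, hd⟩ ⟨hg, d', hd'⟩
    refine ⟨fun e => by rw [map_mul, hf, hg], d + d', fun m hm => ?_⟩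
    classical
    rw [MvPowerSeries.coeff_mul] at hm
    obtain ⟨p, hp, hne⟩ := Finset.exists_ne_zero_of_sum_ne_zero hm
    rw [Finset.HasAntidiagonal.mem_antidiagonal] at hp
    rw [← hp, map_add]
    exact add_le_add (hd _ (left_ne_zero_of_mul hne)) (hd' _ (right_ne_zero_of_mul hne))
  add_mem' := by
    rintro f g ⟨hf, d, hd⟩ ⟨hg, d', hd'⟩
    refine ⟨fun e => by rw [map_add, hf, hg], max d d', fun m hm => ?_⟩
    by_cases h : MvPowerSeries.coeff m f = 0
    · refine le_trans (hd' m fun h' => hm ?_) (le_max_right _ _)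
      rw [map_add, h, h', add_zero]
    · exact le_trans (hd m h) (le_max_left _ _)
  algebraMap_mem' := by
    intro r
    refine ⟨fun e => AlgEquiv.commutes _ r, 0, fun m hm => ?_⟩
    classical
    by_contra h
    refine hm ?_
    rw [MvPowerSeries.algebraMap_apply, MvPowerSeries.coeff_C, if_neg]
    rintro rfl
    exact h (by simp)

/-- A power series of bounded degree whose coefficients are invariant is a symmetric function. -/
theorem mem_SymFun (f : MvPowerSeries ℕ ℚ)
    (h : ∀ (e : Equiv.Perm ℕ) (m : ℕ →₀ ℕ),
      MvPowerSeries.coeff (m.embDomain e.toEmbedding) f = MvPowerSeries.coeff m f)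
    (hd : ∃ d : ℕ, ∀ m : ℕ →₀ ℕ, MvPowerSeries.coeff m f ≠ 0 → m.degree ≤ d) : f ∈ SymFun := by
  refine ⟨fun e => ?_, hd⟩
  ext m
  obtain ⟨m', rfl⟩ : ∃ m', Finsupp.embDomain e.toEmbedding m' = m := by
    refine ⟨m.embDomain e.symm.toEmbedding, ?_⟩
    ext i
    obtain ⟨j, rfl⟩ := e.surjective i
    obtain ⟨k, rfl⟩ := e.symm.surjective j
    have h1 := Finsupp.embDomain_apply_self e.toEmbedding
      (Finsupp.embDomain e.symm.toEmbedding m) (e.symm k)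
    have h2 := Finsupp.embDomain_apply_self e.symm.toEmbedding m k
    simp only [Equiv.coe_toEmbedding] at h1 h2
    rw [h1, h2, Equiv.apply_symm_apply]
  rw [h]
  exact MvPowerSeries.coeff_embDomain_rename e.toEmbedding f m'

theorem degree_embDomain (e : Equiv.Perm ℕ) (m : ℕ →₀ ℕ) :
    (m.embDomain e.toEmbedding).degree = m.degree := by
  rw [Finsupp.embDomain_eq_mapDomain, Finsupp.degree_mapDomain]

open Classical in
/-- The sum of all monomials of degree `n`. -/
def hSeries (n : ℕ) : MvPowerSeries ℕ ℚ := fun m => if m.degree = n then 1 else 0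

open Classical in
/-- The series `∑ᵢ xᵢⁿ`, for `n ≥ 1`. -/
def pSeries (n : ℕ) : MvPowerSeries ℕ ℚ :=
  fun m => if ∃ i, m = Finsupp.single i n then 1 else 0

open Classical in
theorem coeff_hSeries (n : ℕ) (m : ℕ →₀ ℕ) :
    MvPowerSeries.coeff m (hSeries n) = if m.degree = n then 1 else 0 := rfl

open Classical in
theorem coeff_pSeries (n : ℕ) (m : ℕ →₀ ℕ) :
    MvPowerSeries.coeff m (pSeries n) = if ∃ i, m = Finsupp.single i n then 1 else 0 := rfl

/-- The complete homogeneous symmetric function `h_n`. -/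
def hSym (n : ℕ) : SymFun :=
  ⟨hSeries n, by
    refine mem_SymFun _ (fun e m => ?_) ⟨n, fun m hm => ?_⟩
    · rw [coeff_hSeries, coeff_hSeries, degree_embDomain]
    · rw [coeff_hSeries] at hm
      by_contra h
      exact hm (if_neg fun h' => h h'.le)⟩

/-- The power sum `p_n`, for `n ≥ 1`. -/
def pSym (n : ℕ) : SymFun :=
  ⟨pSeries n, by
    refine mem_SymFun _ (fun e m => ?_) ⟨n, fun m hm => ?_⟩
    · have key : (∃ i, m.embDomain e.toEmbedding = Finsupp.single i n) ↔
          ∃ i, m = Finsupp.single i n := by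
        constructor
        · rintro ⟨i, hi⟩
          refine ⟨e.symm i, Finsupp.embDomain_injective e.toEmbedding ?_⟩
          rw [hi, Finsupp.embDomain_single]
          simp
        · rintro ⟨i, rfl⟩
          exact ⟨e i, by rw [Finsupp.embDomain_single]; simp⟩
      rw [coeff_pSeries, coeff_pSeries]
      by_cases h : ∃ i, m = Finsupp.single i n
      · rw [if_pos (key.mpr h), if_pos h]
      · rw [if_neg fun h' => h (key.mp h'), if_neg h]
    · rw [coeff_pSeries] at hm
      by_contra h
      refine hm (if_neg ?_)
      rintro ⟨i, rfl⟩
      exact h (by simp)⟩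

/-- `Γ : 𝐒𝐲𝐦 → Sym`, the algebra morphism with `Γ(S_n) = h_n`. -/
def Gam : NSym →ₐ[ℚ] SymFun :=
  MonoidAlgebra.lift ℚ SymFun (FreeMonoid ℕ+) (FreeMonoid.lift fun i : ℕ+ => hSym i)

/-- `p_λ`, the product of the `p_i` over the parts of `λ`. -/
def pPart {n : ℕ} (l : n.Partition) : SymFun := (l.parts.map pSym).prod

/-- `z_λ = ∏_r r^{i_r} i_r!`, where `i_r` is the number of parts of size `r`. -/
def zPart {n : ℕ} (l : n.Partition) : ℕ :=
  ∏ r ∈ l.parts.toFinset, r ^ l.parts.count r * (l.parts.count r).factorial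

/-- The number of odd parts. -/
def oddLen {n : ℕ} (l : n.Partition) : ℕ := l.parts.countP fun i => Odd i

/-- The number of even parts. -/
def evenLen {n : ℕ} (l : n.Partition) : ℕ := l.parts.countP fun i => Even i

open Classical in
/-- `∑ p_λ / z_λ` over the partitions `λ` of `n` whose numbers of odd and even parts satisfy
`q`. -/
def pSum (n : ℕ) (q : ℕ → ℕ → Prop) : SymFun :=
  ∑ l : n.Partition with q (oddLen l) (evenLen l), (1 / (zPart l : ℚ)) • pPart l

/-- The family `e` is a basis of the subspace `A` made of pairwise orthogonal idempotents. -/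
structure IsOrthIdemBasis {n : ℕ} (A : Submodule ℚ (GroupAlg n)) {ι : Type}
    (e : ι → GroupAlg n) : Prop where
  orthogonalIdempotents : OrthogonalIdempotents e
  linearIndependent : LinearIndependent ℚ e
  span_eq : Submodule.span ℚ (Set.range e) = A

/-- The indices `k` with `a ≤ k ≤ n - b` and `k ≡ n mod 2`. -/
abbrev Idx (a b n : ℕ) : Type := {k : ℕ // a ≤ k ∧ k + b ≤ n ∧ k ≡ n [MOD 2]}

/-- `½ (I_{k,n}^+ + I_{k,n}^-)`. -/
def elemA (n k : ℕ) : NSym := (1 / 2 : ℚ) • (Iplusn n k + Iminusn n k)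

/-- `½ (J_{l,n}^+ + J_{l,n}^- - I_{l,n}^+ - I_{l,n}^-)`. -/
def elemB (n l : ℕ) : NSym :=
  (1 / 2 : ℚ) • (Jplusn n l + Jminusn n l - Iplusn n l - Iminusn n l)

/-- `½ (J_{m,n}^+ - J_{m,n}^-)`. -/
def elemC (n m : ℕ) : NSym := (1 / 2 : ℚ) • (Jplusn n m - Jminusn n m)

end

end RunAlgebra

open RunAlgebra

/-! Consider the alternating products of `r` factors `V₁⁺`, `V₁⁻`, the sign of the last factor being
fixed. For `r` of a given parity such a product is `V₂^{⋆r/2}`, or `V₁ ⋆ V₂^{⋆(-1/2)} ⋆ V₂^{⋆r/2}`.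
Since `V₂^{⋆r/2} = exp_⋆(r · ½ log_⋆ V₂)`, its degree `n` part is a polynomial in `r`, and the
coefficient of `r^k` is one of `I_{k,n}^±`, `J_{k,n}^±` (`coeff_altProd`). Statements about these
elements thus become identities for the products, valid for all `r` of one parity, from which
coefficients are extracted (`eq_of_sum_pow_smul_eq`).

Multiplication. In the group algebra the product with `r` factors is the sum of the inverses of the
permutations sorting the labellings of `n` positions by `r` labels of alternating signs, as in
signed riffle shuffles (`toDescent_altProd`). Two successive shuffles with `a` and `b` labels amount
to one with `ab` labels (`labelSum_mul_labelSum`). Comparing coefficients of `x^k y^l` in a relation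
of the form `P(x) P(y) = P(xy)` shows that elements of different indices annihilate each other. For
one index `k`, each `I_k^±` absorbs every right factor, `J_k^+` is a left identity, and `J_k^-`
exchanges the two signs (`eulerElem_mul`). Orthogonality and idempotence of the stated combinations
are then arithmetic.

Membership. The coefficient of `σ` counts the labellings compatible with the word of ascents and
descents of `σ`. A rational generating function shows that it depends only on the number of sign
changes of that word, bordered by one sign on each side (`labelSeries_eq`,
`exists_coeff_eulerElem`). Runs and peaks determine these numbers, for the symmetric combinations up
to exchanging the two terms.

Basis. By Newton's identities `Γ` sends the product with `r` factors to `∑ r^{ℓ_o(λ)} ε^{ℓ_e(λ)} p_λ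
/ z_λ` with `ε ∈ {0, 1, -1}`, which yields the images (`Gam_coeff_IJ`). These are nonzero, so the
elements are nonzero in the group algebra, where degree `n` embeds (`eq_zero_of_toDescent_eq_zero`).
Nonzero orthogonal idempotents are independent, and each space is spanned by a family with the same
index set, so dimensions force a basis (`isOrthIdemBasis_of_le_span`). -/

namespace RunAlgebra
noncomputable section

/-! Evaluation of a rational power series at a power series without constant term. -/

section EvalAt

open PowerSeries

variable {R : Type*} [Ring R] [Algebra ℚ R]

theorem coeff_rat_smul (n : ℕ) (c : ℚ) (F : PowerSeries R) :
    coeff n (c • F) = c • coeff n F := rfl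

omit [Algebra ℚ R] in
theorem coeff_pow_eq_zero_of_lt {H : PowerSeries R} (hH : constantCoeff H = 0) :
    ∀ {n k : ℕ}, n < k → coeff n (H ^ k) = 0 := by
  intro n k
  induction k generalizing n with
  | zero => intro h; omega
  | succ k ih =>
    intro h
    rw [pow_succ, coeff_mul]
    refine Finset.sum_eq_zero fun p hp => ?_
    rw [Finset.HasAntidiagonal.mem_antidiagonal] at hp
    rcases Nat.eq_zero_or_pos p.2 with h0 | h0
    · rw [h0, coeff_zero_eq_constantCoeff_apply, hH, mul_zero]
    · rw [ih (by omega), zero_mul]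

/-- The power series `f(H)`, for `H` without constant term. -/
def evalAt (H : PowerSeries R) (f : PowerSeries ℚ) : PowerSeries R :=
  mk fun n => ∑ k ∈ Finset.range (n + 1), coeff k f • coeff n (H ^ k)

theorem coeff_evalAt {H : PowerSeries R} (hH : constantCoeff H = 0) (f : PowerSeries ℚ)
    {n N : ℕ} (h : n ≤ N) :
    coeff n (evalAt H f) = ∑ k ∈ Finset.range (N + 1), coeff k f • coeff n (H ^ k) := by
  rw [evalAt, coeff_mk]
  refine Finset.sum_subset (Finset.range_mono (by omega)) fun k _ hk => ?_
  rw [coeff_pow_eq_zero_of_lt hH (by simpa using hk), smul_zero]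

/-- The ring `R` need not be commutative: only powers of the single series `H` occur, and these
commute. This makes the usual calculus of `log` and `exp` available over `𝐒𝐲𝐦`. -/
theorem evalAt_mul {H : PowerSeries R} (hH : constantCoeff H = 0) (f g : PowerSeries ℚ) :
    evalAt H (f * g) = evalAt H f * evalAt H g := by
  ext n
  have h1 : coeff n (evalAt H f * evalAt H g) =
      ∑ i ∈ Finset.range (n + 1), ∑ j ∈ Finset.range (n + 1),
        (coeff i f * coeff j g) • coeff n (H ^ (i + j)) := by
    rw [coeff_mul]
    have : ∀ p ∈ Finset.HasAntidiagonal.antidiagonal n, coeff p.1 (evalAt H f) * coeff p.2 (evalAt H g) =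
        ∑ i ∈ Finset.range (n + 1), ∑ j ∈ Finset.range (n + 1),
          (coeff i f * coeff j g) • (coeff p.1 (H ^ i) * coeff p.2 (H ^ j)) := by
      intro p hp
      rw [Finset.HasAntidiagonal.mem_antidiagonal] at hp
      rw [coeff_evalAt hH f (show p.1 ≤ n by omega), coeff_evalAt hH g (show p.2 ≤ n by omega),
        Finset.sum_mul_sum]
      simp only [smul_mul_smul_comm]
    rw [Finset.sum_congr rfl this, Finset.sum_comm]
    refine Finset.sum_congr rfl fun i _ => ?_
    rw [Finset.sum_comm]
    refine Finset.sum_congr rfl fun j _ => ?_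
    rw [pow_add, coeff_mul, Finset.smul_sum]
  rw [h1, coeff_evalAt hH _ le_rfl]
  have h2 : ∀ i ∈ Finset.range (n + 1), ∑ j ∈ Finset.range (n + 1),
      (coeff i f * coeff j g) • coeff n (H ^ (i + j)) =
      ∑ k ∈ Finset.range (n + 1), ∑ j ∈ Finset.range (n + 1),
        if i + j = k then (coeff i f * coeff j g) • coeff n (H ^ k) else 0 := by
    intro i _
    rw [Finset.sum_comm]
    refine Finset.sum_congr rfl fun j _ => ?_
    rw [Finset.sum_ite_eq]
    split_ifs with h
    · rfl
    · rw [coeff_pow_eq_zero_of_lt hH (by simpa using h), smul_zero]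
  rw [Finset.sum_congr rfl h2, Finset.sum_comm]
  refine Finset.sum_congr rfl fun k hk => ?_
  rw [Finset.mem_range] at hk
  rw [coeff_mul, Finset.sum_smul, ← Finset.sum_product', ← Finset.sum_filter]
  refine Finset.sum_congr ?_ fun _ _ => rfl
  ext p
  simp only [Finset.HasAntidiagonal.mem_antidiagonal, Finset.mem_filter, Finset.mem_product, Finset.mem_range]
  omega

theorem evalAt_one (H : PowerSeries R) : evalAt H 1 = 1 := by
  ext n
  rw [evalAt, coeff_mk, Finset.sum_eq_single 0]
  · simp
  · intro k _ hk
    rw [coeff_one, if_neg hk, zero_smul]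
  · simp

theorem evalAt_pow {H : PowerSeries R} (hH : constantCoeff H = 0) (f : PowerSeries ℚ) (k : ℕ) :
    evalAt H (f ^ k) = evalAt H f ^ k := by
  induction k with
  | zero => rw [pow_zero, pow_zero, evalAt_one]
  | succ k ih => rw [pow_succ, evalAt_mul hH, ih, pow_succ]

theorem constantCoeff_evalAt (H : PowerSeries R) {f : PowerSeries ℚ}
    (hf : constantCoeff f = 0) : constantCoeff (evalAt H f) = 0 := by
  rw [← coeff_zero_eq_constantCoeff_apply, evalAt, coeff_mk]
  simp [hf]

theorem evalAt_evalAt {H : PowerSeries R} (hH : constantCoeff H = 0) {f : PowerSeries ℚ}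
    (hf : constantCoeff f = 0) (g : PowerSeries ℚ) :
    evalAt (evalAt H f) g = evalAt H (evalAt f g) := by
  ext n
  rw [evalAt, coeff_mk, coeff_evalAt hH _ le_rfl]
  have : ∀ k ∈ Finset.range (n + 1), coeff k g • coeff n (evalAt H f ^ k) =
      ∑ j ∈ Finset.range (n + 1), (coeff k g * coeff j (f ^ k)) • coeff n (H ^ j) := by
    intro k _
    rw [← evalAt_pow hH, coeff_evalAt hH _ le_rfl, Finset.smul_sum]
    simp only [smul_smul]
  rw [Finset.sum_congr rfl this, Finset.sum_comm]
  refine Finset.sum_congr rfl fun j hj => ?_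
  rw [Finset.mem_range] at hj
  rw [coeff_evalAt hf g (show j ≤ n by omega), Finset.sum_smul]
  rfl

theorem evalAt_one_add_X {H : PowerSeries R} (hH : constantCoeff H = 0) :
    evalAt H (1 + X) = 1 + H := by
  ext n
  rw [coeff_evalAt hH _ (Nat.le_succ n), Finset.sum_range_succ', Finset.sum_range_succ',
    Finset.sum_eq_zero]
  · simp [coeff_X, coeff_one, add_comm]
  · intro k _
    simp [coeff_X, coeff_one]

theorem evalAt_smul (H : PowerSeries R) (a : ℚ) (f : PowerSeries ℚ) :
    evalAt (a • H) f = evalAt H (rescale a f) := by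
  ext n
  rw [evalAt, evalAt, coeff_mk, coeff_mk]
  refine Finset.sum_congr rfl fun k _ => ?_
  rw [smul_pow, coeff_rat_smul, coeff_rescale, smul_smul, mul_comm]

theorem evalAt_eq_subst {f : PowerSeries ℚ} (hf : constantCoeff f = 0) (g : PowerSeries ℚ) :
    evalAt f g = g.subst f := by
  ext n
  rw [coeff_subst' (HasSubst.of_constantCoeff_zero' hf), evalAt, coeff_mk]
  rw [finsum_eq_sum_of_support_subset]
  intro k hk
  by_contra h
  refine hk ?_
  simp only [Finset.coe_range, Set.mem_Iio, not_lt] at h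
  change coeff k g • coeff n (f ^ k) = 0
  rw [coeff_pow_eq_zero_of_lt hf (by omega), smul_zero]

/-- Both sides solve `(1 + X) Y' = Y` with constant term `1`; the equation forces all coefficients
from degree `2` on to vanish. By `evalAt_evalAt` this one rational identity gives `exp_⋆ (log_⋆ G) =
G`. -/
theorem evalAt_log_exp : evalAt (PowerSeries.log ℚ) (exp ℚ) = 1 + X := by
  rw [evalAt_eq_subst constantCoeff_log]
  set Y := (exp ℚ).subst (PowerSeries.log ℚ) with hY
  have h0 : coeff 0 Y = 1 := by
    rw [hY, ← evalAt_eq_subst constantCoeff_log, evalAt, coeff_mk]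
    simp
  have hd : d⁄dX ℚ Y = Y * mk fun n => (-1 : ℚ) ^ n := by
    rw [hY, derivative_subst HasSubst.log, derivative_exp, deriv_log]
    rfl
  have hg : (mk fun n => (-1 : ℚ) ^ n) * (1 + X) = 1 := by
    ext n
    cases n with
    | zero => simp
    | succ n => simp [mul_add, coeff_succ_mul_X, coeff_one, pow_succ]
  have hd' : d⁄dX ℚ Y * (1 + X) = Y := by rw [hd, mul_assoc, hg, mul_one]
  have h1 : coeff 1 Y = 1 := by
    have := congrArg (coeff 0) hd'
    rw [mul_add, mul_one, map_add, coeff_derivative, coeff_zero_mul_X, h0] at this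
    simpa using this
  have h2 : ∀ n, coeff (n + 2) Y = 0 := by
    intro n
    induction n with
    | zero =>
      have := congrArg (coeff 1) hd'
      simp only [mul_add, mul_one, map_add, coeff_derivative, coeff_succ_mul_X, h1] at this
      norm_num at this
      simpa using this
    | succ n ih =>
      have := congrArg (coeff (n + 2)) hd'
      rw [mul_add, mul_one, map_add, coeff_derivative, coeff_succ_mul_X, coeff_derivative, ih] at this
      rw [zero_mul, add_zero] at this
      exact (mul_eq_zero.mp this).resolve_right (by positivity)
  ext n
  match n with
  | 0 => simp [h0]
  | 1 => simp [h1, coeff_one]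
  | n + 2 => simp [h2, coeff_one, coeff_X]

end EvalAt

/-! Logarithms and powers of series with constant term `1`. -/

open PowerSeries

theorem logStar_eq_evalAt (G : NSymHat) : logStar G = evalAt (G - 1) (PowerSeries.log ℚ) := by
  ext1 n
  rw [logStar, evalAt, coeff_mk, coeff_mk, Finset.range_eq_Ico, Finset.sum_eq_sum_Ico_succ_bot
    (by omega)]
  simp only [coeff_log, if_true, zero_smul, zero_add]
  refine Finset.sum_congr (by ext; simp) fun k hk => ?_
  rw [Finset.mem_Ico] at hk
  rw [if_neg (by omega)]
  congr 1
  obtain ⟨j, rfl⟩ : ∃ j, k = j + 1 := ⟨k - 1, by omega⟩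
  simp [pow_succ]

theorem expStar_eq_evalAt (F : NSymHat) : expStar F = evalAt F (exp ℚ) := by
  ext1 n
  rw [expStar, evalAt, coeff_mk, coeff_mk]
  simp [coeff_exp]

theorem constantCoeff_logStar (G : NSymHat) : constantCoeff (logStar G) = 0 := by
  rw [logStar_eq_evalAt]
  exact constantCoeff_evalAt _ constantCoeff_log

theorem powStar_eq_evalAt (G : NSymHat) (a : ℚ) :
    powStar G a = evalAt (logStar G) (rescale a (exp ℚ)) := by
  rw [powStar, expStar_eq_evalAt, evalAt_smul]

theorem powStar_mul_powStar (G : NSymHat) (a b : ℚ) :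
    powStar G a * powStar G b = powStar G (a + b) := by
  simp only [powStar_eq_evalAt]
  rw [← evalAt_mul (constantCoeff_logStar G), exp_mul_exp_eq_exp_add]

theorem powStar_one {G : NSymHat} (hG : constantCoeff G = 1) : powStar G 1 = G := by
  have h : constantCoeff (G - 1) = 0 := by rw [map_sub, hG, map_one, sub_self]
  rw [powStar_eq_evalAt, rescale_one, RingHom.id_apply, logStar_eq_evalAt,
    evalAt_evalAt h constantCoeff_log, evalAt_log_exp, evalAt_one_add_X h]
  abel

theorem powStar_natCast {G : NSymHat} (hG : constantCoeff G = 1) (m : ℕ) :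
    powStar G m = G ^ m := by
  induction m with
  | zero =>
    rw [powStar_eq_evalAt, Nat.cast_zero, pow_zero, rescale_zero_apply, constantCoeff_exp, map_one,
      evalAt_one]
  | succ m ih => rw [Nat.cast_succ, ← powStar_mul_powStar, ih, powStar_one hG, pow_succ]

/-- The coefficients of `G ^ (x / 2)` are polynomial in `x`. -/
theorem coeff_powStar_half (G : NSymHat) (x : ℚ) {n N : ℕ} (h : n ≤ N) :
    coeff n (powStar G (x / 2)) = ∑ k ∈ Finset.range (N + 1),
      x ^ k • coeff n ((1 / (k.factorial : ℚ)) • ((1 / 2 : ℚ) • logStar G) ^ k) := by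
  rw [powStar_eq_evalAt, coeff_evalAt (constantCoeff_logStar G) _ h]
  refine Finset.sum_congr rfl fun k _ => ?_
  rw [coeff_rescale, coeff_rat_smul, smul_pow, coeff_rat_smul, smul_smul, smul_smul, coeff_exp]
  congr 1
  simp only [Algebra.algebraMap_self, RingHom.id_apply]
  rw [div_pow, div_pow]
  ring

theorem coeff_mul_powStar_half (F G : NSymHat) (x : ℚ) (n : ℕ) :
    coeff n (F * powStar G (x / 2)) = ∑ k ∈ Finset.range (n + 1),
      x ^ k • coeff n (F * ((1 / (k.factorial : ℚ)) • ((1 / 2 : ℚ) • logStar G) ^ k)) := by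
  rw [coeff_mul]
  simp only [coeff_mul, Finset.smul_sum]
  rw [Finset.sum_comm]
  refine Finset.sum_congr rfl fun p hp => ?_
  rw [Finset.HasAntidiagonal.mem_antidiagonal] at hp
  rw [coeff_powStar_half G x (show p.2 ≤ n by omega), Finset.mul_sum]
  simp only [mul_smul_comm]

/-! Alternating products of `V₁⁺` and `V₁⁻`. -/

/-- `V₁⁺` for `true`, `V₁⁻` for `false`. -/
def V1 (e : Bool) : NSymHat := if e then V1plus else V1minus

/-- The sign in position `k` (counted from the end) of an alternating sequence ending with `e`. -/
def altSign (e : Bool) (k : ℕ) : Bool := if Even k then e else !e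

theorem altSign_zero (e : Bool) : altSign e 0 = e := rfl

theorem altSign_succ (e : Bool) (k : ℕ) : altSign e (k + 1) = !altSign e k := by
  rw [altSign, altSign]
  by_cases h : Even k <;> simp [h, Nat.even_add_one]

/-- The alternating product of `r` factors `V₁⁺` and `V₁⁻` whose last factor has sign `e`. -/
def altProd (e : Bool) : ℕ → NSymHat
  | 0 => 1
  | r + 1 => V1 (altSign e r) * altProd e r

/-- `V₂⁻` for `true`, `V₂⁺` for `false`. -/
def V2 (e : Bool) : NSymHat := if e then V2minus else V2plus

theorem V2_eq (e : Bool) : V2 e = V1 (!e) * V1 e := by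
  cases e <;> simp [V2, V1, V2plus, V2minus]

theorem altProd_even (e : Bool) (m : ℕ) : altProd e (2 * m) = V2 e ^ m := by
  induction m with
  | zero => rfl
  | succ m ih =>
    rw [show 2 * (m + 1) = 2 * m + 1 + 1 by ring, altProd, altProd, ih, pow_succ', V2_eq, mul_assoc,
      altSign_succ]
    simp [altSign]

theorem altProd_odd (e : Bool) (m : ℕ) : altProd e (2 * m + 1) = V1 e * V2 e ^ m := by
  rw [altProd, altProd_even]
  simp [altSign]

/-- `I_k^∓` for parity `0`, `J_k^±` for parity `1`. -/
def IJ (e odd : Bool) (k : ℕ) : NSymHat :=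
  if odd then (if e then Jplus k else Jminus k) else (if e then Iminus k else Iplus k)

theorem IJ_even (e : Bool) (k : ℕ) :
    IJ e false k = (1 / (k.factorial : ℚ)) • ((1 / 2 : ℚ) • logStar (V2 e)) ^ k := by
  cases e <;> rfl

theorem IJ_odd (e : Bool) (k : ℕ) :
    IJ e true k = V1 e * powStar (V2 e) (-1 / 2) *
      ((1 / (k.factorial : ℚ)) • ((1 / 2 : ℚ) • logStar (V2 e)) ^ k) := by
  cases e <;> rfl

instance subsingleton_composition_zero : Subsingleton (Composition 0) :=
  Fintype.card_le_one_iff_subsingleton.mp (by simp [composition_card])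

theorem ribbonR_zero (I : Composition 0) : ribbonR I = 1 := by
  have hI : I = Composition.ones 0 := Subsingleton.elim _ _
  subst hI
  rw [ribbonR, Finset.sum_eq_single (Composition.ones 0)]
  · simp [completeS, compWord, MonoidAlgebra.one_def]
    rfl
  · intro J _ hJ
    exact (hJ (Subsingleton.elim _ _)).elim
  · simp

theorem constantCoeff_V1 (e : Bool) : constantCoeff (V1 e) = 1 := by
  rw [← coeff_zero_eq_constantCoeff_apply]
  cases e
  · change coeff 0 V1minus = 1
    rw [V1minus, coeff_mk, ribbonR_zero]
  · change coeff 0 V1plus = 1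
    rw [V1plus, coeff_mk, ribbonR_zero]

theorem constantCoeff_V2 (e : Bool) : constantCoeff (V2 e) = 1 := by
  rw [V2_eq, map_mul, constantCoeff_V1, constantCoeff_V1, mul_one]

/-- The degree `n` parts of the alternating products with `r` factors are polynomial in `r`, for
`r` of a given parity. -/
theorem coeff_altProd (e odd : Bool) (m n : ℕ) :
    coeff n (altProd e (2 * m + odd.toNat)) = ∑ k ∈ Finset.range (n + 1),
      ((2 * m + odd.toNat : ℕ) : ℚ) ^ k • coeff n (IJ e odd k) := by
  cases odd
  · simp only [Bool.toNat_false, add_zero, IJ_even]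
    rw [← coeff_powStar_half _ _ le_rfl, altProd_even, ← powStar_natCast (constantCoeff_V2 e)]
    congr 2
    push_cast
    ring
  · simp only [Bool.toNat_true, IJ_odd]
    -- The exponents add up to `-1/2 + (2m + 1)/2 = m`: the factor `V₂^{⋆(-1/2)}` in the definition
    -- of `J_k` is what makes the variable equal to the number of factors.
    rw [← coeff_mul_powStar_half, mul_assoc, powStar_mul_powStar, altProd_odd,
      ← powStar_natCast (constantCoeff_V2 e)]
    congr 3
    push_cast
    ring

end
end RunAlgebra

namespace RunAlgebra
noncomputable section

/-! Vector-valued polynomials with infinitely many zeros. -/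

section VectorPolynomial

variable {V : Type*} [AddCommGroup V] [Module ℚ V]

/-- Linear functionals separate the points of a rational vector space, which reduces the claim to
scalar polynomials. -/
theorem eq_zero_of_sum_pow_smul_eq_zero {s : Set ℚ} (hs : s.Infinite) {N : ℕ} {c : ℕ → V}
    (h : ∀ x ∈ s, ∑ k ∈ Finset.range N, x ^ k • c k = 0) {k : ℕ} (hk : k < N) : c k = 0 := by
  rw [← Module.forall_dual_apply_eq_zero_iff ℚ]
  intro f
  set p : Polynomial ℚ := ∑ k ∈ Finset.range N, Polynomial.monomial k (f (c k)) with hp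
  have h0 : p = 0 := by
    refine Polynomial.eq_zero_of_infinite_isRoot p (hs.mono fun x hx => ?_)
    have := congrArg f (h x hx)
    rw [map_sum, map_zero] at this
    simp only [map_smul, smul_eq_mul] at this
    rw [Set.mem_ofPred_eq, Polynomial.IsRoot, hp, Polynomial.eval_finsetSum, ← this]
    exact Finset.sum_congr rfl fun k _ => by rw [Polynomial.eval_monomial, mul_comm]
  have := congrArg (fun q => Polynomial.coeff q k) h0
  simpa [hp, Polynomial.coeff_monomial, hk] using this

theorem eq_of_sum_pow_smul_eq {s : Set ℚ} (hs : s.Infinite) {N : ℕ} {c d : ℕ → V}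
    (h : ∀ x ∈ s, ∑ k ∈ Finset.range N, x ^ k • c k = ∑ k ∈ Finset.range N, x ^ k • d k)
    {k : ℕ} (hk : k < N) : c k = d k := by
  refine sub_eq_zero.mp (eq_zero_of_sum_pow_smul_eq_zero (c := fun k => c k - d k) hs
    (fun x hx => ?_) hk)
  simp only [smul_sub, Finset.sum_sub_distrib, h x hx, sub_self]

/-- A polynomial in `x` and `y` that is a function of `xy` has only diagonal monomials. This is the
source of orthogonality. -/
theorem eq_of_sum_pow_mul_pow_smul_eq {s t : Set ℚ} (hs : s.Infinite) (ht : t.Infinite) {N : ℕ}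
    {c : ℕ → ℕ → V} {d : ℕ → V}
    (h : ∀ x ∈ s, ∀ y ∈ t, ∑ k ∈ Finset.range N, ∑ l ∈ Finset.range N, (x ^ k * y ^ l) • c k l =
      ∑ k ∈ Finset.range N, (x * y) ^ k • d k)
    {k l : ℕ} (hk : k < N) (hl : l < N) : c k l = if k = l then d k else 0 := by
  have h1 : ∀ y ∈ t, ∑ l ∈ Finset.range N, y ^ l • c k l = y ^ k • d k := fun y hy =>
    eq_of_sum_pow_smul_eq hs (c := fun k => ∑ l ∈ Finset.range N, y ^ l • c k l)
      (d := fun k => y ^ k • d k) (fun x hx => by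
        simpa only [Finset.smul_sum, smul_smul, mul_pow] using h x hx y hy) hk
  refine eq_of_sum_pow_smul_eq ht (d := fun l => if k = l then d k else 0) (fun y hy => ?_) hl
  rw [h1 y hy]
  simp [hk]

end VectorPolynomial

/-- The natural numbers of a given parity. -/
theorem infinite_parity (odd : Bool) :
    {x : ℚ | ∃ m : ℕ, x = ((2 * m + odd.toNat : ℕ) : ℚ)}.Infinite := by
  refine Set.infinite_of_injective_forall_mem (f := fun m : ℕ => ((2 * m + odd.toNat : ℕ) : ℚ))
    (fun a b h => ?_) fun m => ⟨m, rfl⟩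
  have : 2 * a + odd.toNat = 2 * b + odd.toNat := Nat.cast_injective h
  omega

/-! The number of monotone labellings of a sequence of ascents and descents by alternating signs. -/

/-- The number of weakly decreasing sequences of labels in `{0, …, p - 1}`, one label more than
letters in the word, two consecutive labels being allowed to be equal if and only if the letter
between them is the sign of the label; the signs alternate, and that of `0` is `e`. -/
def labelCount (e : Bool) : ℕ → List Bool → ℕ
  | p, [] => p
  | p, a :: w => ∑ i ∈ Finset.range p, labelCount e (if altSign e i = a then i + 1 else i) w

theorem labelCount_nil (e : Bool) (p : ℕ) : labelCount e p [] = p := by rw [labelCount]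

theorem labelCount_zero (e : Bool) (w : List Bool) : labelCount e 0 w = 0 := by
  cases w <;> simp [labelCount]

theorem labelCount_succ (e a : Bool) (p : ℕ) (w : List Bool) :
    labelCount e (p + 1) (a :: w) =
      labelCount e p (a :: w) + labelCount e (if altSign e p = a then p + 1 else p) w := by
  rw [labelCount, labelCount, Finset.sum_range_succ]

/-- The number of changes in the word `x :: w`. -/
def changes : Bool → List Bool → ℕ
  | _, [] => 0
  | x, a :: w => (if x = a then 0 else 1) + changes a w

theorem changes_le (x : Bool) (w : List Bool) : changes x w ≤ w.length := by
  induction w generalizing x with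
  | nil => simp [changes]
  | cons a w ih =>
    have := ih a
    simp only [changes, List.length_cons]
    split_ifs <;> omega

/-- The word starts with `x` and ends with `e`, and every change flips the sign. -/
theorem even_changes_concat (x e : Bool) (w : List Bool) :
    Even (changes x (w ++ [e])) ↔ x = e := by
  induction w generalizing x with
  | nil => cases x <;> cases e <;> simp [changes]
  | cons a w ih =>
    rw [List.cons_append, changes, Nat.even_add, ih a]
    cases x <;> cases e <;> cases a <;> simp

open PowerSeries in
/-- The generating function of the label counts whose first label has sign `x`. -/
def labelSeries (e x : Bool) (w : List Bool) : PowerSeries ℤ :=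
  mk fun q => (labelCount e (2 * q + if x = e then 1 else 0) w : ℤ)

open PowerSeries

theorem altSign_two_mul (e : Bool) (q : ℕ) : altSign e (2 * q) = e := by simp [altSign]

theorem altSign_two_mul_add_one (e : Bool) (q : ℕ) : altSign e (2 * q + 1) = !e := by
  rw [altSign_succ, altSign_two_mul]

theorem labelSeries_nil (e x : Bool) :
    (1 - X) ^ 2 * labelSeries e x [] = if x = e then 1 + X else 2 * X := by
  have h : (1 - X : PowerSeries ℤ) ^ 2 = 1 - X - X + X * X := by ring
  ext q
  rw [h]
  match q with
  | 0 =>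
    split_ifs with h1 <;>
    simp [labelSeries, labelCount_nil, h1]
  | 1 =>
    split_ifs with h1 <;>
    simp [labelSeries, labelCount_nil, h1, sub_mul, add_mul, coeff_one, mul_assoc, two_mul, show ∀ F : PowerSeries ℤ, coeff 1 (X * F) = coeff 0 F from coeff_succ_X_mul 0]
  | q + 2 =>
    split_ifs with h1 <;>
    simp [labelSeries, labelCount_nil, h1, sub_mul, add_mul, coeff_one, mul_assoc, coeff_X,
      coeff_succ_X_mul, two_mul] <;> ring

/-- Multiplying by `1 - X` isolates the two largest possible first labels `p - 1` and `p - 2`. The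
larger has sign `x`, agrees with the letter and leaves `p` choices for the next label; the smaller
disagrees and leaves `p - 2`. -/
theorem labelSeries_cons_self (e x : Bool) (w : List Bool) :
    (1 - X) * labelSeries e x (x :: w) = (1 + X) * labelSeries e x w := by
  ext q
  simp only [sub_mul, add_mul, one_mul, map_sub, map_add]
  by_cases h : x = e
  · subst h
    cases q with
    | zero => simp [labelSeries, labelCount_succ, labelCount_zero, altSign_zero]
    | succ q =>
      simp only [labelSeries, coeff_succ_X_mul, coeff_mk, if_true, mul_add, mul_one,
        labelCount_succ, altSign_two_mul, altSign_two_mul_add_one]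
      simp
      ring
  · obtain rfl : x = !e := by cases x <;> cases e <;> simp_all
    cases q with
    | zero => simp [labelSeries, labelCount_zero]
    | succ q =>
      simp only [labelSeries, coeff_succ_X_mul, coeff_mk, if_neg h, mul_add, mul_one,
        labelCount_succ, altSign_two_mul, altSign_two_mul_add_one, add_zero]
      simp
      ring

/-- Here the label `p - 1` disagrees with the letter and `p - 2` agrees with it, so both leave the
same `p - 1` choices; hence the factor `2`. The parity of the bound changes, which costs a shift by
`X` unless `x = e`. -/
theorem labelSeries_cons_not (e x : Bool) (w : List Bool) :
    (1 - X) * labelSeries e x ((!x) :: w) =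
      (if x = e then 2 else 2 * X) * labelSeries e (!x) w := by
  have h2 : ∀ F : PowerSeries ℤ, 2 * F = F + F := two_mul
  ext q
  simp only [sub_mul, one_mul, map_sub]
  by_cases h : x = e
  · subst h
    cases q with
    | zero => simp [labelSeries, labelCount_succ, labelCount_zero, altSign_zero, h2]
    | succ q =>
      simp only [labelSeries, coeff_succ_X_mul, coeff_mk, if_true, mul_add, mul_one, h2, map_add,
        labelCount_succ, altSign_two_mul, altSign_two_mul_add_one]
      simp
      ring
  · obtain rfl : x = !e := by cases x <;> cases e <;> simp_all
    cases q with
    | zero => simp [labelSeries, labelCount_zero]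
    | succ q =>
      simp only [labelSeries, coeff_succ_X_mul, coeff_mk, if_neg h, mul_add, mul_one, h2,
        add_mul, map_add,
        labelCount_succ, altSign_two_mul, altSign_two_mul_add_one, add_zero]
      simp
      ring

/-- With `c` changes, each repeated letter contributes `(1 + X)/(1 - X)` and each change `2/(1 - X)`
or `2X/(1 - X)` alternately. Only the length and `c` survive. The powers of `1 ± X` are cleared to
stay within power series over `ℤ`. -/
theorem labelSeries_eq (e x : Bool) (w : List Bool) :
    (1 - X) ^ (w.length + 2) * labelSeries e x w * (1 + X) ^ changes x (w ++ [e]) =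
      (1 + X) ^ (w.length + 1) * 2 ^ changes x (w ++ [e]) *
        X ^ ((changes x (w ++ [e]) + 1) / 2) := by
  induction w generalizing x with
  | nil =>
    simp only [List.length_nil, List.nil_append, changes, zero_add, labelSeries_nil]
    split_ifs <;> simp
    ring
  | cons a w ih =>
    rcases Bool.eq_or_eq_not a x with rfl | rfl
    · rw [List.cons_append, changes, if_pos rfl, zero_add, List.length_cons, pow_succ _ (_ + 1 + 1),
        pow_succ _ (w.length + 1)]
      have := ih a
      calc _ = (1 - X) ^ (w.length + 2) * ((1 - X) * labelSeries e a (a :: w)) *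
            (1 + X) ^ changes a (w ++ [e]) := by ring
        _ = _ := by
          rw [labelSeries_cons_self]
          linear_combination (1 + X) * this
    · have := ih (!x)
      have hp := even_changes_concat (!x) e w
      rw [List.cons_append, changes, if_neg (by simp), List.length_cons]
      set c := changes (!x) (w ++ [e])
      -- The rounded exponent increases exactly when `c` is even, and by parity this is the case `x
      -- ≠ e`.
      have hc : (X : PowerSeries ℤ) ^ ((1 + c + 1) / 2) = (if x = e then 1 else X) *
          X ^ ((c + 1) / 2) := by
        split_ifs with h
        · rw [one_mul]
          have : ¬ Even c := fun h' => by
            rw [hp, h] at h'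
            simp at h'
          rw [Nat.not_even_iff_odd] at this
          obtain ⟨d, hd⟩ := this
          congr 1
          omega
        · rw [← pow_succ']
          obtain ⟨d, hd⟩ := hp.mpr (by cases x <;> cases e <;> simp_all)
          congr 1
          omega
      calc _ = (1 - X) ^ (w.length + 2) * ((1 - X) * labelSeries e x ((!x) :: w)) *
            (1 + X) ^ c * (1 + X) := by ring
        _ = _ := by
          rw [labelSeries_cons_not, hc]
          have h2 : (if x = e then 2 else 2 * X : PowerSeries ℤ) =
            2 * if x = e then 1 else X := by split_ifs <;> ring
          rw [h2]
          linear_combination (1 + X) * (2 * if x = e then 1 else X) * this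

/-- The number of labellings depends only on the number of labels, the number of letters, and the
number of changes of sign. -/
theorem labelCount_eq_of_changes_eq {e e' odd : Bool} {w w' : List Bool}
    (hl : w.length = w'.length)
    (hc : changes (e == odd) (w ++ [e]) = changes (e' == odd) (w' ++ [e'])) (m : ℕ) :
    labelCount e (2 * m + odd.toNat) w = labelCount e' (2 * m + odd.toNat) w' := by
  have h1 := labelSeries_eq e (e == odd) w
  have h2 := labelSeries_eq e' (e' == odd) w'
  rw [hl, hc] at h1
  rw [← h2] at h1
  have hne : ((1 + X : PowerSeries ℤ)) ≠ 0 := fun h => by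
    simpa using congrArg (coeff 0) h
  have hne' : ((1 - X : PowerSeries ℤ)) ≠ 0 := fun h => by
    simpa using congrArg (coeff 0) h
  have h3 := mul_left_cancel₀ (pow_ne_zero _ hne') (mul_right_cancel₀ (pow_ne_zero _ hne) h1)
  have h4 := congrArg (coeff m) h3
  simp only [labelSeries, coeff_mk, Nat.cast_inj] at h4
  cases odd <;> cases e <;> cases e' <;> simpa using h4

end
end RunAlgebra

namespace RunAlgebra
noncomputable section

open PowerSeries

/-! Compositions as words. -/

/-- The sum of the letters of a word. -/
def weight (W : FreeMonoid ℕ+) : ℕ := (W.toList.map fun i : ℕ+ => (i : ℕ)).sum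

theorem weight_one : weight 1 = 0 := rfl

theorem weight_of_mul (k : ℕ+) (W : FreeMonoid ℕ+) : weight (.of k * W) = k + weight W := by
  simp [weight]

theorem map_compWord {n : ℕ} (I : Composition n) :
    (compWord I).toList.map (fun i : ℕ+ => (i : ℕ)) = I.blocks := by
  have h : ∀ (l : List ℕ) (H : ∀ i ∈ l, 0 < i),
      (l.pmap (fun i hi => (⟨i, hi⟩ : ℕ+)) H).map (fun i : ℕ+ => (i : ℕ)) = l := by
    intro l
    induction l with
    | nil => intro _; rfl
    | cons a l ih => intro H; exact congrArg (List.cons a) (ih _)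
  exact h _ _

theorem weight_compWord {n : ℕ} (I : Composition n) : weight (compWord I) = n := by
  rw [weight, map_compWord, I.blocks_sum]

theorem compWord_injective (n : ℕ) : Function.Injective (compWord (n := n)) := fun I J h => by
  ext1
  rw [← map_compWord, ← map_compWord, h]

theorem exists_compWord_eq {n : ℕ} {W : FreeMonoid ℕ+} (h : weight W = n) :
    ∃ I : Composition n, compWord I = W := by
  refine ⟨⟨W.toList.map fun i : ℕ+ => (i : ℕ), ?_, h⟩, ?_⟩
  · intro i hi
    obtain ⟨k, _, rfl⟩ := List.mem_map.mp hi
    exact k.pos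
  · apply FreeMonoid.toList.injective
    exact List.map_injective_iff.mpr PNat.coe_injective (map_compWord _)

theorem length_compWord {n : ℕ} (I : Composition n) : (compWord I).toList.length = I.length := by
  rw [← List.length_map (fun i : ℕ+ => (i : ℕ)), map_compWord]

/-- The generator `S_n`, with `S_0 = 1`. -/
def genS (n : ℕ) : NSym :=
  if h : 0 < n then MonoidAlgebra.single (.of (n.toPNat h)) 1 else 1

theorem mem_compDes {n : ℕ} {I : Composition n} {m : ℕ} :
    m ∈ compDes I ↔ ∃ j, 1 ≤ j ∧ j < I.length ∧ I.sizeUpTo j = m := by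
  simp [compDes, and_assoc]

theorem compDes_bounds {n : ℕ} {I : Composition n} {m : ℕ} (h : m ∈ compDes I) :
    1 ≤ m ∧ m < n := by
  obtain ⟨j, h1, h2, rfl⟩ := mem_compDes.mp h
  constructor
  · have := I.sizeUpTo_strict_mono (i := 0) (by omega)
    have h3 := I.monotone_sizeUpTo (show 0 + 1 ≤ j from h1)
    omega
  · have := I.sizeUpTo_strict_mono h2
    have h3 := I.sizeUpTo_le (j + 1)
    omega

theorem compDes_ones (n : ℕ) : compDes (Composition.ones n) = Finset.Ico 1 n := by
  ext m
  rw [mem_compDes, Finset.mem_Ico]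
  constructor
  · rintro ⟨j, h1, h2, rfl⟩
    rw [Composition.ones_length] at h2
    rw [Composition.ones_sizeUpTo]
    omega
  · rintro ⟨h1, h2⟩
    exact ⟨m, h1, by rwa [Composition.ones_length], by rw [Composition.ones_sizeUpTo]; omega⟩

theorem ribbonR_rowComp (n : ℕ) : ribbonR (rowComp n) = genS n := by
  cases n with
  | zero => rw [ribbonR_zero]; rfl
  | succ n =>
    have hn : 0 < n + 1 := n.succ_pos
    change ribbonR (Composition.single (n + 1) hn) = _
    have hdes : compDes (Composition.single (n + 1) hn) = ∅ := by
      simp [compDes]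
    rw [ribbonR, hdes, Finset.sum_eq_single (Composition.single (n + 1) hn)]
    · rw [sub_self, zpow_zero, one_smul, genS, dif_pos hn]
      rfl
    · intro J hJ hne
      refine (hne ?_).elim
      rw [Finset.mem_filter, Finset.subset_empty] at hJ
      rw [Composition.eq_single_iff_length]
      have h1 : 0 < J.length := J.length_pos_of_pos hn
      by_contra h2
      have h3 : J.sizeUpTo 1 ∈ compDes J := mem_compDes.mpr ⟨1, le_rfl, by omega, rfl⟩
      rw [hJ.2] at h3
      simp at h3
    · intro h
      refine (h ?_).elim
      simp [hdes]

theorem coeff_ribbonR_ones (n : ℕ) (W : FreeMonoid ℕ+) :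
    (ribbonR (Composition.ones n)).coeff W =
      if weight W = n then (-1 : ℚ) ^ (W.toList.length + n) else 0 := by
  classical
  have hfilter : ∀ J : Composition n, compDes J ⊆ compDes (Composition.ones n) := fun J m hm => by
    rw [compDes_ones, Finset.mem_Ico]
    exact compDes_bounds hm
  rw [ribbonR, Finset.filter_true_of_mem fun J _ => hfilter J, MonoidAlgebra.coeff_sum,
    Finsupp.finsetSum_apply]
  have hterm : ∀ J : Composition n,
      (((-1 : ℚ) ^ ((J.length : ℤ) - ((Composition.ones n).length : ℤ)) • completeS J : NSym)).coeff W
        = if compWord J = W then (-1 : ℚ) ^ (J.length + n) else 0 := by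
    intro J
    rw [MonoidAlgebra.coeff_smul_apply, completeS, MonoidAlgebra.coeff_single,
      Finsupp.single_apply, Composition.ones_length]
    split_ifs
    · rw [smul_eq_mul, mul_one, zpow_sub₀ (by norm_num), zpow_natCast, zpow_natCast, pow_add,
        div_eq_mul_inv, ← inv_pow]
      norm_num
    · rw [smul_zero]
  rw [Finset.sum_congr rfl fun J _ => hterm J]
  split_ifs with h
  · obtain ⟨I, rfl⟩ := exists_compWord_eq h
    rw [Finset.sum_eq_single I]
    · rw [if_pos rfl, length_compWord]
    · intro J _ hJ
      rw [if_neg fun h' => hJ (compWord_injective n h')]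
    · simp
  · refine Finset.sum_eq_zero fun J _ => if_neg ?_
    rintro rfl
    exact h (weight_compWord J)

/-- `∑ (-1)^n R_{(1^n)}`, the inverse of `V₁⁺`. -/
def V1inv : NSymHat := PowerSeries.mk fun n => (-1 : ℚ) ^ n • ribbonR (Composition.ones n)

theorem coeff_V1inv (n : ℕ) (W : FreeMonoid ℕ+) :
    (coeff n V1inv).coeff W = if weight W = n then (-1 : ℚ) ^ W.toList.length else 0 := by
  rw [V1inv, coeff_mk, MonoidAlgebra.coeff_smul_apply, coeff_ribbonR_ones]
  split_ifs
  · rw [smul_eq_mul, pow_add, mul_left_comm, ← pow_add, ← two_mul, pow_mul]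
    norm_num
  · rw [smul_zero]

theorem coeff_genS_mul (i : ℕ) (hi : 0 < i) (F : NSym) :
    (genS i * F).coeff 1 = 0 ∧ ∀ (k : ℕ+) (W : FreeMonoid ℕ+),
      (genS i * F).coeff (.of k * W) = if i = k then F.coeff W else 0 := by
  rw [genS, dif_pos hi]
  constructor
  · refine MonoidAlgebra.coeff_single_mul_of_forall_mul_ne _ _ fun d hd => ?_
    simpa using congrArg (fun W => W.toList.length) hd
  · intro k W
    split_ifs with h
    · rw [MonoidAlgebra.coeff_single_mul_eq_mul_coeff W, one_mul]
      intro m' _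
      have : i.toPNat hi = k := PNat.eq h
      rw [this]
      exact mul_right_inj _
    · refine MonoidAlgebra.coeff_single_mul_of_forall_mul_ne _ _ fun d hd => h ?_
      have := congrArg (fun W => W.toList) hd
      simp only [FreeMonoid.toList_of_mul, List.cons.injEq] at this
      rw [← this.1]
      rfl

/-- A word `k W` receives two contributions: its own coefficient, from the term `S_0 = 1`, and that
of `W`, from the term `S_k`. The lengths differ by one, so the signs cancel. -/
theorem V1plus_mul_V1inv : V1plus * V1inv = 1 := by
  have h0 : ∀ n, coeff n V1plus = genS n := fun n => by rw [V1plus, coeff_mk, ribbonR_rowComp]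
  have hg0 : genS 0 = 1 := rfl
  ext1 n
  cases n with
  | zero =>
    rw [coeff_mul, Finset.HasAntidiagonal.antidiagonal_zero, Finset.sum_singleton, h0, hg0, one_mul, V1inv, coeff_mk,
      ribbonR_zero, pow_zero, one_smul, coeff_one, if_pos rfl]
  | succ n =>
    rw [coeff_mul, Finset.Nat.sum_antidiagonal_succ, h0, hg0, one_mul, coeff_one,
      if_neg n.succ_ne_zero]
    refine MonoidAlgebra.coeff_injective (Finsupp.ext fun W => ?_)
    rw [MonoidAlgebra.coeff_add, Finsupp.add_apply, MonoidAlgebra.coeff_sum, Finsupp.finsetSum_apply,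
      coeff_V1inv]
    simp only [h0]
    induction W using FreeMonoid.casesOn with
    | one =>
      rw [if_neg (by rw [weight_one]; omega), Finset.sum_eq_zero]
      · simp
      · intro p _
        exact (coeff_genS_mul _ (Nat.succ_pos _) _).1
    | of_mul k W =>
      have h2 : ∀ p : ℕ × ℕ, (genS (p.1 + 1) * coeff p.2 V1inv).coeff (.of k * W) =
          if p.1 + 1 = k ∧ weight W = p.2 then (-1 : ℚ) ^ W.toList.length else 0 := by
        intro p
        rw [(coeff_genS_mul _ (Nat.succ_pos _) _).2, coeff_V1inv]
        split_ifs <;> simp_all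
      rw [Finset.sum_congr rfl fun p _ => h2 p, weight_of_mul]
      split_ifs with h
      · rw [Finset.sum_eq_single ((k : ℕ) - 1, weight W)]
        · have := k.pos
          rw [if_pos ⟨by simp; omega, rfl⟩, FreeMonoid.toList_of_mul, List.length_cons, pow_succ]
          simp
        · rintro ⟨a, b⟩ _ hne
          refine if_neg fun h' => hne ?_
          simp only at h'
          rw [← h'.1, h'.2]
          rfl
        · intro hm
          refine (hm ?_).elim
          have := k.pos
          rw [Finset.HasAntidiagonal.mem_antidiagonal]
          simp only
          omega
      · rw [Finset.sum_eq_zero, zero_add]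
        · simp
        · intro p hp
          rw [Finset.HasAntidiagonal.mem_antidiagonal] at hp
          exact if_neg fun h' => h (by omega)

end
end RunAlgebra

namespace RunAlgebra
noncomputable section

open PowerSeries

theorem coeff_V1plus (n : ℕ) : coeff n V1plus = genS n := by
  rw [V1plus, coeff_mk, ribbonR_rowComp]

/-! The action of noncommutative symmetric functions on functions on positions. -/

/-- All letters of `l` strictly between the positions `i ≤ ⋯ < j` are equal to `s`. -/
def IsMono (l : ℕ → Bool) (s : Bool) (i j : ℕ) : Prop := ∀ a, i ≤ a → a + 1 < j → l a = s

theorem isMono_of_le {l : ℕ → Bool} {s : Bool} {i j : ℕ} (h : j ≤ i + 1) : IsMono l s i j :=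
  fun a h1 h2 => by omega

theorem isMono_iff {l : ℕ → Bool} {s : Bool} {i j : ℕ} (h : i + 1 < j) :
    IsMono l s i j ↔ l i = s ∧ IsMono l s (i + 1) j := by
  constructor
  · exact fun H => ⟨H i le_rfl h, fun a h1 h2 => H a (by omega) h2⟩
  · rintro ⟨h0, H⟩ a h1 h2
    rcases h1.eq_or_lt with rfl | h1
    · exact h0
    · exact H a h1 h2

open Classical in
/-- The operator shifting by `k` along monotone factors. -/
def stepOp (l : ℕ → Bool) (s : Bool) (k : ℕ) : Module.End ℚ (ℕ → ℚ) where
  toFun f i := if IsMono l s i (i + k) then f (i + k) else 0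
  map_add' f g := by
    ext i
    simp only [Pi.add_apply]
    split_ifs <;> simp
  map_smul' c f := by
    ext i
    simp

open Classical in
theorem stepOp_apply (l : ℕ → Bool) (s : Bool) (k : ℕ) (f : ℕ → ℚ) (i : ℕ) :
    stepOp l s k f i = if IsMono l s i (i + k) then f (i + k) else 0 := rfl

theorem stepOp_zero (l : ℕ → Bool) (s : Bool) : stepOp l s 0 = 1 := by
  ext f i
  simp [stepOp_apply, isMono_of_le]

/-- The representation in which `S_k` shifts by `k` along ascending factors. -/
def stepRep (l : ℕ → Bool) : NSym →ₐ[ℚ] Module.End ℚ (ℕ → ℚ) :=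
  MonoidAlgebra.lift ℚ _ (FreeMonoid ℕ+) (FreeMonoid.lift fun k : ℕ+ => stepOp l true k)

theorem stepRep_genS (l : ℕ → Bool) (k : ℕ) : stepRep l (genS k) = stepOp l true k := by
  rw [genS]
  split_ifs with h
  · rw [stepRep, MonoidAlgebra.lift_single, one_smul, FreeMonoid.lift_eval_of]
    rfl
  · obtain rfl : k = 0 := by omega
    rw [map_one, stepOp_zero]

-- Signed count of the cuts of an interval into a descending and then an ascending factor. If the
-- first letter is a descent, the first position joins the descending factor and the induction
-- applies. If it is an ascent, only the cuts of descending length `0` and `1` can occur, and they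
-- cancel.
open Classical in
theorem sum_desc_asc (l : ℕ → Bool) (n i : ℕ) :
    ∑ p ∈ Finset.HasAntidiagonal.antidiagonal (n + 1), ((-1 : ℚ) ^ p.1 *
      if IsMono l false i (i + p.1) ∧ IsMono l true (i + p.1) (i + (n + 1)) then 1 else 0) = 0 := by
  induction n generalizing i with
  | zero => simp [Finset.Nat.sum_antidiagonal_succ, isMono_of_le]
  | succ n ih =>
    rw [Finset.Nat.sum_antidiagonal_succ]
    cases h : l i
    · have h1 : ¬ IsMono l true i (i + (n + 1 + 1)) := by
        rw [isMono_iff (by omega), h]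
        simp
      have h2 : ∀ p ∈ Finset.HasAntidiagonal.antidiagonal (n + 1),
          ((-1 : ℚ) ^ (p.1 + 1) * if IsMono l false i (i + (p.1 + 1)) ∧
            IsMono l true (i + (p.1 + 1)) (i + (n + 1 + 1)) then 1 else 0) =
          (-1) * ((-1 : ℚ) ^ p.1 * if IsMono l false (i + 1) (i + 1 + p.1) ∧
            IsMono l true (i + 1 + p.1) (i + 1 + (n + 1)) then 1 else 0) := by
        intro p _
        have h3 : IsMono l false i (i + (p.1 + 1)) ↔ IsMono l false (i + 1) (i + 1 + p.1) := by
          rcases Nat.eq_zero_or_pos p.1 with h0 | h0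
          · rw [h0]
            exact iff_of_true (isMono_of_le (by omega)) (isMono_of_le (by omega))
          · rw [isMono_iff (by omega), h, show i + (p.1 + 1) = i + 1 + p.1 by ring]
            simp
        rw [h3, show i + (p.1 + 1) = i + 1 + p.1 by ring,
          show i + (n + 1 + 1) = i + 1 + (n + 1) by ring]
        ring
      rw [Finset.sum_congr rfl h2, ← Finset.mul_sum, ih]
      simp [h1]
    · rw [Finset.Nat.sum_antidiagonal_succ, Finset.sum_eq_zero]
      · have h1 : IsMono l true i (i + (n + 1 + 1)) ↔
            IsMono l true (i + (0 + 1)) (i + (n + 1 + 1)) := by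
          rw [isMono_iff (by omega), h]
          simp
        have h2 : IsMono l false i (i + (0 + 1)) := isMono_of_le (by omega)
        have h3 : IsMono l false i (i + 0) := isMono_of_le (by omega)
        simp only [h2, h3, true_and]
        simp only [add_zero]
        rw [← h1]
        ring
      · intro p _
        rw [if_neg, mul_zero]
        rw [isMono_iff (by omega), h]
        simp

/-- The generating series `A` of the ascending shifts has the image of `V1inv` as right inverse and,
by `sum_desc_asc`, the signed series `D` of the descending shifts as left inverse. The two inverses
coincide. -/
theorem stepRep_ribbonR_ones (l : ℕ → Bool) (k : ℕ) :
    stepRep l (ribbonR (Composition.ones k)) = stepOp l false k := by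
  classical
  set A : PowerSeries (Module.End ℚ (ℕ → ℚ)) := mk fun k => stepOp l true k with hA
  set D : PowerSeries (Module.End ℚ (ℕ → ℚ)) := mk fun k => (-1 : ℚ) ^ k • stepOp l false k with hD
  have hAB : A * PowerSeries.map (stepRep l : NSym →+* _) V1inv = 1 := by
    rw [← map_one (PowerSeries.map (stepRep l : NSym →+* _)), ← V1plus_mul_V1inv, map_mul]
    congr 1
    ext1 k
    rw [hA, coeff_mk, coeff_map, coeff_V1plus]
    exact (stepRep_genS l k).symm
  have hDA : D * A = 1 := by
    ext1 n
    cases n with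
    | zero => simp [hA, hD, stepOp_zero]
    | succ n =>
      rw [coeff_mul, coeff_one, if_neg n.succ_ne_zero]
      ext1 f
      ext1 i
      rw [LinearMap.sum_apply, Finset.sum_apply, LinearMap.zero_apply, Pi.zero_apply]
      have h1 : ∀ p ∈ Finset.HasAntidiagonal.antidiagonal (n + 1),
          ((coeff p.1 D * coeff p.2 A : Module.End ℚ (ℕ → ℚ)) f) i = ((-1 : ℚ) ^ p.1 *
            if IsMono l false i (i + p.1) ∧ IsMono l true (i + p.1) (i + (n + 1)) then 1 else 0) *
            f (i + (n + 1)) := by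
        intro p hp
        rw [Finset.HasAntidiagonal.mem_antidiagonal] at hp
        rw [hD, hA, coeff_mk, coeff_mk, Module.End.mul_apply, LinearMap.smul_apply, Pi.smul_apply,
          stepOp_apply, stepOp_apply, ← hp, ← add_assoc]
        split_ifs <;> simp_all
      rw [Finset.sum_congr rfl h1, ← Finset.sum_mul, sum_desc_asc, zero_mul]
  have h : D = PowerSeries.map (stepRep l : NSym →+* _) V1inv := by
    rw [← mul_one D, ← hAB, ← mul_assoc, hDA, one_mul]
  have h2 := congrArg (coeff k) h
  rw [hD, coeff_mk, coeff_map, V1inv, coeff_mk] at h2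
  have h3 : (-1 : ℚ) ^ k • stepOp l false k =
      (-1 : ℚ) ^ k • stepRep l (ribbonR (Composition.ones k)) := by
    rw [h2, ← map_smul]
    rfl
  exact (smul_right_injective _ (pow_ne_zero k (by norm_num : (-1 : ℚ) ≠ 0)) h3).symm

theorem stepRep_coeff_V1 (l : ℕ → Bool) (e : Bool) (k : ℕ) :
    stepRep l (coeff k (V1 e)) = stepOp l e k := by
  cases e
  · rw [← stepRep_ribbonR_ones]
    congr 1
    change coeff k V1minus = _
    rw [V1minus, coeff_mk]
  · rw [← stepRep_genS, ← coeff_V1plus]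
    rfl

/-- The number of factorisations, into factors of alternating monotonicity, of the positions from
`i` to the end `n`. -/
def factorCount (l : ℕ → Bool) (e : Bool) (n r i : ℕ) : ℚ :=
  stepRep l (coeff (n - i) (altProd e r)) (Pi.single n 1) i

theorem factorCount_zero (l : ℕ → Bool) (e : Bool) {n i : ℕ} (h : i < n) :
    factorCount l e n 0 i = 0 := by
  rw [factorCount, altProd, coeff_one, if_neg (by omega), map_zero]
  rfl

open Classical in
theorem factorCount_succ (l : ℕ → Bool) (e : Bool) {n r i : ℕ} (h : i ≤ n) :
    factorCount l e n (r + 1) i = ∑ p ∈ Finset.HasAntidiagonal.antidiagonal (n - i),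
      if IsMono l (altSign e r) i (i + p.1) then factorCount l e n r (i + p.1) else 0 := by
  rw [factorCount, altProd, coeff_mul, map_sum, LinearMap.sum_apply, Finset.sum_apply]
  refine Finset.sum_congr rfl fun p hp => ?_
  rw [Finset.HasAntidiagonal.mem_antidiagonal] at hp
  rw [map_mul, Module.End.mul_apply, stepRep_coeff_V1, stepOp_apply, factorCount,
    show n - (i + p.1) = p.2 by omega]

theorem factorCount_end (l : ℕ → Bool) (e : Bool) (n r : ℕ) : factorCount l e n r n = 1 := by
  classical
  induction r with
  | zero => simp [factorCount, altProd]
  | succ r ih =>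
    rw [factorCount_succ l e le_rfl, Nat.sub_self, Finset.HasAntidiagonal.antidiagonal_zero,
      Finset.sum_singleton, if_pos (isMono_of_le (by simp))]
    exact ih

/-- A labelling is the same as a cut into factors, possibly empty, of alternating monotonicity: the
label of a position is the number of factors after its own. Both counts satisfy the recursion
`labelCount_succ`. -/
theorem factorCount_eq_labelCount (l : ℕ → Bool) (e : Bool) {n d i : ℕ} (h : i + d + 1 = n) (r : ℕ) :
    factorCount l e n r i = labelCount e r ((List.range' i d).map l) := by
  classical
  induction d generalizing i r with
  | zero =>
    simp only [List.range'_zero, List.map_nil, labelCount_nil]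
    induction r with
    | zero => rw [factorCount_zero l e (by omega)]; rfl
    | succ r ih =>
      rw [factorCount_succ l e (by omega), show n - i = 0 + 1 by omega,
        Finset.Nat.sum_antidiagonal_succ, Finset.HasAntidiagonal.antidiagonal_zero,
        Finset.sum_singleton, if_pos (isMono_of_le (by simp)), if_pos (isMono_of_le (by simp)),
        add_zero, ih, show i + (0 + 1) = n by omega, factorCount_end, Nat.cast_succ]
  | succ d ihd =>
    have ihd' := ihd (i := i + 1) (by omega)
    rw [List.range'_succ, List.map_cons]
    induction r with
    | zero => rw [factorCount_zero l e (by omega), labelCount_zero]; rfl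
    | succ r ih =>
      -- The term with an empty first factor is split off. Otherwise position `i` lies in the first
      -- factor: it can be deleted if the letter after it has the right sign, and it forms the whole
      -- factor if not.
      rw [labelCount_succ, Nat.cast_add, ← ih, ← ihd', factorCount_succ l e (by omega),
        show n - i = (n - (i + 1)) + 1 by omega, Finset.Nat.sum_antidiagonal_succ,
        if_pos (isMono_of_le (by simp)), add_zero]
      congr 1
      split_ifs with hs
      · rw [factorCount_succ l e (by omega)]
        refine Finset.sum_congr rfl fun p _ => ?_
        have h3 : IsMono l (altSign e r) i (i + (p.1 + 1)) ↔
            IsMono l (altSign e r) (i + 1) (i + 1 + p.1) := by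
          rcases Nat.eq_zero_or_pos p.1 with h0 | h0
          · rw [h0]
            exact iff_of_true (isMono_of_le (by omega)) (isMono_of_le (by omega))
          · rw [isMono_iff (by omega), hs, show i + (p.1 + 1) = i + 1 + p.1 by ring]
            simp
        rw [h3, show i + (p.1 + 1) = i + 1 + p.1 by ring]
      · rw [show n - (i + 1) = d + 1 by omega, Finset.Nat.sum_antidiagonal_succ,
          Finset.sum_eq_zero, add_zero, if_pos (isMono_of_le (by simp))]
        intro p _
        refine if_neg fun hm => hs ?_
        rw [isMono_iff (by omega)] at hm
        exact hm.1.symm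

/-! Comparison with the descent algebra. -/

/-- The letters of a permutation: whether there is an ascent after position `a`. -/
def letter {n : ℕ} (σ : Equiv.Perm (Fin n)) (a : ℕ) : Bool :=
  if h : a + 1 < n then decide (σ ⟨a, by omega⟩ < σ ⟨a + 1, h⟩) else true

theorem letter_eq_false_iff {n : ℕ} (σ : Equiv.Perm (Fin n)) (a : ℕ) :
    letter σ a = false ↔ a + 1 ∈ permDes σ := by
  rw [letter, permDes, Set.mem_ofPred_eq]
  constructor
  · intro H
    split_ifs at H with h
    refine ⟨⟨a, by omega⟩, ⟨a + 1, h⟩, rfl, rfl, ?_⟩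
    rw [decide_eq_false_iff_not, not_lt] at H
    refine Nat.succ_lt_succ (lt_of_le_of_ne H fun h' => ?_)
    have := σ.injective (Fin.ext h')
    simp at this
  · rintro ⟨b, c, hb, hc, H⟩
    have hn : a + 1 < n := hc ▸ c.isLt
    rw [dif_pos hn, decide_eq_false_iff_not, not_lt]
    have hb' : σ ⟨a, by omega⟩ = σ b := congrArg σ (Fin.ext (by simpa using hb.symm))
    have hc' : σ ⟨a + 1, hn⟩ = σ c := congrArg σ (Fin.ext hc.symm)
    rw [hb', hc']
    exact Fin.le_def.mpr (Nat.lt_of_succ_lt_succ H).le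

theorem one_le_of_mem_permDes {n : ℕ} {σ : Equiv.Perm (Fin n)} {m : ℕ} (h : m ∈ permDes σ) :
    1 ≤ m ∧ m < n := by
  obtain ⟨b, c, hb, hc, _⟩ := h
  exact ⟨by omega, hc ▸ c.isLt⟩

/-- The descents after position `i` are at ends of blocks of the composition `W` of the positions
that follow `i`. -/
def DescentsIn (l : ℕ → Bool) (i : ℕ) (W : FreeMonoid ℕ+) : Prop :=
  ∀ a, i ≤ a → a + 1 < i + weight W → l a = false →
    ∃ j, j < W.toList.length ∧ 1 ≤ j ∧
      i + ((W.toList.map fun i : ℕ+ => (i : ℕ)).take j).sum = a + 1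

-- Each letter `k` of the word shifts by `k` and demands that no descent lie strictly inside its
-- block.
open Classical in
theorem stepRep_single (l : ℕ → Bool) (W : FreeMonoid ℕ+) (f : ℕ → ℚ) (i : ℕ) :
    stepRep l (MonoidAlgebra.single W 1) f i =
      if DescentsIn l i W then f (i + weight W) else 0 := by
  have hlift : ∀ W : FreeMonoid ℕ+, stepRep l (MonoidAlgebra.single W 1) =
      FreeMonoid.lift (fun k : ℕ+ => stepOp l true k) W := fun W => by
    rw [stepRep, MonoidAlgebra.lift_single, one_smul]
  rw [hlift]
  induction W using FreeMonoid.recOn generalizing i with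
  | one =>
    rw [map_one, if_pos]
    · rfl
    · intro a h1 h2
      rw [weight_one] at h2
      omega
  | of_mul k W ih =>
    rw [map_mul, FreeMonoid.lift_eval_of, Module.End.mul_apply, stepOp_apply, ih (i + k)]
    have hw : i + weight (.of k * W) = i + k + weight W := by rw [weight_of_mul, add_assoc]
    rw [← ite_and, hw]
    refine if_congr ?_ rfl rfl
    rw [DescentsIn, DescentsIn, hw]
    have hk := k.pos
    have hlist : (FreeMonoid.of k * W).toList = k :: W.toList := rfl
    simp only [hlist, List.length_cons, List.map_cons]
    constructor
    · rintro ⟨h1, h2⟩ a h3 h4 h5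
      by_cases h6 : a + 1 < i + k
      · rw [h1 a h3 h6] at h5
        simp at h5
      by_cases h7 : a + 1 = i + k
      · refine ⟨1, ?_, le_rfl, by simp [h7]⟩
        have : 0 < weight W := by omega
        have h8 : W.toList ≠ [] := fun h => by
          rw [weight, h] at this
          simp at this
        have := List.length_pos_iff.mpr h8
        omega
      · obtain ⟨j, h8, h9, h10⟩ := h2 a (by omega) h4 h5
        refine ⟨j + 1, by omega, by omega, ?_⟩
        rw [List.take_succ_cons, List.sum_cons, ← h10]
        ring
    · intro H
      constructor
      · intro a h1 h2
        by_contra h3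
        obtain ⟨j, h4, h5, h6⟩ := H a h1 (by omega) (by simpa using h3)
        obtain ⟨j, rfl⟩ : ∃ j', j = j' + 1 := ⟨j - 1, by omega⟩
        rw [List.take_succ_cons, List.sum_cons] at h6
        omega
      · intro a h1 h2 h3
        obtain ⟨j, h4, h5, h6⟩ := H a (by omega) h2 h3
        obtain ⟨j, rfl⟩ : ∃ j', j = j' + 1 := ⟨j - 1, by omega⟩
        rw [List.take_succ_cons, List.sum_cons] at h6
        refine ⟨j, by omega, ?_, by rw [← h6]; ring⟩
        by_contra h7
        obtain rfl : j = 0 := by omega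
        simp at h6
        omega

open Classical in
theorem coeff_permSum {n : ℕ} (p : Equiv.Perm (Fin n) → Prop) (σ : Equiv.Perm (Fin n)) :
    (permSum p).coeff σ = if p σ then 1 else 0 := by
  rw [permSum, MonoidAlgebra.coeff_sum, Finsupp.finsetSum_apply, Finset.sum_eq_single σ]
  · split_ifs <;> simp
  · intro τ _ h
    split_ifs <;> simp [h]
  · simp

/-- This turns coefficients in the group algebra into matrix entries of an algebra morphism, so the
external product can be computed one permutation at a time. -/
theorem coeff_toDescent {n : ℕ} (F : NSym) (σ : Equiv.Perm (Fin n)) :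
    (toDescent n F).coeff σ = stepRep (letter σ) F (Pi.single n 1) 0 := by
  classical
  induction F using MonoidAlgebra.induction_linear with
  | zero => simp
  | add F G hF hG => simp [hF, hG]
  | single W c =>
    have hc : MonoidAlgebra.single W c = c • (MonoidAlgebra.single W 1 : NSym) := by simp
    rw [hc, map_smul, map_smul, MonoidAlgebra.coeff_smul_apply, LinearMap.smul_apply, Pi.smul_apply]
    congr 1
    rw [stepRep_single, zero_add]
    change (∑ I : Composition n,
      ((MonoidAlgebra.single W 1 : NSym).coeff (compWord I)) • descentS I).coeff σ = _
    rw [MonoidAlgebra.coeff_sum, Finsupp.finsetSum_apply]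
    simp only [MonoidAlgebra.coeff_smul_apply, descentS, coeff_permSum, MonoidAlgebra.coeff_single,
      Finsupp.single_apply]
    by_cases hW : weight W = n
    · obtain ⟨I, rfl⟩ := exists_compWord_eq hW
      rw [Finset.sum_eq_single I]
      · rw [if_pos rfl, one_smul, hW, Pi.single_eq_same]
        refine if_congr ?_ rfl rfl
        simp only [DescentsIn, map_compWord, length_compWord, zero_add, weight_compWord]
        constructor
        · intro H a _ h1 h2
          obtain ⟨j, h3, h4, h5⟩ := mem_compDes.mp (H ((letter_eq_false_iff σ a).mp h2))
          exact ⟨j, h4, h3, h5⟩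
        · intro H m hm
          have h1 := one_le_of_mem_permDes hm
          obtain ⟨a, rfl⟩ : ∃ a, m = a + 1 := ⟨m - 1, by omega⟩
          obtain ⟨j, h3, h4, h5⟩ := H a (Nat.zero_le _) h1.2 ((letter_eq_false_iff σ a).mpr hm)
          exact mem_compDes.mpr ⟨j, h4, h3, h5⟩
      · intro J _ hJ
        rw [if_neg fun h => hJ (compWord_injective n h).symm, zero_smul]
      · simp
    -- In a degree other than `n` both sides vanish: no composition of `n` gives the word, and the
    -- shift from `0` misses the point `n`.
    · rw [Finset.sum_eq_zero, Pi.single_eq_of_ne hW, ite_self]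
      intro I _
      rw [if_neg, zero_smul]
      rintro rfl
      exact hW (weight_compWord I)

/-- The word of ascents and descents of a permutation. -/
def letters {n : ℕ} (σ : Equiv.Perm (Fin n)) : List Bool := (List.range' 0 (n - 1)).map (letter σ)

theorem length_letters {n : ℕ} (σ : Equiv.Perm (Fin n)) : (letters σ).length = n - 1 := by
  simp [letters]

theorem coeff_toDescent_altProd {n : ℕ} (hn : 0 < n) (σ : Equiv.Perm (Fin n)) (e : Bool) (r : ℕ) :
    (toDescent n (coeff n (altProd e r))).coeff σ = labelCount e r (letters σ) := by
  rw [coeff_toDescent, letters, ← factorCount_eq_labelCount (letter σ) e (n := n) (by omega) r]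
  rfl

end
end RunAlgebra

namespace RunAlgebra
noncomputable section

/-! Permutations that sort a labelling. -/

theorem perm_eq_of_lt_iff_lt {n : ℕ} {σ τ : Equiv.Perm (Fin n)}
    (h : ∀ i j, σ i < σ j ↔ τ i < τ j) : σ = τ := by
  have hmono : StrictMono (σ.symm.trans τ) := fun i j hij => by
    simpa [← h] using hij
  have h1 : (hmono.orderIsoOfSurjective _ (σ.symm.trans τ).surjective) = OrderIso.refl (Fin n) :=
    Subsingleton.elim _ _
  ext i
  have h2 := congrArg (fun f => f (σ i)) h1
  simp at h2
  rw [h2]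

/-- The key by which positions labelled by alternating signs are sorted: by decreasing label, and
for equal labels by increasing position if the sign of the label is `true`, and by decreasing
position otherwise. -/
def labelKey {n r : ℕ} (e : Bool) (f : Fin n → Fin r) (i : Fin n) : ℤ ×ₗ ℤ :=
  toLex (-((f i : ℕ) : ℤ), if altSign e (f i) then ((i : ℕ) : ℤ) else -((i : ℕ) : ℤ))

theorem labelKey_lt_iff {n r : ℕ} (e : Bool) (f : Fin n → Fin r) (i j : Fin n) :
    labelKey e f i < labelKey e f j ↔
      f j < f i ∨ f i = f j ∧ if altSign e (f i) then i < j else j < i := by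
  rw [labelKey, labelKey, Prod.Lex.toLex_lt_toLex]
  simp only [neg_lt_neg_iff, neg_inj, Nat.cast_lt, Nat.cast_inj, Fin.val_inj, Fin.val_fin_lt]
  refine or_congr Iff.rfl (and_congr_right fun h => ?_)
  rw [h]
  split_ifs <;> simp

theorem labelKey_injective {n r : ℕ} (e : Bool) (f : Fin n → Fin r) :
    Function.Injective (labelKey e f) := fun i j h => by
  have h1 := (labelKey_lt_iff e f i j).not.mp (by rw [h]; exact lt_irrefl _)
  have h2 := (labelKey_lt_iff e f j i).not.mp (by rw [h]; exact lt_irrefl _)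
  push Not at h1 h2
  have h3 := le_antisymm h1.1 h2.1
  have h4 := h1.2 h3
  have h5 := h2.2 h3.symm
  rw [h3] at h4
  split_ifs at h4 h5 <;> order

/-- The permutation taking each position to its rank for the key of a labelling. -/
def labelPerm {n r : ℕ} (e : Bool) (f : Fin n → Fin r) : Equiv.Perm (Fin n) :=
  (Tuple.sort (labelKey e f))⁻¹

theorem labelPerm_lt_iff {n r : ℕ} (e : Bool) (f : Fin n → Fin r) (i j : Fin n) :
    labelPerm e f i < labelPerm e f j ↔ labelKey e f i < labelKey e f j := by
  have hmono : StrictMono (labelKey e f ∘ Tuple.sort (labelKey e f)) :=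
    (Tuple.monotone_sort _).strictMono_of_injective
      ((labelKey_injective e f).comp (Equiv.injective _))
  rw [← hmono.lt_iff_lt]
  simp [labelPerm]

theorem labelPerm_eq_iff {n r : ℕ} (e : Bool) (f : Fin n → Fin r) (σ : Equiv.Perm (Fin n)) :
    labelPerm e f = σ ↔ ∀ i j, σ i < σ j ↔ labelKey e f i < labelKey e f j := by
  constructor
  · rintro rfl
    exact labelPerm_lt_iff e f
  · intro h
    exact perm_eq_of_lt_iff_lt fun i j => by rw [labelPerm_lt_iff, h]

/-- The sum of the inverses of the permutations sorting the labellings with `r` labels. -/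
def labelSum (n : ℕ) (e : Bool) (r : ℕ) : GroupAlg n :=
  ∑ f : Fin n → Fin r, MonoidAlgebra.single (labelPerm e f)⁻¹ 1

theorem add_mul_lt_add_mul_iff {a x x' y y' : ℕ} (hy : y < a) (hy' : y' < a) :
    y' + a * x' < y + a * x ↔ x' < x ∨ x' = x ∧ y' < y := by
  rcases lt_trichotomy x' x with h | h | h
  · have := Nat.mul_le_mul_left a (Nat.succ_le_of_lt h)
    rw [Nat.mul_succ] at this
    omega
  · subst h
    omega
  · have := Nat.mul_le_mul_left a (Nat.succ_le_of_lt h)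
    rw [Nat.mul_succ] at this
    omega

/-- Signs multiply under the combination of labels. Reversing a block of `a` labels is what keeps
the signs alternating across block boundaries, and the parity of `a` decides the sign of the label
`0`. -/
theorem altSign_add_mul (e e' : Bool) {a y : ℕ} (hy : y < a) (x : ℕ) :
    altSign (if Even a then e else (e == e'))
      ((if altSign e' x then y else a - (y + 1)) + a * x) = (altSign e y == altSign e' x) := by
  obtain ⟨t, rfl⟩ : ∃ t, a = y + 1 + t := ⟨a - (y + 1), by omega⟩
  rw [Nat.add_sub_cancel_left]
  by_cases hx : Even x <;> by_cases hy : Even y <;> by_cases ht : Even t <;> cases e <;> cases e' <;>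
    simp [altSign, hx, hy, ht, Nat.even_add, Nat.even_mul, Nat.even_add_one]

/-- The lexicographic combination of two labellings, the second one being applied to the ranks for
the first one, which is reversed where the sign of the second label is `false`. -/
def combineLabels {n a b : ℕ} (e e' : Bool) (p : (Fin n → Fin a) × (Fin n → Fin b)) :
    Fin n → Fin (b * a) := fun i =>
  finProdFinEquiv (p.2 (labelPerm e p.1 i),
    if altSign e' (p.2 (labelPerm e p.1 i)) then p.1 i else (p.1 i).rev)

theorem combineLabels_bijective {n a b : ℕ} (e e' : Bool) :
    Function.Bijective (combineLabels (n := n) (a := a) (b := b) e e') := by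
  rw [Fintype.bijective_iff_injective_and_card]
  constructor
  · rintro ⟨f, g⟩ ⟨f', g'⟩ h
    have h1 : ∀ i, g (labelPerm e f i) = g' (labelPerm e f' i) := fun i => by
      have := finProdFinEquiv.injective (congrFun h i)
      exact congrArg Prod.fst this
    have h2 : f = f' := by
      funext i
      have := congrArg Prod.snd (finProdFinEquiv.injective (congrFun h i))
      simp only [h1 i] at this
      split_ifs at this
      · exact this
      · exact Fin.rev_injective this
    subst h2
    refine Prod.ext rfl (funext fun i => ?_)
    have := h1 ((labelPerm e f).symm i)
    simpa using this
  · simp [mul_pow, mul_comm]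

/-- Positions are compared first by `g`. At equal `g`-labels the order is that of the ranks for `f`,
or its opposite if the sign of the `g`-label is `false`. The opposite of the order for `f` is
obtained by reversing the labels and flipping their signs. -/
theorem labelPerm_combineLabels {n a b : ℕ} (e e' : Bool) (f : Fin n → Fin a) (g : Fin n → Fin b) :
    labelPerm (if Even a then e else (e == e')) (combineLabels e e' (f, g)) =
      labelPerm e' g * labelPerm e f := by
  rw [labelPerm_eq_iff]
  intro i j
  rw [Equiv.Perm.mul_apply, Equiv.Perm.mul_apply, labelPerm_lt_iff, labelKey_lt_iff,
    labelKey_lt_iff]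
  set x := labelPerm e f i with hx
  set y := labelPerm e f j with hy
  have hxy : x < y ↔ f j < f i ∨ f i = f j ∧ if altSign e (f i) then i < j else j < i := by
    rw [hx, hy, labelPerm_lt_iff, labelKey_lt_iff]
  have hyx : y < x ↔ f i < f j ∨ f j = f i ∧ if altSign e (f j) then j < i else i < j := by
    rw [hx, hy, labelPerm_lt_iff, labelKey_lt_iff]
  have hval : ∀ k, ((combineLabels e e' (f, g) k : Fin (b * a)) : ℕ) =
      (if altSign e' (g (labelPerm e f k)) then (f k : ℕ) else a - (f k + 1)) +
        a * (g (labelPerm e f k) : ℕ) := by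
    intro k
    rw [combineLabels, finProdFinEquiv_apply_val]
    split_ifs <;> simp [Fin.val_rev]
  have hsign : altSign (if Even a then e else (e == e')) (combineLabels e e' (f, g) i) =
      (altSign e (f i) == altSign e' (g x)) := by
    rw [hval, altSign_add_mul e e' (f i).isLt]
  have hlt : combineLabels e e' (f, g) j < combineLabels e e' (f, g) i ↔
      g y < g x ∨ g y = g x ∧ if altSign e' (g x) then f j < f i else f i < f j := by
    have h1 := (f i).isLt
    have h2 := (f j).isLt
    rw [Fin.lt_def, hval, hval, add_mul_lt_add_mul_iff (by split_ifs <;> omega)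
      (by split_ifs <;> omega), ← hx, ← hy, Fin.val_fin_lt, Fin.val_inj]
    refine or_congr Iff.rfl (and_congr_right fun h => ?_)
    rw [h]
    split_ifs
    · rfl
    · rw [Fin.lt_def]
      omega
  have heq : combineLabels e e' (f, g) i = combineLabels e e' (f, g) j ↔
      g x = g y ∧ f i = f j := by
    rw [combineLabels, combineLabels, finProdFinEquiv.injective.eq_iff, Prod.mk.injEq]
    refine and_congr_right fun h => ?_
    simp only [← hx, ← hy]
    simp only at h
    rw [h]
    split_ifs
    · rfl
    · exact Fin.rev_injective.eq_iff
  rw [hsign, hlt, heq, hxy, hyx]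
  rcases lt_trichotomy (g x) (g y) with h | h | h
  · simp [h.ne, h.ne', h.not_gt]
  · rw [h]
    rcases lt_trichotomy (f i) (f j) with h' | h' | h'
    · cases altSign e' (g y) <;> simp [h', h'.ne, h'.ne', h'.not_gt]
    · rw [h']
      cases altSign e' (g y) <;> cases altSign e (f j) <;> simp
    · cases altSign e' (g y) <;> simp [h', h'.ne, h'.ne', h'.not_gt]
  · simp [h]

/-- Pairs of labellings correspond bijectively to combined ones, and taking inverses in `labelSum`
matches the order of the factors. -/
theorem labelSum_mul_labelSum (n : ℕ) (e e' : Bool) (a b : ℕ) :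
    labelSum n e a * labelSum n e' b =
      labelSum n (if Even a then e else (e == e')) (b * a) := by
  rw [labelSum, labelSum, Finset.sum_mul_sum, ← Finset.sum_product', Finset.univ_product_univ,
    labelSum]
  refine Fintype.sum_bijective (combineLabels e e') (combineLabels_bijective e e') _ _ ?_
  rintro ⟨f, g⟩
  rw [labelPerm_combineLabels, MonoidAlgebra.single_mul_single, mul_one, mul_inv_rev]

/-! The coefficients of the sums of sorting permutations. -/

/-- The labels weakly decrease, and two consecutive ones may be equal if and only if their sign is
the letter between them. -/
def IsLabelling {m r : ℕ} (e : Bool) (l : Fin m → Bool) (f : Fin (m + 1) → Fin r) : Prop :=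
  ∀ k : Fin m, f k.succ < f k.castSucc ∨
    f k.castSucc = f k.succ ∧ altSign e (f k.castSucc) = l k

theorem isLabelling_cons {m r : ℕ} (e : Bool) (l : Fin (m + 1) → Bool) (j : Fin r)
    (f : Fin (m + 1) → Fin r) :
    IsLabelling e l (Fin.cons j f : Fin (m + 2) → Fin r) ↔
      (f 0 : ℕ) < (if altSign e j = l 0 then (j : ℕ) + 1 else j) ∧
        IsLabelling e (fun k => l k.succ) f := by
  rw [IsLabelling, Fin.forall_fin_succ]
  refine and_congr ?_ ?_
  · rw [Fin.castSucc_zero, Fin.cons_succ, Fin.cons_zero, Fin.lt_def, Fin.ext_iff]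
    split_ifs with h <;> simp only [h, and_true, and_false, or_false]
    omega
  · refine forall_congr' fun k => ?_
    rw [← Fin.succ_castSucc, Fin.cons_succ, Fin.cons_succ]

-- The bound `p` on the first label is separated from the number `r` of labels so that it can vary
-- in the induction along the word.
open Classical in
theorem sum_isLabelling {m r p : ℕ} (hp : p ≤ r) (e : Bool) (l : Fin m → Bool) :
    (∑ f : Fin (m + 1) → Fin r, if (f 0 : ℕ) < p ∧ IsLabelling e l f then 1 else 0) =
      labelCount e p (List.ofFn l) := by
  induction m generalizing p with
  | zero =>
    rw [List.ofFn_zero, labelCount_nil, ← (Equiv.funUnique (Fin 1) (Fin r)).symm.sum_comp]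
    simp only [IsLabelling, IsEmpty.forall_iff, and_true]
    simp only [Equiv.funUnique_symm_apply, uniqueElim_const]
    rw [Fin.sum_univ_eq_sum_range (fun i => if i < p then 1 else 0), ← Finset.sum_filter,
      Finset.sum_const, smul_eq_mul, mul_one]
    have : {x ∈ Finset.range r | x < p} = Finset.range p := by
      ext
      simp
      omega
    rw [this, Finset.card_range]
  | succ m ih =>
    rw [List.ofFn_succ, labelCount, ← (Fin.consEquiv fun _ => Fin r).sum_comp,
      Fintype.sum_prod_type]
    have h1 : ∀ j : Fin r, (∑ f : Fin (m + 1) → Fin r,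
        if ((Fin.cons j f : Fin (m + 2) → Fin r) 0 : ℕ) < p ∧
          IsLabelling e l (Fin.cons j f : Fin (m + 2) → Fin r)
        then 1 else 0) = if (j : ℕ) < p then labelCount e (if altSign e j = l 0 then (j : ℕ) + 1
          else j) (List.ofFn fun k => l k.succ) else 0 := by
      intro j
      simp only [Fin.cons_zero, isLabelling_cons]
      by_cases hj : (j : ℕ) < p
      · rw [if_pos hj, ← ih (by split_ifs <;> omega)]
        simp only [hj, true_and]
      · simp only [hj, false_and, if_false, Finset.sum_const_zero]
    refine (Finset.sum_congr rfl fun j _ => h1 j).trans ?_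
    rw [Fin.sum_univ_eq_sum_range (fun j => if j < p then
      labelCount e (if altSign e j = l 0 then j + 1 else j) (List.ofFn fun k => l k.succ) else 0),
      ← Finset.sum_filter]
    have : {x ∈ Finset.range r | x < p} = Finset.range p := by
      ext
      simp
      omega
    rw [this]

theorem letters_eq_ofFn {m : ℕ} (σ : Equiv.Perm (Fin (m + 1))) :
    letters σ = List.ofFn fun k : Fin m => decide (σ k.castSucc < σ k.succ) := by
  refine List.ext_getElem (by simp [letters]) fun k h1 h2 => ?_
  rw [List.length_ofFn] at h2
  simp [letters, letter, h2]

/-- Read in the order prescribed by `τ`, the labels of a labelling sorted by `τ⁻¹` have increasing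
keys. It suffices to test consecutive entries, and this is the condition `IsLabelling` for the
ascents and descents of `τ`. -/
theorem coeff_labelSum {m : ℕ} (e : Bool) (r : ℕ) (τ : Equiv.Perm (Fin (m + 1))) :
    (labelSum (m + 1) e r).coeff τ = labelCount e r (letters τ) := by
  classical
  rw [letters_eq_ofFn, ← sum_isLabelling le_rfl, labelSum, MonoidAlgebra.coeff_sum,
    Finsupp.finsetSum_apply, ← (Equiv.arrowCongr τ (Equiv.refl (Fin r))).sum_comp, Nat.cast_sum]
  refine Finset.sum_congr rfl fun f _ => ?_
  rw [MonoidAlgebra.coeff_single, Finsupp.single_apply, Nat.cast_ite, Nat.cast_one, Nat.cast_zero]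
  refine if_congr ?_ rfl rfl
  rw [inv_eq_iff_eq_inv, labelPerm_eq_iff]
  set g := Equiv.arrowCongr τ (Equiv.refl (Fin r)) f with hg
  have hgf : ∀ i, g (τ i) = f i := fun i => by simp [hg]
  have h1 : (∀ i j, τ⁻¹ i < τ⁻¹ j ↔ labelKey e g i < labelKey e g j) ↔
      StrictMono (labelKey e g ∘ τ) := by
    constructor
    · intro h i j hij
      simpa [← h] using hij
    · intro h i j
      rw [← h.lt_iff_lt]
      simp
  rw [h1, Fin.strictMono_iff_lt_succ]
  simp only [Fin.is_lt, true_and, IsLabelling, Function.comp_apply, labelKey_lt_iff, hgf]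
  refine forall_congr' fun k => or_congr Iff.rfl (and_congr_right fun h => ?_)
  have hne : τ k.castSucc ≠ τ k.succ := fun h' => (Fin.castSucc_lt_succ (i := k)).ne (τ.injective h')
  cases altSign e (f k.castSucc)
  · simp only [Bool.false_eq_true, if_false, false_eq_decide_iff, not_lt]
    exact ⟨le_of_lt, fun h' => lt_of_le_of_ne h' hne.symm⟩
  · simp

theorem toDescent_altProd (n : ℕ) (e : Bool) (r : ℕ) :
    toDescent n (PowerSeries.coeff n (altProd e r)) = labelSum n e r := by
  refine MonoidAlgebra.coeff_injective (Finsupp.ext fun σ => ?_)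
  cases n with
  | zero =>
    rw [coeff_toDescent]
    refine (factorCount_end (letter σ) e 0 r).trans ?_
    rw [labelSum, MonoidAlgebra.coeff_sum, Finsupp.finsetSum_apply, Fintype.sum_unique,
      Subsingleton.elim (labelPerm e default)⁻¹ σ]
    simp
  | succ m => rw [coeff_toDescent_altProd m.succ_pos, coeff_labelSum]

/-- The product in the group algebra of the images of alternating products. -/
theorem toDescent_altProd_mul (n : ℕ) (e e' : Bool) (a b : ℕ) :
    toDescent n (PowerSeries.coeff n (altProd e a)) *
        toDescent n (PowerSeries.coeff n (altProd e' b)) =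
      toDescent n (PowerSeries.coeff n (altProd (if Even a then e else (e == e')) (a * b))) := by
  rw [toDescent_altProd, toDescent_altProd, toDescent_altProd, labelSum_mul_labelSum, mul_comm b]

end
end RunAlgebra

/-! ### Multiplication and coefficients of the Eulerian elements. -/

namespace RunAlgebra
noncomputable section

/-- The degree `n` part of `IJ e odd k` in the group algebra. -/
def eulerElem (n : ℕ) (e odd : Bool) (k : ℕ) : GroupAlg n :=
  toDescent n (PowerSeries.coeff n (IJ e odd k))

theorem toDescent_altProd_eq_sum (n : ℕ) (e odd : Bool) (m : ℕ) :
    toDescent n (PowerSeries.coeff n (altProd e (2 * m + odd.toNat))) =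
      ∑ k ∈ Finset.range (n + 1), ((2 * m + odd.toNat : ℕ) : ℚ) ^ k • eulerElem n e odd k := by
  rw [coeff_altProd, map_sum]
  simp only [map_smul, eulerElem]

theorem eulerElem_mul (n : ℕ) (e e' odd odd' : Bool) {k l : ℕ} (hk : k ≤ n) (hl : l ≤ n) :
    eulerElem n e odd k * eulerElem n e' odd' l =
      if k = l then eulerElem n (if odd then (e == e') else e) (odd && odd') k else 0 := by
  refine eq_of_sum_pow_mul_pow_smul_eq (N := n + 1) (infinite_parity odd) (infinite_parity odd')
    (c := fun k l => eulerElem n e odd k * eulerElem n e' odd' l)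
    (d := fun k => eulerElem n (if odd then (e == e') else e) (odd && odd') k) ?_ (by omega)
    (by omega)
  rintro x ⟨a, rfl⟩ y ⟨b, rfl⟩
  have h := toDescent_altProd_mul n e e' (2 * a + odd.toNat) (2 * b + odd'.toNat)
  obtain ⟨c, hc⟩ : ∃ c, (2 * a + odd.toNat) * (2 * b + odd'.toNat) =
      2 * c + (odd && odd').toNat := by
    cases odd <;> cases odd'
    · exact ⟨2 * a * b, by simp; ring⟩
    · exact ⟨a * (2 * b + 1), by simp; ring⟩
    · exact ⟨(2 * a + 1) * b, by simp; ring⟩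
    · exact ⟨2 * a * b + a + b, by simp; ring⟩
  have heven : (if Even (2 * a + odd.toNat) then e else (e == e')) =
      if odd then (e == e') else e := by
    cases odd <;> simp
  rw [heven, hc, toDescent_altProd_eq_sum, toDescent_altProd_eq_sum, toDescent_altProd_eq_sum,
    Finset.sum_mul_sum, ← hc, Nat.cast_mul] at h
  rw [← h]
  simp only [smul_mul_smul_comm]

/-- The signs `e` and `e'` may differ: one function of the number of changes serves both signs,
which later makes the symmetric combinations depend on runs alone. -/
theorem coeff_eulerElem_eq {n : ℕ} (hn : 0 < n) {e e' odd : Bool} {σ σ' : Equiv.Perm (Fin n)}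
    (h : changes (e == odd) (letters σ ++ [e]) = changes (e' == odd) (letters σ' ++ [e']))
    {k : ℕ} (hk : k ≤ n) :
    (eulerElem n e odd k).coeff σ = (eulerElem n e' odd k).coeff σ' := by
  refine eq_of_sum_pow_smul_eq (N := n + 1) (infinite_parity odd)
    (c := fun k => (eulerElem n e odd k).coeff σ) (d := fun k => (eulerElem n e' odd k).coeff σ')
    ?_ (by omega)
  rintro x ⟨m, rfl⟩
  have h1 : ∀ (e : Bool) (σ : Equiv.Perm (Fin n)), ∑ k ∈ Finset.range (n + 1),
      ((2 * m + odd.toNat : ℕ) : ℚ) ^ k • (eulerElem n e odd k).coeff σ =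
        labelCount e (2 * m + odd.toNat) (letters σ) := by
    intro e σ
    rw [← coeff_toDescent_altProd hn, toDescent_altProd_eq_sum, MonoidAlgebra.coeff_sum,
      Finsupp.finsetSum_apply]
    rfl
  rw [h1, h1, labelCount_eq_of_changes_eq (by simp [length_letters]) h]

/-- The coefficients of the Eulerian elements are functions of the number of sign changes. -/
theorem exists_coeff_eulerElem {n : ℕ} (hn : 0 < n) (odd : Bool) {k : ℕ} (hk : k ≤ n) :
    ∃ φ : ℕ → ℚ, ∀ (e : Bool) (σ : Equiv.Perm (Fin n)),
      (eulerElem n e odd k).coeff σ = φ (changes (e == odd) (letters σ ++ [e])) := by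
  have h : Function.FactorsThrough
      (fun p : Bool × Equiv.Perm (Fin n) => (eulerElem n p.1 odd k).coeff p.2)
      (fun p => changes (p.1 == odd) (letters p.2 ++ [p.1])) :=
    fun p q hpq => coeff_eulerElem_eq hn hpq hk
  obtain ⟨φ, hφ⟩ := (Function.factorsThrough_iff _).mp h
  exact ⟨φ, fun e σ => congrFun hφ (e, σ)⟩

end
end RunAlgebra

namespace RunAlgebra
noncomputable section

/-! Runs and peaks in terms of ascents and descents. -/

/-- Whether there is an ascent after position `a` of a sequence. -/
def seqLetter {n : ℕ} (v : Fin n → ℕ) (a : ℕ) : Bool :=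
  if h : a + 1 < n then decide (v ⟨a, by omega⟩ < v ⟨a + 1, h⟩) else true

/-- Consecutive entries are distinct. -/
def AdjDistinct {n : ℕ} (v : Fin n → ℕ) : Prop :=
  ∀ (a : ℕ) (h : a + 1 < n), v ⟨a, by omega⟩ ≠ v ⟨a + 1, h⟩

theorem strictMonoOn_Icc_iff {n : ℕ} {α : Type*} [Preorder α] (v : Fin n → α) (a b : Fin n) :
    StrictMonoOn v (Set.Icc a b) ↔
      ∀ (c : ℕ) (h : c + 1 < n), (a : ℕ) ≤ c → c + 1 < (b : ℕ) + 1 →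
        v ⟨c, by omega⟩ < v ⟨c + 1, h⟩ := by
  constructor
  · intro H c h h1 h2
    refine H ⟨h1, ?_⟩ ⟨?_, ?_⟩ ?_ <;> simp only [Fin.le_def, Fin.lt_def] <;> omega
  · rintro H ⟨i, hi⟩ hi' ⟨j, hj⟩ hj' hij
    obtain ⟨d, rfl⟩ : ∃ d, j = i + d + 1 := ⟨j - i - 1, by simp only [Fin.lt_def] at hij; omega⟩
    simp only [Set.mem_Icc, Fin.le_def] at hi' hj'
    induction d with
    | zero => exact H i hj hi'.1 (by omega)
    | succ d ih =>
      exact (ih (by omega) (by simp only [Fin.lt_def]; omega) (by omega)).trans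
        (H (i + d + 1) hj (by omega) (by omega))

theorem strictMonoOn_iff_isMono {n : ℕ} (v : Fin n → ℕ) (a b : Fin n) :
    StrictMonoOn v (Set.Icc a b) ↔ IsMono (seqLetter v) true a (b + 1) := by
  rw [strictMonoOn_Icc_iff]
  refine forall_congr' fun c => ?_
  constructor
  · intro H h1 h2
    have h : c + 1 < n := by omega
    rw [seqLetter, dif_pos h, decide_eq_true_iff]
    exact H h h1 h2
  · intro H h h1 h2
    have := H h1 h2
    rwa [seqLetter, dif_pos h, decide_eq_true_iff] at this

theorem strictAntiOn_iff_isMono {n : ℕ} {v : Fin n → ℕ} (hv : AdjDistinct v) (a b : Fin n) :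
    StrictAntiOn v (Set.Icc a b) ↔ IsMono (seqLetter v) false a (b + 1) := by
  rw [← strictMonoOn_toDual_comp_iff, strictMonoOn_Icc_iff]
  refine forall_congr' fun c => ?_
  constructor
  · intro H h1 h2
    have h : c + 1 < n := by omega
    rw [seqLetter, dif_pos h, decide_eq_false_iff_not, not_lt]
    exact le_of_lt (H h h1 h2)
  · intro H h h1 h2
    have := H h1 h2
    rw [seqLetter, dif_pos h, decide_eq_false_iff_not, not_lt] at this
    exact show v ⟨c + 1, h⟩ < v ⟨c, by omega⟩ from lt_of_le_of_ne this (hv c h).symm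

theorem monotoneFactor_iff {n : ℕ} {v : Fin n → ℕ} (hv : AdjDistinct v) (a b : Fin n) :
    MonotoneFactor v a b ↔ ∃ s, IsMono (seqLetter v) s a (b + 1) := by
  rw [MonotoneFactor, strictMonoOn_iff_isMono, strictAntiOn_iff_isMono hv, Bool.exists_bool, or_comm]

/-- A run starts at `a` if and only if `a` is not the last position and the sign changes at `a`. -/
theorem exists_isRun_iff {m : ℕ} {v : Fin (m + 2) → ℕ} (hv : AdjDistinct v) (a : Fin (m + 2)) :
    (∃ b, IsRun v (a, b)) ↔
      (a : ℕ) < m + 1 ∧ ((a : ℕ) = 0 ∨ seqLetter v (a - 1) ≠ seqLetter v a) := by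
  classical
  constructor
  · rintro ⟨b, hab, hm, hmax⟩
    simp only at hab hm hmax
    -- With at least two entries, a factor reduced to one entry is never maximal, since it extends
    -- to a neighbour.
    have hab' : (a : ℕ) < b := by
      refine lt_of_le_of_ne hab fun h => ?_
      by_cases ha : (a : ℕ) + 1 < m + 2
      · have := (hmax a ⟨a + 1, ha⟩ le_rfl (Fin.le_def.mpr (by simp only; omega))
          ((monotoneFactor_iff hv _ _).mpr ⟨seqLetter v a, fun c h1 h2 => by
            simp only at h2
            rw [show c = a by omega]⟩)).2
        rw [Fin.ext_iff] at this
        simp only at this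
        omega
      · have := a.isLt
        have := (hmax ⟨a - 1, by omega⟩ b (Fin.le_def.mpr (by simp only; omega)) le_rfl
          ((monotoneFactor_iff hv _ _).mpr ⟨seqLetter v (a - 1), fun c h1 h2 => by
            simp only at h1
            rw [show c = a - 1 by omega]⟩)).1
        rw [Fin.ext_iff] at this
        simp only at this
        omega
    have hb := b.isLt
    refine ⟨by omega, ?_⟩
    by_contra H
    push Not at H
    obtain ⟨s, hs⟩ := (monotoneFactor_iff hv _ _).mp hm
    have h0 : seqLetter v a = s := hs a le_rfl (by omega)
    have := (hmax ⟨a - 1, by omega⟩ b (Fin.le_def.mpr (by simp only; omega)) le_rfl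
      ((monotoneFactor_iff hv _ _).mpr ⟨s, fun c h1 h2 => by
        simp only at h1
        by_cases hc : c = a - 1
        · rw [hc, H.2, h0]
        · exact hs c (by omega) h2⟩)).1
    rw [Fin.ext_iff] at this
    simp only at this
    omega
  · rintro ⟨h1, h2⟩
    set P : ℕ → Prop := fun b => IsMono (seqLetter v) (seqLetter v a) a (b + 1) with hP
    have hP1 : P (a + 1) := fun c h3 h4 => by rw [show c = a by omega]
    -- The run is the longest factor from `a` with the sign of its first step; the change of sign at
    -- `a` prevents an extension to the left.
    set b := Nat.findGreatest P (m + 1) with hb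
    have hPb : P b := Nat.findGreatest_spec (by omega) hP1
    have hab : (a : ℕ) + 1 ≤ b := Nat.le_findGreatest (by omega) hP1
    have hbm : b ≤ m + 1 := Nat.findGreatest_le _
    refine ⟨⟨b, by omega⟩, Fin.le_def.mpr (by simp only; omega),
      (monotoneFactor_iff hv _ _).mpr ⟨_, hPb⟩, ?_⟩
    intro c d hc hd hcd
    simp only [Fin.le_def] at hc hd
    obtain ⟨s, hs⟩ := (monotoneFactor_iff hv _ _).mp hcd
    have h0 : seqLetter v a = s := hs a hc (by omega)
    have hca : (c : ℕ) = a := by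
      by_contra hne
      have h3 := hs (a - 1) (by omega) (by omega)
      rcases h2 with h2 | h2
      · omega
      · exact h2 (h3.trans h0.symm)
    have hdb : (d : ℕ) ≤ b := by
      have := d.isLt
      refine Nat.le_findGreatest (by omega) fun i h3 h4 => ?_
      rw [h0]
      exact hs i (by omega) h4
    exact ⟨Fin.ext hca, Fin.ext (by simp only; omega)⟩

theorem IsRun.lt {m : ℕ} {v : Fin (m + 2) → ℕ} (hv : AdjDistinct v) {a b : Fin (m + 2)}
    (h : IsRun v (a, b)) : a < b := by
  have h1 := ((exists_isRun_iff hv a).mp ⟨b, h⟩).1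
  refine lt_of_le_of_ne h.1 fun hab => ?_
  subst hab
  have := (h.2.2 a ⟨a + 1, by omega⟩ le_rfl (Fin.le_def.mpr (by simp))
    ((monotoneFactor_iff hv _ _).mpr ⟨seqLetter v a, fun c h1 h2 => by
      simp only at h2
      rw [show c = a by omega]⟩)).2
  rw [Fin.ext_iff] at this
  simp at this

theorem IsRun.eq_of_fst_eq {n : ℕ} {v : Fin n → ℕ} {a b b' : Fin n}
    (h : IsRun v (a, b)) (h' : IsRun v (a, b')) : b = b' := by
  rcases le_total b b' with hb | hb
  · exact (h.2.2 a b' le_rfl hb h'.2.1).2.symm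
  · exact (h'.2.2 a b le_rfl hb h.2.1).2

/-! ### Runs and peaks counted by sign changes. -/

theorem changes_range' (l : ℕ → Bool) (m i : ℕ) :
    changes (l i) ((List.range' (i + 1) m).map l) =
      ∑ k ∈ Finset.range m, if l (i + k) ≠ l (i + k + 1) then 1 else 0 := by
  induction m generalizing i with
  | zero => rfl
  | succ m ih =>
    rw [List.range'_succ, List.map_cons, changes, ih, Finset.sum_range_succ', add_comm]
    congr 1
    · exact Finset.sum_congr rfl fun k _ => by rw [show i + 1 + k = i + (k + 1) by ring]
    · simp only [add_zero, ne_eq, ite_not]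

/-- A run is determined by its starting position, so it is enough to count the starting positions:
the first entry and the places where the sign changes. -/
theorem runCount_eq {m : ℕ} {v : Fin (m + 2) → ℕ} (hv : AdjDistinct v) :
    runCount v = 1 + changes (seqLetter v 0) ((List.range' 1 m).map (seqLetter v)) := by
  classical
  have h1 : Set.InjOn (fun r : Fin (m + 2) × Fin (m + 2) => (r.1 : ℕ)) {r | IsRun v r} := by
    rintro ⟨a, b⟩ h ⟨a', b'⟩ h' haa
    obtain rfl : a = a' := Fin.ext haa
    rw [IsRun.eq_of_fst_eq h h']
  have h2 : (fun r : Fin (m + 2) × Fin (m + 2) => (r.1 : ℕ)) '' {r | IsRun v r} =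
      ((Finset.range (m + 1)).filter fun a => a = 0 ∨ seqLetter v (a - 1) ≠ seqLetter v a :
        Finset ℕ) := by
    ext a
    simp only [Set.mem_image, Finset.coe_filter, Finset.mem_range]
    constructor
    · rintro ⟨⟨a, b⟩, h, rfl⟩
      exact (exists_isRun_iff hv a).mp ⟨b, h⟩
    · rintro h
      obtain ⟨b, hb⟩ := (exists_isRun_iff hv ⟨a, by have := h.1; omega⟩).mpr h
      exact ⟨_, hb, rfl⟩
  rw [runCount, ← h1.ncard_image, h2, Set.ncard_coe_finset, Finset.card_filter,
    Finset.sum_range_succ', changes_range' _ m 0, add_comm]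
  simp

/-- The number of pairs `true`, `false` of consecutive letters in the word `x :: w`. -/
def peaks : Bool → List Bool → ℕ
  | _, [] => 0
  | x, a :: w => (if x = true ∧ a = false then 1 else 0) + peaks a w

theorem peaks_range' (l : ℕ → Bool) (m i : ℕ) :
    peaks (l i) ((List.range' (i + 1) m).map l) =
      ∑ k ∈ Finset.range m, if l (i + k) = true ∧ l (i + k + 1) = false then 1 else 0 := by
  induction m generalizing i with
  | zero => rfl
  | succ m ih =>
    rw [List.range'_succ, List.map_cons, peaks, ih, Finset.sum_range_succ', add_comm]
    congr 1
    exact Finset.sum_congr rfl fun k _ => by rw [show i + 1 + k = i + (k + 1) by ring]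

/-- As the word ends with `true`, every change from `true` to `false` is followed by a change back;
a word starting with `false` has one more change upwards. -/
theorem changes_concat_true (x : Bool) (w : List Bool) :
    changes x (w ++ [true]) = 2 * peaks x w + if x = true then 0 else 1 := by
  induction w generalizing x with
  | nil => simp [changes, peaks]
  | cons a w ih =>
    rw [List.cons_append, changes, peaks, ih]
    cases x <;> cases a <;> simp <;> ring

theorem peakCount_eq {n : ℕ} {v : Fin n → ℕ} (hv : AdjDistinct v) :
    peakCount v = ∑ k ∈ Finset.range (n - 2),
      if seqLetter v k = true ∧ seqLetter v (k + 1) = false then 1 else 0 := by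
  classical
  have h2 : (fun i : Fin n => (i : ℕ)) '' {i : Fin n | ∃ (a b : Fin n), (a : ℕ) + 1 = i ∧
      (i : ℕ) + 1 = b ∧ v a < v i ∧ v b < v i} = (((Finset.range (n - 2)).filter fun k =>
        seqLetter v k = true ∧ seqLetter v (k + 1) = false).image (· + 1) : Finset ℕ) := by
    ext i
    simp only [Set.mem_image, Finset.coe_image, Finset.coe_filter, Finset.mem_range]
    constructor
    · rintro ⟨i, ⟨a, b, h1, h2, h3, h4⟩, rfl⟩
      have hb := b.isLt
      refine ⟨a, ⟨by omega, ?_, ?_⟩, h1⟩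
      · rw [seqLetter, dif_pos (by omega), decide_eq_true_iff]
        convert h3
      · rw [seqLetter, dif_pos (by omega), decide_eq_false_iff_not, not_lt]
        have e1 : (⟨a + 1, by omega⟩ : Fin n) = i := Fin.ext h1
        have e2 : (⟨a + 1 + 1, by omega⟩ : Fin n) = b := Fin.ext (by simp only; omega)
        rw [e1, e2]
        exact h4.le
    · rintro ⟨k, ⟨h1, h2, h3⟩, rfl⟩
      rw [seqLetter, dif_pos (by omega), decide_eq_true_iff] at h2
      rw [seqLetter, dif_pos (by omega), decide_eq_false_iff_not, not_lt] at h3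
      exact ⟨⟨k + 1, by omega⟩, ⟨⟨k, by omega⟩, ⟨k + 1 + 1, by omega⟩, rfl, rfl, h2,
        lt_of_le_of_ne h3 (hv (k + 1) (by omega)).symm⟩, rfl⟩
  rw [peakCount, ← Set.ncard_image_of_injective _ Fin.val_injective, h2, Set.ncard_coe_finset,
    Finset.card_image_of_injective _ (add_left_injective 1), Finset.card_filter]

/-! The statistics of permutations. -/

theorem adjDistinct_of_injective {n : ℕ} {v : Fin n → ℕ} (hv : Function.Injective v) :
    AdjDistinct v := fun a h h' => by
  have := hv h'
  simp at this

theorem word_injective {n : ℕ} (σ : Equiv.Perm (Fin n)) : Function.Injective (word σ) :=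
  fun _ _ h => σ.injective (Fin.ext (Nat.succ_injective h))

theorem leftWord_injective {n : ℕ} (σ : Equiv.Perm (Fin n)) : Function.Injective (leftWord σ) := by
  rw [leftWord, Fin.cons_injective_iff]
  refine ⟨?_, word_injective σ⟩
  rintro ⟨i, hi⟩
  exact Nat.succ_ne_zero _ hi

theorem seqLetter_word {n : ℕ} (σ : Equiv.Perm (Fin n)) : seqLetter (word σ) = letter σ := by
  funext a
  rw [seqLetter, letter]
  split_ifs with h
  · simp [word]
  · rfl

theorem seqLetter_leftWord_zero {n : ℕ} (hn : 0 < n) (σ : Equiv.Perm (Fin n)) :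
    seqLetter (leftWord σ) 0 = true := by
  rw [seqLetter, dif_pos (by omega), decide_eq_true_iff]
  exact Nat.succ_pos _

theorem seqLetter_leftWord_succ {n : ℕ} (σ : Equiv.Perm (Fin n)) (a : ℕ) :
    seqLetter (leftWord σ) (a + 1) = letter σ a := by
  rw [← seqLetter_word, seqLetter, seqLetter]
  by_cases h : a + 1 < n
  · rw [dif_pos (by omega), dif_pos h]
    rfl
  · rw [dif_neg (by omega), dif_neg h]

theorem map_seqLetter_leftWord {n : ℕ} (σ : Equiv.Perm (Fin n)) :
    (List.range' 1 (n - 1)).map (seqLetter (leftWord σ)) = letters σ := by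
  refine (congrArg (List.map _) (List.range'_succ_left (s := 0))).trans ?_
  rw [List.map_map]
  exact List.map_congr_left fun a _ => seqLetter_leftWord_succ σ a

theorem letters_eq_cons {m : ℕ} (σ : Equiv.Perm (Fin (m + 2))) :
    letters σ = letter σ 0 :: (List.range' 1 m).map (letter σ) := by
  rw [letters, show m + 2 - 1 = m + 1 by omega, List.range'_succ, List.map_cons]

theorem run_eq {m : ℕ} (σ : Equiv.Perm (Fin (m + 2))) :
    run σ = 1 + changes (letter σ 0) ((List.range' 1 m).map (letter σ)) := by
  rw [run, runCount_eq (adjDistinct_of_injective (word_injective σ)), seqLetter_word]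

theorem leftRun_eq {m : ℕ} (σ : Equiv.Perm (Fin (m + 1))) :
    leftRun σ = 1 + changes true (letters σ) := by
  rw [leftRun, runCount_eq (adjDistinct_of_injective (leftWord_injective σ)),
    seqLetter_leftWord_zero m.succ_pos]
  exact congrArg (fun w => 1 + changes true w) (map_seqLetter_leftWord σ)

theorem leftPk_eq {n : ℕ} (σ : Equiv.Perm (Fin n)) : leftPk σ = peaks true (letters σ) := by
  rw [leftPk, peakCount_eq (adjDistinct_of_injective (leftWord_injective σ))]
  cases n with
  | zero => rfl
  | succ m =>
    have h := peaks_range' (seqLetter (leftWord σ)) m 0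
    simp only [zero_add] at h
    rw [show m + 1 + 1 - 2 = m by omega, ← h, seqLetter_leftWord_zero m.succ_pos]
    exact congrArg (peaks true) (map_seqLetter_leftWord σ)

theorem pk_eq {n : ℕ} (σ : Equiv.Perm (Fin n)) : pk σ = peaks false (letters σ) := by
  rw [pk, peakCount_eq (adjDistinct_of_injective (word_injective σ)), seqLetter_word]
  match n with
  | 0 => rfl
  | 1 => rfl
  | m + 2 =>
    have h := peaks_range' (letter σ) m 0
    simp only [zero_add] at h
    rw [letters_eq_cons, peaks, show m + 2 - 2 = m by omega, ← h]
    simp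

theorem firstRunAscending_iff {m : ℕ} (σ : Equiv.Perm (Fin (m + 2))) :
    FirstRunAscending σ ↔ letter σ 0 = true := by
  have hv := adjDistinct_of_injective (word_injective σ)
  constructor
  · rintro ⟨⟨a, b⟩, hr, h0, hm⟩
    have hab := Fin.lt_def.mp (IsRun.lt hv hr)
    simp only at h0 hab
    rw [strictMonoOn_iff_isMono, seqLetter_word] at hm
    exact hm 0 (by simp only; omega) (by simp only; omega)
  · intro h
    obtain ⟨b, hb⟩ := (exists_isRun_iff hv 0).mpr ⟨by simp, Or.inl (by simp)⟩
    refine ⟨_, hb, rfl, ?_⟩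
    obtain ⟨s, hs⟩ := (monotoneFactor_iff hv _ _).mp hb.2.1
    have hab := Fin.lt_def.mp (IsRun.lt hv hb)
    rw [strictMonoOn_iff_isMono]
    have h0 := hs 0 (by simp) (by simp only; omega)
    rw [seqLetter_word, h] at h0
    rwa [← h0] at hs

theorem firstRunDescending_iff {m : ℕ} (σ : Equiv.Perm (Fin (m + 2))) :
    FirstRunDescending σ ↔ letter σ 0 = false := by
  have hv := adjDistinct_of_injective (word_injective σ)
  constructor
  · rintro ⟨⟨a, b⟩, hr, h0, hm⟩
    have hab := Fin.lt_def.mp (IsRun.lt hv hr)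
    simp only at h0 hab
    rw [strictAntiOn_iff_isMono hv, seqLetter_word] at hm
    exact hm 0 (by simp only; omega) (by simp only; omega)
  · intro h
    obtain ⟨b, hb⟩ := (exists_isRun_iff hv 0).mpr ⟨by simp, Or.inl (by simp)⟩
    refine ⟨_, hb, rfl, ?_⟩
    obtain ⟨s, hs⟩ := (monotoneFactor_iff hv _ _).mp hb.2.1
    have hab := Fin.lt_def.mp (IsRun.lt hv hb)
    rw [strictAntiOn_iff_isMono hv]
    have h0 := hs 0 (by simp) (by simp only; omega)
    rw [seqLetter_word, h] at h0
    rwa [← h0] at hs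

end
end RunAlgebra

namespace RunAlgebra
noncomputable section

open PowerSeries

/-! Exponential-type power series. -/

section LogDerivative

variable {R : Type*} [CommRing R] [Algebra ℚ R]

/-- Uniqueness for a first order linear differential equation, which stands in for comparing
exponentials. -/
theorem eq_of_derivative_eq_mul {F G P : PowerSeries R} (hF : d⁄dX R F = P * F)
    (hG : d⁄dX R G = P * G) (h0 : constantCoeff F = constantCoeff G) : F = G := by
  ext n
  induction n using Nat.strong_induction_on with
  | _ n ih =>
    cases n with
    | zero => rwa [coeff_zero_eq_constantCoeff_apply, coeff_zero_eq_constantCoeff_apply]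
    | succ n =>
      have h1 := congrArg (coeff n) hF
      have h2 := congrArg (coeff n) hG
      rw [coeff_derivative, coeff_mul] at h1 h2
      have h3 : coeff (n + 1) F * (n + 1) = coeff (n + 1) G * (n + 1) := by
        rw [h1, h2]
        refine Finset.sum_congr rfl fun p hp => ?_
        rw [Finset.HasAntidiagonal.mem_antidiagonal] at hp
        rw [ih p.2 (by omega)]
      have hu : IsUnit ((n : R) + 1) := by
        have : ((n : R) + 1) = algebraMap ℚ R ((n : ℚ) + 1) := by simp
        rw [this]
        exact (IsUnit.mk0 _ (by positivity)).map _
      exact hu.mul_left_injective h3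

/-- `∏ r^{i_r} i_r!`, where `i_r` is the multiplicity of `r`. -/
def zMultiset (s : Multiset ℕ) : ℕ := ∏ r ∈ s.toFinset, r ^ s.count r * (s.count r).factorial

theorem zMultiset_eq_prod {s : Multiset ℕ} {t : Finset ℕ} (h : s.toFinset ⊆ t) :
    zMultiset s = ∏ r ∈ t, r ^ s.count r * (s.count r).factorial := by
  refine Finset.prod_subset h fun r _ hr => ?_
  rw [Multiset.mem_toFinset] at hr
  rw [Multiset.count_eq_zero_of_notMem hr]
  rfl

theorem zMultiset_cons (i : ℕ) (s : Multiset ℕ) :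
    zMultiset (i ::ₘ s) = zMultiset s * (i * (s.count i + 1)) := by
  have h1 : s.toFinset ⊆ (i ::ₘ s).toFinset := by
    rw [Multiset.toFinset_cons]
    exact Finset.subset_insert _ _
  have h2 : ∀ r ∈ (i ::ₘ s).toFinset,
      r ^ (i ::ₘ s).count r * ((i ::ₘ s).count r).factorial =
      (r ^ s.count r * (s.count r).factorial) * if r = i then i * (s.count i + 1) else 1 := by
    intro r _
    by_cases h : r = i
    · subst h
      rw [Multiset.count_cons_self, if_pos rfl, pow_succ, Nat.factorial_succ]
      ring
    · rw [Multiset.count_cons_of_ne h, if_neg h, mul_one]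
  rw [zMultiset_eq_prod h1, zMultiset, Finset.prod_congr rfl h2, Finset.prod_mul_distrib,
    Finset.prod_ite_eq', if_pos (by simp)]

theorem zMultiset_pos {s : Multiset ℕ} (h : ∀ i ∈ s, 0 < i) : 0 < zMultiset s :=
  Finset.prod_pos fun r hr =>
    Nat.mul_pos (pow_pos (h r (Multiset.mem_toFinset.mp hr)) _) (Nat.factorial_pos _)

/-- The multisets of parts of the partitions of `n`. -/
def partMultisets (n : ℕ) : Finset (Multiset ℕ) :=
  Finset.univ.image fun l : n.Partition => l.parts

theorem mem_partMultisets {n : ℕ} {s : Multiset ℕ} :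
    s ∈ partMultisets n ↔ s.sum = n ∧ ∀ i ∈ s, 0 < i := by
  rw [partMultisets, Finset.mem_image]
  constructor
  · rintro ⟨l, _, rfl⟩
    exact ⟨l.parts_sum, fun i hi => l.parts_pos hi⟩
  · rintro ⟨h1, h2⟩
    exact ⟨⟨s, fun {i} hi => h2 i hi, h1⟩, Finset.mem_univ _, rfl⟩

theorem sum_partMultisets {M : Type*} [AddCommMonoid M] (n : ℕ) (f : Multiset ℕ → M) :
    ∑ l : n.Partition, f l.parts = ∑ s ∈ partMultisets n, f s := by
  rw [partMultisets, Finset.sum_image fun l _ l' _ h => Nat.Partition.ext h]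

/-- The series `∑ z_λ⁻¹ ∏ u(λᵢ) t^{|λ|}`. -/
def cycleSeries (u : ℕ → R) : PowerSeries R :=
  mk fun n => ∑ s ∈ partMultisets n, (1 / (zMultiset s : ℚ)) • (s.map u).prod

theorem constantCoeff_cycleSeries (u : ℕ → R) : constantCoeff (cycleSeries u) = 1 := by
  have : partMultisets 0 = {0} := by
    ext s
    rw [mem_partMultisets, Finset.mem_singleton]
    constructor
    · rintro ⟨h1, h2⟩
      refine Multiset.eq_zero_of_forall_notMem fun i hi => ?_
      have h3 := Multiset.single_le_sum (fun _ _ => Nat.zero_le _) i hi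
      have h4 := h2 i hi
      omega
    · rintro rfl
      simp
  rw [← coeff_zero_eq_constantCoeff_apply, cycleSeries, coeff_mk, this, Finset.sum_singleton]
  simp [zMultiset]

/-- The series is `exp(∑ u(i) tⁱ / i)`. Combinatorially, `n + 1` is the sum of the parts, so a
marked part `i` of multiplicity `c` has weight `ci`; removing it divides `z_λ` by exactly `ci`. -/
theorem derivative_cycleSeries (u : ℕ → R) :
    d⁄dX R (cycleSeries u) = (mk fun n => u (n + 1)) * cycleSeries u := by
  ext n
  rw [coeff_derivative, coeff_mul]
  simp only [cycleSeries, coeff_mk]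
  have h1 : ∀ s ∈ partMultisets (n + 1), (1 / (zMultiset s : ℚ)) • (s.map u).prod * ((n : R) + 1) =
      ∑ i ∈ s.toFinset, ((s.count i * i : ℕ) : ℚ) • (1 / (zMultiset s : ℚ)) • (s.map u).prod := by
    intro s hs
    rw [← Finset.sum_smul, ← Nat.cast_sum]
    have h2 : ∑ i ∈ s.toFinset, s.count i * i = n + 1 := by
      rw [← (mem_partMultisets.mp hs).1, Finset.sum_multiset_count]
      simp
    rw [h2, Algebra.smul_def ((n + 1 : ℕ) : ℚ), mul_comm]
    simp
  rw [Finset.sum_mul, Finset.sum_congr rfl h1, Finset.sum_sigma']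
  simp only [Finset.mul_sum]
  rw [Finset.sum_sigma']
  -- The marked part is stored as its predecessor, because the coefficient of `tⁿ` in the first
  -- factor is `u (n + 1)`.
  refine Finset.sum_bij' (fun x _ => ⟨(x.2 - 1, n + 1 - x.2), x.1.erase x.2⟩)
    (fun y _ => ⟨(y.1.1 + 1) ::ₘ y.2, y.1.1 + 1⟩) ?_ ?_ ?_ ?_ ?_
  · rintro ⟨s, i⟩ h
    simp only [Finset.mem_sigma, Multiset.mem_toFinset] at h
    obtain ⟨hs, hi⟩ := h
    rw [mem_partMultisets] at hs
    have h3 := hs.2 i hi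
    have h4 : i + (s.erase i).sum = s.sum := Multiset.sum_erase hi
    simp only [Finset.mem_sigma, Finset.HasAntidiagonal.mem_antidiagonal]
    refine ⟨by omega, mem_partMultisets.mpr ⟨by omega, fun j hj => hs.2 j (Multiset.mem_of_mem_erase hj)⟩⟩
  · rintro ⟨⟨i, j⟩, s⟩ h
    simp only [Finset.mem_sigma, Finset.HasAntidiagonal.mem_antidiagonal, mem_partMultisets] at h
    simp only [Finset.mem_sigma, mem_partMultisets, Multiset.mem_toFinset, Multiset.sum_cons]
    refine ⟨⟨by omega, fun k hk => ?_⟩, Multiset.mem_cons_self _ _⟩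
    rcases Multiset.mem_cons.mp hk with rfl | hk
    · omega
    · exact h.2.2 k hk
  · rintro ⟨s, i⟩ h
    simp only [Finset.mem_sigma, Multiset.mem_toFinset] at h
    have h3 := (mem_partMultisets.mp h.1).2 i h.2
    simp only
    rw [Nat.sub_add_cancel h3, Multiset.cons_erase h.2]
  · rintro ⟨⟨i, j⟩, s⟩ h
    simp only [Finset.mem_sigma, Finset.HasAntidiagonal.mem_antidiagonal] at h
    simp only [Nat.add_sub_cancel, Multiset.erase_cons_head]
    rw [show n + 1 - (i + 1) = j by omega]
  · rintro ⟨s, i⟩ h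
    simp only [Finset.mem_sigma, Multiset.mem_toFinset] at h
    obtain ⟨hs, hi⟩ := h
    have h3 := (mem_partMultisets.mp hs).2
    obtain ⟨t, rfl⟩ := Multiset.exists_cons_of_mem hi
    have hz : (zMultiset t : ℚ) ≠ 0 := by
      exact_mod_cast (zMultiset_pos fun j hj => h3 j (Multiset.mem_cons_of_mem hj)).ne'
    have hi0 : (i : ℚ) ≠ 0 := by exact_mod_cast (h3 i hi).ne'
    simp only [Multiset.erase_cons_head]
    rw [Nat.sub_add_cancel (h3 i hi), Multiset.map_cons, Multiset.prod_cons, smul_smul,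
      mul_smul_comm, zMultiset_cons, Multiset.count_cons_self]
    congr 1
    push_cast
    field_simp

theorem cycleSeries_add (u v : ℕ → R) :
    cycleSeries (fun n => u n + v n) = cycleSeries u * cycleSeries v := by
  refine eq_of_derivative_eq_mul (derivative_cycleSeries _) ?_ ?_
  · rw [Derivation.leibniz, derivative_cycleSeries, derivative_cycleSeries]
    have : (mk fun n => u (n + 1) + v (n + 1)) =
      (mk fun n => u (n + 1)) + mk fun n => v (n + 1) := rfl
    rw [this, smul_eq_mul, smul_eq_mul]
    ring
  · simp [constantCoeff_cycleSeries]

theorem cycleSeries_zero : cycleSeries (fun _ => (0 : R)) = 1 := by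
  refine eq_of_derivative_eq_mul (derivative_cycleSeries _) ?_ ?_
  · have : (mk fun _ => (0 : R)) = 0 := rfl
    rw [this, zero_mul]
    exact Derivation.map_one_eq_zero _
  · simp [constantCoeff_cycleSeries]

end LogDerivative

/-! Newton's identities. -/

-- The powers `x_j^{i+1}` dividing a monomial number one for each `j` and each `i < m_j`, so their
-- number is its degree.
open Classical in
theorem card_powers_dividing (m : ℕ →₀ ℕ) (n : ℕ) (hm : m.degree = n) :
    (((Finset.range n) ×ˢ (Finset.HasAntidiagonal.antidiagonal m)).filter
      fun x : ℕ × (ℕ →₀ ℕ) × (ℕ →₀ ℕ) => ∃ j, x.2.1 = Finsupp.single j (x.1 + 1)).card = n := by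
  have h1 : (m.support.sigma fun j => Finset.range (m j)).card = n := by
    rw [Finset.card_sigma, ← hm]
    simp only [Finset.card_range]
    rfl
  rw [← h1]
  symm
  refine Finset.card_bij (fun x _ => (x.2, Finsupp.single x.1 (x.2 + 1),
    m - Finsupp.single x.1 (x.2 + 1))) ?_ ?_ ?_
  · rintro ⟨j, i⟩ h
    simp only [Finset.mem_sigma, Finset.mem_range] at h
    have hle : Finsupp.single j (i + 1) ≤ m := by
      rw [Finsupp.single_le_iff]
      exact h.2
    simp only [Finset.mem_filter, Finset.mem_product, Finset.mem_range,
      Finset.HasAntidiagonal.mem_antidiagonal]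
    refine ⟨⟨?_, add_tsub_cancel_of_le hle⟩, j, rfl⟩
    have := Finsupp.le_degree j m
    omega
  · rintro ⟨j, i⟩ _ ⟨j', i'⟩ _ h
    simp only [Prod.mk.injEq] at h
    obtain ⟨rfl, h, _⟩ := h
    rw [Finsupp.single_left_inj (by omega)] at h
    rw [h]
  · rintro ⟨i, p, q⟩ h
    simp only [Finset.mem_filter, Finset.mem_product, Finset.mem_range,
      Finset.HasAntidiagonal.mem_antidiagonal] at h
    obtain ⟨⟨_, hpq⟩, j, rfl⟩ := h
    have hj : i + 1 ≤ m j := by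
      rw [← hpq]
      simp
    refine ⟨⟨j, i⟩, ?_, ?_⟩
    · simp only [Finset.mem_sigma, Finset.mem_range, Finsupp.mem_support_iff]
      omega
    · rw [← hpq]
      simp

theorem hSym_zero : hSym 0 = 1 := by
  classical
  refine Subtype.ext (MvPowerSeries.ext fun m => ?_)
  change MvPowerSeries.coeff m (hSeries 0) = MvPowerSeries.coeff m 1
  rw [coeff_hSeries, MvPowerSeries.coeff_one]
  exact if_congr (Finsupp.degree_eq_zero_iff m) rfl rfl

/-- The coefficient of a monomial of degree `n + 1` on the right counts the powers of a single
variable that divide it. -/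
theorem newton (n : ℕ) : ((n + 1 : ℕ) : SymFun) * hSym (n + 1) =
    ∑ p ∈ Finset.HasAntidiagonal.antidiagonal n, pSym (p.1 + 1) * hSym p.2 := by
  classical
  refine Subtype.ext (MvPowerSeries.ext fun m => ?_)
  have h1 : MvPowerSeries.coeff m ((((n + 1 : ℕ) : SymFun) * hSym (n + 1) : SymFun) :
      MvPowerSeries ℕ ℚ) = ((n + 1 : ℕ) : ℚ) * if m.degree = n + 1 then 1 else 0 := by
    rw [← coeff_hSeries, ← nsmul_eq_mul, ← nsmul_eq_mul, ← map_nsmul]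
    rfl
  have h2 : ((∑ p ∈ Finset.HasAntidiagonal.antidiagonal n, pSym (p.1 + 1) * hSym p.2 : SymFun) :
      MvPowerSeries ℕ ℚ) =
      ∑ p ∈ Finset.HasAntidiagonal.antidiagonal n, pSeries (p.1 + 1) * hSeries p.2 := by
    rw [AddSubmonoidClass.coe_finsetSum]
    rfl
  rw [h1, h2, map_sum, Finset.Nat.sum_antidiagonal_eq_sum_range_succ
    fun i j => MvPowerSeries.coeff m (pSeries (i + 1) * hSeries j)]
  simp only [MvPowerSeries.coeff_mul, coeff_hSeries, coeff_pSeries]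
  rw [← Finset.sum_product']
  have h3 : ∀ x ∈ Finset.range n.succ ×ˢ Finset.HasAntidiagonal.antidiagonal m,
      ((if ∃ j, x.2.1 = Finsupp.single j (x.1 + 1) then (1 : ℚ) else 0) *
        if x.2.2.degree = n - x.1 then 1 else 0) =
      if (∃ j, x.2.1 = Finsupp.single j (x.1 + 1)) then (if m.degree = n + 1 then 1 else 0)
        else 0 := by
    rintro ⟨i, p, q⟩ hx
    simp only [Finset.mem_product, Finset.mem_range, Finset.HasAntidiagonal.mem_antidiagonal] at hx
    simp only
    split_ifs with h4 h5 h6 h6 <;> try simp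
    all_goals
      obtain ⟨j, rfl⟩ := h4
      have h7 := congrArg Finsupp.degree hx.2
      rw [map_add, Finsupp.degree_single] at h7
      omega
  rw [Finset.sum_congr rfl h3]
  split_ifs with hm
  · rw [Finset.sum_boole, card_powers_dividing m (n + 1) hm, mul_one]
  · simp

end
end RunAlgebra

namespace RunAlgebra
noncomputable section

open PowerSeries

/-! Commutative images. -/

/-- The weight of a part in the series counting odd parts by `a` and even parts by `b`. -/
def partWeight (a b : ℚ) (i : ℕ) : SymFun := (if Odd i then a else b) • pSym i

/-- The series `∑ a^{ℓ_o(λ)} b^{ℓ_e(λ)} p_λ / z_λ`. -/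
def partSeries (a b : ℚ) : PowerSeries SymFun := cycleSeries (partWeight a b)

theorem prod_map_partWeight (a b : ℚ) (s : Multiset ℕ) :
    (s.map (partWeight a b)).prod =
      (a ^ (s.countP fun i => Odd i) * b ^ (s.countP fun i => Even i)) • (s.map pSym).prod := by
  induction s using Multiset.induction_on with
  | empty => simp
  | cons i s ih =>
    rw [Multiset.map_cons, Multiset.prod_cons, ih, Multiset.map_cons, Multiset.prod_cons,
      Multiset.countP_cons, Multiset.countP_cons, partWeight, smul_mul_smul_comm]
    congr 1
    by_cases h : Odd i
    · have h' : ¬ Even i := Nat.not_even_iff_odd.mpr h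
      simp only [h, h', if_true, if_false]
      ring
    · have h' : Even i := Nat.not_odd_iff_even.mp h
      simp only [h, h', if_true, if_false]
      ring

theorem coeff_partSeries (a b : ℚ) (n : ℕ) :
    coeff n (partSeries a b) = ∑ l : n.Partition,
      (a ^ oddLen l * b ^ evenLen l / (zPart l : ℚ)) • pPart l := by
  rw [partSeries, cycleSeries, coeff_mk, ← sum_partMultisets]
  refine Finset.sum_congr rfl fun l _ => ?_
  rw [prod_map_partWeight, smul_smul, one_div, inv_mul_eq_div]
  rfl

theorem partSeries_add (a b a' b' : ℚ) :
    partSeries (a + a') (b + b') = partSeries a b * partSeries a' b' := by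
  rw [partSeries, partSeries, partSeries, ← cycleSeries_add]
  congr 1
  funext i
  rw [partWeight, partWeight, partWeight, ← add_smul]
  split_ifs <;> rfl

theorem partSeries_zero : partSeries 0 0 = 1 := by
  rw [partSeries, ← cycleSeries_zero]
  congr 1
  funext i
  simp [partWeight]

theorem Gam_genS (n : ℕ) : Gam (genS n) = hSym n := by
  rw [genS]
  split_ifs with h
  · rw [Gam, MonoidAlgebra.lift_single, one_smul, FreeMonoid.lift_eval_of]
    rfl
  · obtain rfl : n = 0 := by omega
    rw [map_one, hSym_zero]

/-- `Γ`, coefficientwise. -/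
def GamHat : NSymHat →+* PowerSeries SymFun := PowerSeries.map (Gam : NSym →+* SymFun)

theorem coeff_GamHat (n : ℕ) (F : NSymHat) : coeff n (GamHat F) = Gam (coeff n F) :=
  coeff_map _ _ _

theorem GamHat_V1plus : GamHat V1plus = partSeries 1 1 := by
  have h : ∀ n, coeff n (GamHat V1plus) = hSym n := fun n => by
    rw [coeff_GamHat, coeff_V1plus, Gam_genS]
  refine eq_of_derivative_eq_mul ?_ (derivative_cycleSeries _) ?_
  · ext1 n
    have hn := newton n
    rw [coeff_derivative, h, mul_comm, coeff_mul]
    simp only [h, coeff_mk]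
    push_cast at hn
    rw [hn]
    refine Finset.sum_congr rfl fun p _ => ?_
    simp [partWeight]
  · rw [partSeries, constantCoeff_cycleSeries, ← coeff_zero_eq_constantCoeff_apply, h, hSym_zero]

theorem neg_one_pow_sum (s : Multiset ℕ) :
    (-1 : ℚ) ^ s.sum = (-1) ^ (s.countP fun i => Odd i) := by
  induction s using Multiset.induction_on with
  | empty => simp
  | cons i s ih =>
    rw [Multiset.sum_cons, Multiset.countP_cons, pow_add, pow_add, ih, mul_comm]
    congr 1
    by_cases h : Odd i
    · simp [h]
    · simp [h, (Nat.not_odd_iff_even.mp h).neg_one_pow]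

/-- The inverse of `partSeries 1 1` is `partSeries (-1) (-1)`. Undoing the sign `(-1)ⁿ`, which is
`(-1)` to the number of odd parts, restores the weight `1` on odd parts only. -/
theorem GamHat_V1minus : GamHat V1minus = partSeries 1 (-1) := by
  have h1 : partSeries (-1) (-1) * partSeries 1 1 = 1 := by
    rw [← partSeries_add, neg_add_cancel, partSeries_zero]
  have h2 : GamHat V1inv = partSeries (-1) (-1) := by
    rw [← one_mul (GamHat V1inv), ← h1, mul_assoc, ← GamHat_V1plus, ← map_mul, V1plus_mul_V1inv,
      map_one, mul_one]
  ext1 n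
  have h3 := congrArg (coeff n) h2
  rw [coeff_GamHat, V1inv, coeff_mk, map_smul, coeff_partSeries] at h3
  have h4 : Gam (ribbonR (Composition.ones n)) =
      (-1 : ℚ) ^ n • (-1 : ℚ) ^ n • Gam (ribbonR (Composition.ones n)) := by
    rw [smul_smul, ← mul_pow]
    simp
  rw [coeff_GamHat, V1minus, coeff_mk, h4, h3, coeff_partSeries, Finset.smul_sum]
  refine Finset.sum_congr rfl fun l _ => ?_
  have h5 : (-1 : ℚ) ^ n = (-1) ^ oddLen l := by
    rw [oddLen, ← neg_one_pow_sum, l.parts_sum]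
  rw [smul_smul, h5, mul_div_assoc', ← mul_assoc, ← mul_pow]
  simp

/-- The weight of even parts in the commutative images of alternating products. -/
def evenWeight (e odd : Bool) : ℚ := if odd then (if e then 1 else -1) else 0

theorem GamHat_V1 (e : Bool) : GamHat (V1 e) = partSeries 1 (evenWeight e true) := by
  cases e
  · exact GamHat_V1minus
  · exact GamHat_V1plus

theorem GamHat_V2 (e : Bool) : GamHat (V2 e) = partSeries 2 0 := by
  rw [V2_eq, map_mul, GamHat_V1, GamHat_V1, ← partSeries_add]
  congr 1
  · norm_num
  · cases e <;> simp [evenWeight]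

theorem GamHat_V2_pow (e : Bool) (m : ℕ) : GamHat (V2 e ^ m) = partSeries (2 * m) 0 := by
  rw [map_pow, GamHat_V2]
  induction m with
  | zero => simp [partSeries_zero]
  | succ m ih =>
    rw [pow_succ, ih, ← partSeries_add]
    congr 1
    · push_cast
      ring
    · norm_num

theorem GamHat_altProd (e odd : Bool) (m : ℕ) :
    GamHat (altProd e (2 * m + odd.toNat)) =
      partSeries ((2 * m + odd.toNat : ℕ) : ℚ) (evenWeight e odd) := by
  cases odd
  · simp only [Bool.toNat_false, add_zero, altProd_even, GamHat_V2_pow]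
    simp [evenWeight]
  · simp only [Bool.toNat_true, altProd_odd, map_mul, GamHat_V1, GamHat_V2_pow]
    rw [← partSeries_add]
    congr 1
    · push_cast
      ring
    · simp

theorem oddLen_le {n : ℕ} (l : n.Partition) : oddLen l ≤ n := by
  refine (Multiset.countP_le_card _ _).trans ?_
  have h := Multiset.card_nsmul_le_sum (s := l.parts) (a := 1) fun i hi => l.parts_pos hi
  rwa [l.parts_sum, smul_eq_mul, mul_one] at h

/-- In the image of an alternating product the number of factors occurs only through its power
`ℓ_o(λ)`, so the coefficient of `r^k` selects `ℓ_o(λ) = k`. For even products the even parts have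
weight `0`, and `0 ^ 0 = 1` selects the partitions without even parts. -/
theorem Gam_coeff_IJ (e odd : Bool) {n k : ℕ} (hk : k ≤ n) :
    Gam (coeff n (IJ e odd k)) = ∑ l : n.Partition,
      (if oddLen l = k then evenWeight e odd ^ evenLen l / (zPart l : ℚ) else 0) • pPart l := by
  refine eq_of_sum_pow_smul_eq (N := n + 1) (infinite_parity odd)
    (c := fun k => Gam (coeff n (IJ e odd k))) (d := fun k => ∑ l : n.Partition,
      (if oddLen l = k then evenWeight e odd ^ evenLen l / (zPart l : ℚ) else 0) • pPart l) ?_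
    (by omega)
  rintro x ⟨m, rfl⟩
  have h := congrArg (coeff n) (GamHat_altProd e odd m)
  rw [coeff_GamHat, coeff_altProd, map_sum, coeff_partSeries] at h
  simp only [map_smul] at h
  rw [h]
  simp only [Finset.smul_sum]
  rw [Finset.sum_comm]
  refine Finset.sum_congr rfl fun l _ => ?_
  simp only [ite_smul, zero_smul, smul_ite, smul_zero, smul_smul]
  rw [Finset.sum_ite_eq, if_pos (by have := oddLen_le l; simp; omega), mul_div_assoc]

/-- The images under `Γ` of combinations of Eulerian elements with the same index. -/
theorem Gam_eq_pSum {n k : ℕ} {F : NSym} {q : ℕ → Prop} {w : ℕ → ℚ}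
    (hF : Gam F = ∑ l : n.Partition,
      (if oddLen l = k then w (evenLen l) / (zPart l : ℚ) else 0) • pPart l)
    (hw : ∀ e, w e = 1 ∧ q e ∨ w e = 0 ∧ ¬ q e) :
    Gam F = pSum n fun o e => o = k ∧ q e := by
  rw [hF, pSum, Finset.sum_filter]
  refine Finset.sum_congr rfl fun l _ => ?_
  by_cases h : oddLen l = k
  · rcases hw (evenLen l) with ⟨h1, h2⟩ | ⟨h1, h2⟩
    · rw [if_pos h, if_pos ⟨h, h2⟩, h1]
    · rw [if_pos h, if_neg fun h' => h2 h'.2, h1, zero_div, zero_smul]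
  · rw [if_neg h, if_neg fun h' => h h'.1, zero_smul]

/-! ### Images of the idempotents under `Γ`. -/

theorem Gam_Iplusn {n k : ℕ} (hk : k ≤ n) :
    Gam (Iplusn n k) = pSum n fun o e => o = k ∧ e = 0 := by
  refine Gam_eq_pSum (Gam_coeff_IJ false false hk) (w := fun e => evenWeight false false ^ e)
    fun e => ?_
  rcases Nat.eq_zero_or_pos e with rfl | h
  · simp
  · simp [evenWeight, h.ne']

theorem Gam_Iminusn {n k : ℕ} (hk : k ≤ n) :
    Gam (Iminusn n k) = pSum n fun o e => o = k ∧ e = 0 := by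
  refine Gam_eq_pSum (Gam_coeff_IJ true false hk) (w := fun e => evenWeight true false ^ e)
    fun e => ?_
  rcases Nat.eq_zero_or_pos e with rfl | h
  · simp
  · simp [evenWeight, h.ne']

theorem Gam_Jplusn {n k : ℕ} (hk : k ≤ n) :
    Gam (Jplusn n k) = pSum n fun o _ => o = k := by
  have := Gam_eq_pSum (Gam_coeff_IJ true true hk) (q := fun _ => True)
    (w := fun e => evenWeight true true ^ e) fun e => by simp [evenWeight]
  simp only [and_true] at this
  exact this

theorem sum_smul_ite_add {n k : ℕ} (c d : ℚ) (v w : ℕ → ℚ) :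
    c • (∑ l : n.Partition, (if oddLen l = k then v (evenLen l) / (zPart l : ℚ) else 0) • pPart l) +
      d • (∑ l : n.Partition, (if oddLen l = k then w (evenLen l) / (zPart l : ℚ) else 0) • pPart l) =
    ∑ l : n.Partition, (if oddLen l = k then (c * v (evenLen l) + d * w (evenLen l)) / (zPart l : ℚ)
      else 0) • pPart l := by
  rw [Finset.smul_sum, Finset.smul_sum, ← Finset.sum_add_distrib]
  refine Finset.sum_congr rfl fun l _ => ?_
  rw [smul_smul, smul_smul, ← add_smul]
  split_ifs
  · congr 1
    ring
  · simp

theorem elemA_eq (n k : ℕ) : elemA n k =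
    (1 / 2 : ℚ) • coeff n (IJ false false k) + (1 / 2 : ℚ) • coeff n (IJ true false k) :=
  smul_add _ _ _

theorem elemB_eq (n k : ℕ) : elemB n k =
    (1 : ℚ) • ((1 / 2 : ℚ) • coeff n (IJ true true k) + (1 / 2 : ℚ) • coeff n (IJ false true k)) +
    (-1 : ℚ) • ((1 / 2 : ℚ) • coeff n (IJ false false k) +
      (1 / 2 : ℚ) • coeff n (IJ true false k)) := by
  change (1 / 2 : ℚ) • (coeff n (IJ true true k) + coeff n (IJ false true k) -
    coeff n (IJ false false k) - coeff n (IJ true false k)) = _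
  module

theorem elemC_eq (n k : ℕ) : elemC n k =
    (1 / 2 : ℚ) • coeff n (IJ true true k) + (-1 / 2 : ℚ) • coeff n (IJ false true k) := by
  change (1 / 2 : ℚ) • (coeff n (IJ true true k) - coeff n (IJ false true k)) = _
  module

theorem Jplusn_sub_Iplusn_eq (n k : ℕ) : Jplusn n k - Iplusn n k =
    (1 : ℚ) • coeff n (IJ true true k) + (-1 : ℚ) • coeff n (IJ false false k) := by
  change coeff n (IJ true true k) - coeff n (IJ false false k) = _
  module

theorem Gam_elemA {n k : ℕ} (hk : k ≤ n) :
    Gam (elemA n k) = pSum n fun o e => o = k ∧ e = 0 := by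
  refine Gam_eq_pSum (w := fun e => 1 / 2 * evenWeight false false ^ e +
    1 / 2 * evenWeight true false ^ e) ?_ fun e => ?_
  · rw [elemA_eq, map_add, map_smul, map_smul, Gam_coeff_IJ _ _ hk, Gam_coeff_IJ _ _ hk]
    exact sum_smul_ite_add _ _ (fun e => evenWeight false false ^ e) fun e => evenWeight true false ^ e
  · rcases Nat.eq_zero_or_pos e with rfl | h
    · norm_num
    · simp [evenWeight, h.ne']

theorem Gam_Jplusn_sub_Iplusn {n k : ℕ} (hk : k ≤ n) :
    Gam (Jplusn n k - Iplusn n k) = pSum n fun o e => o = k ∧ 0 < e := by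
  refine Gam_eq_pSum (w := fun e => 1 * evenWeight true true ^ e +
    (-1) * evenWeight false false ^ e) ?_ fun e => ?_
  · rw [Jplusn_sub_Iplusn_eq, map_add, map_smul, map_smul, Gam_coeff_IJ _ _ hk, Gam_coeff_IJ _ _ hk]
    exact sum_smul_ite_add _ _ (fun e => evenWeight true true ^ e) fun e => evenWeight false false ^ e
  · rcases Nat.eq_zero_or_pos e with rfl | h
    · norm_num
    · simp [evenWeight, h.ne', h]

theorem Gam_elemC {n k : ℕ} (hk : k ≤ n) :
    Gam (elemC n k) = pSum n fun o e => o = k ∧ Odd e := by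
  refine Gam_eq_pSum (w := fun e => 1 / 2 * evenWeight true true ^ e +
    -1 / 2 * evenWeight false true ^ e) ?_ fun e => ?_
  · rw [elemC_eq, map_add, map_smul, map_smul, Gam_coeff_IJ _ _ hk, Gam_coeff_IJ _ _ hk]
    exact sum_smul_ite_add _ _ (fun e => evenWeight true true ^ e) fun e => evenWeight false true ^ e
  · rcases Nat.even_or_odd e with h | h
    · have : ¬ Odd e := Nat.not_odd_iff_even.mpr h
      simp [evenWeight, h.neg_one_pow, this]
      norm_num
    · simp [evenWeight, h.neg_one_pow, h]
      norm_num

theorem Gam_elemB {n k : ℕ} (hk : k ≤ n) :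
    Gam (elemB n k) = pSum n fun o e => o = k ∧ 0 < e ∧ Even e := by
  refine Gam_eq_pSum (w := fun e => 1 * (1 / 2 * evenWeight true true ^ e +
    1 / 2 * evenWeight false true ^ e) + (-1) * (1 / 2 * evenWeight false false ^ e +
    1 / 2 * evenWeight true false ^ e)) ?_ fun e => ?_
  · rw [elemB_eq]
    simp only [map_add, map_smul]
    rw [Gam_coeff_IJ _ _ hk, Gam_coeff_IJ _ _ hk,
      Gam_coeff_IJ _ _ hk, Gam_coeff_IJ _ _ hk]
    rw [sum_smul_ite_add _ _ (fun e => evenWeight true true ^ e) fun e => evenWeight false true ^ e,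
      sum_smul_ite_add _ _ (fun e => evenWeight false false ^ e) fun e => evenWeight true false ^ e]
    exact sum_smul_ite_add _ _ (fun e => 1 / 2 * evenWeight true true ^ e +
      1 / 2 * evenWeight false true ^ e) fun e => 1 / 2 * evenWeight false false ^ e +
      1 / 2 * evenWeight true false ^ e
  · rcases Nat.eq_zero_or_pos e with rfl | h
    · norm_num
    · rcases Nat.even_or_odd e with h' | h'
      · simp [evenWeight, h'.neg_one_pow, h', h, h.ne']
        norm_num
      · have : ¬ Even e := Nat.not_even_iff_odd.mpr h'
        simp [evenWeight, h'.neg_one_pow, this, h.ne']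

end
end RunAlgebra

namespace RunAlgebra
noncomputable section

open PowerSeries

/-! Homogeneous noncommutative symmetric functions. -/

/-- The degree `n` part of `𝐒𝐲𝐦`. -/
def degPart (n : ℕ) : Submodule ℚ NSym :=
  Submodule.span ℚ ((fun W => MonoidAlgebra.single W (1 : ℚ)) '' {W : FreeMonoid ℕ+ | weight W = n})

theorem weight_mul (W W' : FreeMonoid ℕ+) : weight (W * W') = weight W + weight W' := by
  simp [weight, FreeMonoid.toList_mul]

theorem mul_mem_degPart {m n : ℕ} {F G : NSym} (hF : F ∈ degPart m) (hG : G ∈ degPart n) :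
    F * G ∈ degPart (m + n) := by
  have h := Submodule.mul_mem_mul hF hG
  rw [degPart, degPart, Submodule.span_mul_span] at h
  refine Submodule.span_mono ?_ h
  rintro _ ⟨_, ⟨W, hW, rfl⟩, _, ⟨W', hW', rfl⟩, rfl⟩
  refine ⟨W * W', ?_, ?_⟩
  · rw [Set.mem_ofPred_eq] at *
    rw [weight_mul, hW, hW']
  · simp [MonoidAlgebra.single_mul_single]

theorem one_mem_degPart_zero : (1 : NSym) ∈ degPart 0 :=
  Submodule.subset_span ⟨1, weight_one, rfl⟩

theorem completeS_mem_degPart {n : ℕ} (I : Composition n) : completeS I ∈ degPart n :=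
  Submodule.subset_span ⟨compWord I, weight_compWord I, rfl⟩

theorem ribbonR_mem_degPart {n : ℕ} (I : Composition n) : ribbonR I ∈ degPart n :=
  Submodule.sum_mem _ fun J _ => Submodule.smul_mem _ _ (completeS_mem_degPart J)

theorem coeff_V1_mem_degPart (e : Bool) (n : ℕ) : coeff n (V1 e) ∈ degPart n := by
  cases e
  · change coeff n V1minus ∈ _
    rw [V1minus, coeff_mk]
    exact ribbonR_mem_degPart _
  · change coeff n V1plus ∈ _
    rw [V1plus, coeff_mk]
    exact ribbonR_mem_degPart _

theorem coeff_altProd_mem_degPart (e : Bool) (r n : ℕ) : coeff n (altProd e r) ∈ degPart n := by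
  induction r generalizing n with
  | zero =>
    rw [altProd, coeff_one]
    split_ifs with h
    · exact h ▸ one_mem_degPart_zero
    · exact Submodule.zero_mem _
  | succ r ih =>
    rw [altProd, coeff_mul]
    refine Submodule.sum_mem _ fun p hp => ?_
    rw [← Finset.HasAntidiagonal.mem_antidiagonal.mp hp]
    exact mul_mem_degPart (coeff_V1_mem_degPart _ _) (ih _)

/-- The alternating products are homogeneous; modulo `degPart n` they give a polynomial with
infinitely many zeros, so its coefficients vanish too. -/
theorem coeff_IJ_mem_degPart (e odd : Bool) {n k : ℕ} (hk : k ≤ n) :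
    coeff n (IJ e odd k) ∈ degPart n := by
  rw [← Submodule.Quotient.mk_eq_zero, ← Submodule.mkQ_apply]
  refine eq_zero_of_sum_pow_smul_eq_zero (N := n + 1) (infinite_parity odd)
    (c := fun k => (degPart n).mkQ (coeff n (IJ e odd k))) ?_ (by omega)
  rintro x ⟨m, rfl⟩
  have h := coeff_altProd_mem_degPart e (2 * m + odd.toNat) n
  rw [coeff_altProd, ← Submodule.Quotient.mk_eq_zero, ← Submodule.mkQ_apply, map_sum] at h
  simpa only [map_smul] using h

theorem eq_sum_of_mem_degPart {n : ℕ} {F : NSym} (hF : F ∈ degPart n) :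
    F = ∑ I : Composition n, F.coeff (compWord I) • completeS I := by
  classical
  refine Submodule.span_induction ?_ ?_ ?_ ?_ hF
  · rintro _ ⟨W, hW, rfl⟩
    obtain ⟨I, rfl⟩ := exists_compWord_eq hW
    rw [Finset.sum_eq_single I]
    · simp [completeS]
    · intro J _ hJ
      rw [MonoidAlgebra.coeff_single, Finsupp.single_apply,
        if_neg fun h => hJ (compWord_injective n h).symm, zero_smul]
    · simp
  · simp
  · intro F G _ _ hF hG
    simp only [MonoidAlgebra.coeff_add, Finsupp.add_apply, add_smul, Finset.sum_add_distrib]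
    rw [← hF, ← hG]
  · intro c F _ hF
    simp only [MonoidAlgebra.coeff_smul_apply, smul_assoc, ← Finset.smul_sum]
    rw [← hF]

/-! Linear independence of the sums `S^I` in the descent algebra. -/

theorem mem_boundaries_iff {n : ℕ} {I : Composition n} {b : Fin (n + 1)} :
    b ∈ I.boundaries ↔ (b : ℕ) = 0 ∨ (b : ℕ) = n ∨ (b : ℕ) ∈ compDes I := by
  rw [Composition.boundaries, Finset.mem_map, mem_compDes]
  constructor
  · rintro ⟨j, _, rfl⟩
    change I.sizeUpTo j = 0 ∨ I.sizeUpTo j = n ∨ ∃ j', 1 ≤ j' ∧ j' < I.length ∧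
      I.sizeUpTo j' = I.sizeUpTo j
    rcases Nat.eq_zero_or_pos (j : ℕ) with h | h
    · left
      rw [h, I.sizeUpTo_zero]
    · rcases (Nat.lt_succ_iff.mp j.isLt).eq_or_lt with h' | h'
      · right; left
        rw [h', I.sizeUpTo_length]
      · exact Or.inr (Or.inr ⟨j, h, h', rfl⟩)
  · rintro (h | h | ⟨j, h1, h2, h3⟩)
    · exact ⟨0, Finset.mem_univ _, Fin.ext (by rw [h]; exact I.sizeUpTo_zero)⟩
    · exact ⟨Fin.last _, Finset.mem_univ _, Fin.ext (by rw [h]; exact I.sizeUpTo_length)⟩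
    · exact ⟨⟨j, by omega⟩, Finset.mem_univ _, Fin.ext h3⟩

theorem eq_of_compDes_subset {n : ℕ} {I J : Composition n} (h : compDes I ⊆ compDes J)
    (hl : J.length ≤ I.length) : I = J := by
  have h1 : I.boundaries = J.boundaries := by
    refine Finset.eq_of_subset_of_card_le (fun b hb => ?_) ?_
    · rw [mem_boundaries_iff] at *
      exact hb.imp_right (Or.imp_right fun hb => h hb)
    · rw [I.card_boundaries_eq_succ_length, J.card_boundaries_eq_succ_length]
      omega
  exact (compositionEquiv n).injective (CompositionAsSet.ext h1)

/-- Positions are labelled by twice the number of elements of `Des(I)` passed so far. Even labels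
have sign `true`, so ranks increase within a block, and a larger label gives smaller ranks, hence a
descent between blocks. -/
theorem exists_permDes_eq {n : ℕ} (I : Composition n) :
    ∃ σ : Equiv.Perm (Fin n), permDes σ = (compDes I : Set ℕ) := by
  let c : ℕ → ℕ := fun a => ((compDes I).filter fun d => d ≤ a).card
  have hc : ∀ a, 2 * c a < 2 * (compDes I).card + 1 := fun a => by
    have : c a ≤ (compDes I).card := Finset.card_filter_le _ _
    omega
  refine ⟨labelPerm true fun a : Fin n => ⟨2 * c a, hc a⟩, ?_⟩
  have hmono : ∀ a, c a < c (a + 1) ↔ a + 1 ∈ compDes I := by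
    intro a
    constructor
    · intro h
      by_contra h'
      refine h.ne (congrArg Finset.card (Finset.filter_congr fun d hd => ?_))
      have : d ≠ a + 1 := fun h => h' (h ▸ hd)
      omega
    · intro h
      refine Finset.card_lt_card (Finset.ssubset_iff_of_subset ?_ |>.mpr ⟨a + 1, ?_, ?_⟩)
      · intro d hd
        rw [Finset.mem_filter] at *
        exact ⟨hd.1, by omega⟩
      · rw [Finset.mem_filter]
        exact ⟨h, le_rfl⟩
      · rw [Finset.mem_filter]
        omega
  have hle : ∀ a, c a ≤ c (a + 1) := fun a => Finset.card_le_card fun d hd => by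
    rw [Finset.mem_filter] at *
    exact ⟨hd.1, by omega⟩
  ext m
  constructor
  · rintro ⟨a, b, ha, hb, h⟩
    have h1 := (labelPerm_lt_iff _ _ _ _).mp (Fin.lt_def.mpr (Nat.lt_of_succ_lt_succ h))
    rw [labelKey_lt_iff] at h1
    have h2 : (b : ℕ) = a + 1 := by omega
    rcases h1 with h1 | ⟨-, h1⟩
    · have h3 : 2 * c a < 2 * c b := h1
      rw [h2] at h3
      exact ha ▸ Finset.mem_coe.mpr ((hmono a).mp (by omega))
    · rw [altSign_two_mul, if_pos rfl, Fin.lt_def] at h1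
      omega
  · intro hm
    obtain ⟨h1, h2⟩ := compDes_bounds (Finset.mem_coe.mp hm)
    refine ⟨⟨m - 1, by omega⟩, ⟨m, h2⟩, Nat.sub_add_cancel h1, rfl, ?_⟩
    refine Nat.succ_lt_succ (Fin.lt_def.mp ((labelPerm_lt_iff _ _ _ _).mpr ?_))
    rw [labelKey_lt_iff]
    left
    have h3 := (hmono (m - 1)).mpr (by rwa [Nat.sub_add_cancel h1])
    rw [Nat.sub_add_cancel h1] at h3
    exact Fin.lt_def.mpr (Nat.mul_lt_mul_of_pos_left h3 two_pos)

/-- Triangularity: a permutation with descent set `Des(I)` occurs in `S^J` only if `Des(I) ⊆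
Des(J)`. For `I` of maximal length among the compositions occurring in `F`, only `J = I` remains. -/
theorem eq_zero_of_toDescent_eq_zero {n : ℕ} {F : NSym} (hF : F ∈ degPart n)
    (h : toDescent n F = 0) : F = 0 := by
  classical
  suffices H : ∀ I : Composition n, F.coeff (compWord I) = 0 by
    rw [eq_sum_of_mem_degPart hF]
    simp [H]
  by_contra H
  push Not at H
  obtain ⟨I, hI, hmax⟩ := Finset.exists_max_image
    (Finset.univ.filter fun I : Composition n => F.coeff (compWord I) ≠ 0)
    (fun I => I.length) (by simpa [Finset.Nonempty] using H)
  rw [Finset.mem_filter] at hI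
  obtain ⟨σ, hσ⟩ := exists_permDes_eq I
  have h1 : (∑ J : Composition n, F.coeff (compWord J) • descentS J).coeff σ = 0 := by
    change (toDescent n F).coeff σ = 0
    rw [h]
    rfl
  rw [MonoidAlgebra.coeff_sum, Finsupp.finsetSum_apply, Finset.sum_eq_single I] at h1
  · rw [MonoidAlgebra.coeff_smul_apply, descentS, coeff_permSum, if_pos hσ.le, smul_eq_mul,
      mul_one] at h1
    exact hI.2 h1
  · intro J _ hJ
    rw [MonoidAlgebra.coeff_smul_apply, descentS, coeff_permSum, hσ, Finset.coe_subset]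
    split_ifs with h2
    · by_cases h3 : F.coeff (compWord J) = 0
      · rw [h3, zero_smul]
      · exact absurd (eq_of_compDes_subset h2
          (hmax J (Finset.mem_filter.mpr ⟨Finset.mem_univ _, h3⟩))).symm hJ
    · rw [smul_zero]
  · simp

/-! Nonvanishing of sums over partitions. -/

theorem pPart_ne_zero {n : ℕ} (l : n.Partition) : pPart l ≠ 0 := by
  rw [pPart]
  have h : ∀ i, pSym i ≠ 0 := fun i h => by
    have h1 := congrArg (fun f : SymFun => MvPowerSeries.coeff (Finsupp.single 0 i) (f : MvPowerSeries ℕ ℚ)) h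
    change MvPowerSeries.coeff (Finsupp.single 0 i) (pSeries i) =
      MvPowerSeries.coeff (Finsupp.single 0 i) 0 at h1
    rw [coeff_pSeries, if_pos ⟨0, rfl⟩, map_zero] at h1
    exact one_ne_zero h1
  refine Multiset.prod_ne_zero fun h0 => ?_
  obtain ⟨i, _, hi⟩ := Multiset.mem_map.mp h0
  exact h i hi

theorem coeff_mul_nonneg {f g : MvPowerSeries ℕ ℚ} (hf : ∀ m, 0 ≤ MvPowerSeries.coeff m f)
    (hg : ∀ m, 0 ≤ MvPowerSeries.coeff m g) (m : ℕ →₀ ℕ) : 0 ≤ MvPowerSeries.coeff m (f * g) := by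
  classical
  rw [MvPowerSeries.coeff_mul]
  exact Finset.sum_nonneg fun p _ => mul_nonneg (hf _) (hg _)

theorem coeff_pPart_nonneg {n : ℕ} (l : n.Partition) (m : ℕ →₀ ℕ) :
    0 ≤ MvPowerSeries.coeff m (pPart l : MvPowerSeries ℕ ℚ) := by
  classical
  rw [pPart]
  induction l.parts using Multiset.induction_on generalizing m with
  | empty =>
    rw [Multiset.map_zero, Multiset.prod_zero, OneMemClass.coe_one, MvPowerSeries.coeff_one]
    split_ifs <;> norm_num
  | cons i s ih =>
    rw [Multiset.map_cons, Multiset.prod_cons, MulMemClass.coe_mul]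
    refine coeff_mul_nonneg (fun m => ?_) ih m
    change 0 ≤ MvPowerSeries.coeff m (pSeries i)
    rw [coeff_pSeries]
    split_ifs <;> norm_num

/-- Power sum products have nonnegative coefficients and the `z_λ` are positive, so nothing cancels
and one partition suffices; independence of the `p_λ` is not required. -/
theorem pSum_ne_zero {n : ℕ} {q : ℕ → ℕ → Prop} (l : n.Partition) (hl : q (oddLen l) (evenLen l)) :
    pSum n q ≠ 0 := by
  classical
  intro h
  obtain ⟨m, hm⟩ : ∃ m, MvPowerSeries.coeff m (pPart l : MvPowerSeries ℕ ℚ) ≠ 0 := by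
    by_contra H
    push Not at H
    exact pPart_ne_zero l (Subtype.ext (MvPowerSeries.ext fun m => by rw [H m]; rfl))
  have h1 := congrArg (fun f : SymFun => MvPowerSeries.coeff m (f : MvPowerSeries ℕ ℚ)) h
  simp only [pSum, AddSubmonoidClass.coe_finsetSum, map_sum, ZeroMemClass.coe_zero, map_zero] at h1
  have hz : ∀ l : n.Partition, 0 < (1 / (zPart l : ℚ)) := fun l =>
    one_div_pos.mpr (Nat.cast_pos.mpr (zMultiset_pos fun i hi => l.parts_pos hi))
  have hco : ∀ l : n.Partition, MvPowerSeries.coeff m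
      (((1 / (zPart l : ℚ)) • pPart l : SymFun) : MvPowerSeries ℕ ℚ) =
        1 / (zPart l : ℚ) * MvPowerSeries.coeff m (pPart l : MvPowerSeries ℕ ℚ) := fun l => rfl
  rw [Finset.sum_eq_zero_iff_of_nonneg] at h1
  · have h2 := h1 l (Finset.mem_filter.mpr ⟨Finset.mem_univ _, hl⟩)
    rw [hco] at h2
    exact (mul_ne_zero (hz l).ne' hm) h2
  · intro l _
    rw [hco]
    exact mul_nonneg (hz l).le (coeff_pPart_nonneg l m)

end
end RunAlgebra

namespace RunAlgebra
noncomputable section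

open PowerSeries

/-! Orthogonality of the idempotents. -/

theorem exists_partition_of_list {n : ℕ} (s : List ℕ) (hs : ∀ i ∈ s, 0 < i) (hn : s.sum = n) :
    ∃ l : n.Partition, oddLen l = s.countP (fun i => Odd i) ∧
      evenLen l = s.countP (fun i => Even i) :=
  ⟨⟨(s : Multiset ℕ), fun {i} hi => hs i hi, by simpa using hn⟩, by simp [oddLen],
    by simp [evenLen]⟩

/-- There is a partition with `k` odd parts and `c` even parts, the even parts after the first one
being equal to `2`. -/
theorem exists_partition {n k c : ℕ} (hc : 0 < c) (hk : k + 2 * c ≤ n) (hmod : k ≡ n [MOD 2]) :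
    ∃ l : n.Partition, oddLen l = k ∧ evenLen l = c := by
  obtain ⟨d, rfl⟩ : ∃ d, c = d + 1 := ⟨c - 1, by omega⟩
  have hpar : Even (n - k - 2 * d) := by
    rw [Nat.even_iff]
    unfold Nat.ModEq at hmod
    omega
  have hpar' : ¬ Odd (n - k - 2 * d) := Nat.not_odd_iff_even.mpr hpar
  obtain ⟨l, h1, h2⟩ := exists_partition_of_list (n := n)
    ((n - k - 2 * d) :: (List.replicate k 1 ++ List.replicate d 2)) (by
      intro i hi
      simp only [List.mem_cons, List.mem_append, List.mem_replicate] at hi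
      omega) (by
      simp
      omega)
  refine ⟨l, ?_, ?_⟩
  · rw [h1]
    simp [List.countP_append, List.countP_replicate, hpar',
      (by decide : ¬ Odd 2)]
  · rw [h2]
    simp [List.countP_append, List.countP_replicate, hpar,
      (by decide : ¬ Even 1)]

theorem exists_partition_odd {n k : ℕ} (h1 : 1 ≤ k) (hk : k ≤ n) (hmod : k ≡ n [MOD 2]) :
    ∃ l : n.Partition, oddLen l = k ∧ evenLen l = 0 := by
  have hpar : Odd (n - k + 1) := by
    rw [Nat.odd_iff]
    unfold Nat.ModEq at hmod
    omega
  have hpar' : ¬ Even (n - k + 1) := Nat.not_even_iff_odd.mpr hpar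
  obtain ⟨l, h2, h3⟩ := exists_partition_of_list (n := n)
    ((n - k + 1) :: List.replicate (k - 1) 1) (by
      intro i hi
      simp only [List.mem_cons, List.mem_replicate] at hi
      omega) (by
      simp
      omega)
  refine ⟨l, ?_, ?_⟩
  · rw [h2]
    simp [List.countP_replicate, hpar]
    omega
  · rw [h3]
    simp [List.countP_replicate, hpar', (by decide : ¬ Even 1)]

theorem exists_partition_oddLen {n k : ℕ} (hk : k ≤ n) (hmod : k ≡ n [MOD 2]) :
    ∃ l : n.Partition, oddLen l = k := by
  rcases hk.eq_or_lt with rfl | h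
  · obtain ⟨l, h1, -⟩ := exists_partition_of_list (n := k) (List.replicate k 1) (by
      intro i hi
      rw [List.mem_replicate] at hi
      omega) (by simp)
    exact ⟨l, by rw [h1]; simp [List.countP_replicate]⟩
  · unfold Nat.ModEq at hmod
    obtain ⟨l, h1, -⟩ := exists_partition (n := n) (k := k) (c := 1) one_pos (by omega) hmod
    exact ⟨l, h1⟩

/-! ### Nonvanishing of the idempotents. -/

theorem toDescent_ne_zero {n : ℕ} {F : NSym} (hF : F ∈ degPart n) {q : ℕ → ℕ → Prop}
    (hG : Gam F = pSum n q) (l : n.Partition) (hl : q (oddLen l) (evenLen l)) :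
    toDescent n F ≠ 0 := by
  intro h
  refine pSum_ne_zero l hl ?_
  rw [← hG, eq_zero_of_toDescent_eq_zero hF h, map_zero]

theorem Iplusn_mem_degPart {n k : ℕ} (hk : k ≤ n) : Iplusn n k ∈ degPart n :=
  coeff_IJ_mem_degPart false false hk

theorem Iminusn_mem_degPart {n k : ℕ} (hk : k ≤ n) : Iminusn n k ∈ degPart n :=
  coeff_IJ_mem_degPart true false hk

theorem Jplusn_mem_degPart {n k : ℕ} (hk : k ≤ n) : Jplusn n k ∈ degPart n :=
  coeff_IJ_mem_degPart true true hk

theorem Jminusn_mem_degPart {n k : ℕ} (hk : k ≤ n) : Jminusn n k ∈ degPart n :=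
  coeff_IJ_mem_degPart false true hk

theorem toDescent_Iplusn_ne_zero {n : ℕ} (k : Idx 1 0 n) : toDescent n (Iplusn n k) ≠ 0 := by
  obtain ⟨k, h1, hk, hmod⟩ := k
  obtain ⟨l, ho, he⟩ := exists_partition_odd h1 hk hmod
  exact toDescent_ne_zero (Iplusn_mem_degPart hk) (Gam_Iplusn hk) l ⟨ho, he⟩

theorem toDescent_Iminusn_ne_zero {n : ℕ} (k : Idx 1 0 n) : toDescent n (Iminusn n k) ≠ 0 := by
  obtain ⟨k, h1, hk, hmod⟩ := k
  obtain ⟨l, ho, he⟩ := exists_partition_odd h1 hk hmod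
  exact toDescent_ne_zero (Iminusn_mem_degPart hk) (Gam_Iminusn hk) l ⟨ho, he⟩

theorem toDescent_Jplusn_ne_zero {n : ℕ} (k : Idx 0 0 n) : toDescent n (Jplusn n k) ≠ 0 := by
  obtain ⟨k, h1, hk, hmod⟩ := k
  obtain ⟨l, ho⟩ := exists_partition_oddLen hk hmod
  exact toDescent_ne_zero (Jplusn_mem_degPart hk) (Gam_Jplusn hk) l ho

theorem toDescent_elemA_ne_zero {n : ℕ} (k : Idx 1 0 n) : toDescent n (elemA n k) ≠ 0 := by
  obtain ⟨k, h1, hk, hmod⟩ := k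
  obtain ⟨l, ho, he⟩ := exists_partition_odd h1 hk hmod
  exact toDescent_ne_zero (Submodule.smul_mem _ _ (Submodule.add_mem _ (Iplusn_mem_degPart hk)
    (Iminusn_mem_degPart hk))) (Gam_elemA hk) l ⟨ho, he⟩

theorem toDescent_elemB_ne_zero {n : ℕ} (k : Idx 0 4 n) : toDescent n (elemB n k) ≠ 0 := by
  obtain ⟨k, h1, hk, hmod⟩ := k
  -- Two even parts need at least four units, whence the range `l ≤ n - 4`.
  obtain ⟨l, ho, he⟩ := exists_partition (c := 2) two_pos hk hmod
  have hk : k ≤ n := by omega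
  exact toDescent_ne_zero (Submodule.smul_mem _ _ (Submodule.sub_mem _ (Submodule.sub_mem _
    (Submodule.add_mem _ (Jplusn_mem_degPart hk) (Jminusn_mem_degPart hk)) (Iplusn_mem_degPart hk))
    (Iminusn_mem_degPart hk))) (Gam_elemB hk) l ⟨ho, by rw [he]; exact two_pos, he ▸ even_two⟩

theorem toDescent_elemC_ne_zero {n : ℕ} (k : Idx 0 2 n) : toDescent n (elemC n k) ≠ 0 := by
  obtain ⟨k, h1, hk, hmod⟩ := k
  obtain ⟨l, ho, he⟩ := exists_partition (c := 1) one_pos hk hmod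
  have hk : k ≤ n := by omega
  exact toDescent_ne_zero (Submodule.smul_mem _ _ (Submodule.sub_mem _ (Jplusn_mem_degPart hk)
    (Jminusn_mem_degPart hk))) (Gam_elemC hk) l ⟨ho, he ▸ odd_one⟩

theorem toDescent_Jplusn_sub_Iplusn_ne_zero {n : ℕ} (k : Idx 0 2 n) :
    toDescent n (Jplusn n k - Iplusn n k) ≠ 0 := by
  obtain ⟨k, h1, hk, hmod⟩ := k
  obtain ⟨l, ho, he⟩ := exists_partition (c := 1) one_pos hk hmod
  have hk : k ≤ n := by omega
  exact toDescent_ne_zero (Submodule.sub_mem _ (Jplusn_mem_degPart hk) (Iplusn_mem_degPart hk))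
    (Gam_Jplusn_sub_Iplusn hk) l ⟨ho, by rw [he]; exact one_pos⟩

/-- The combinations of the degree `n` parts of `I_k^±` and `J_k^±` in the group algebra. -/
def eulerComb (n : ℕ) (a b c d : ℚ) (k : ℕ) : GroupAlg n :=
  a • eulerElem n false false k + b • eulerElem n true false k +
    (c • eulerElem n true true k + d • eulerElem n false true k)

/-- The coefficients refer to `I⁺`, `I⁻`, `J⁺`, `J⁻` in this order. The total `a' + b' + c' + d'`
appears because `I⁺` and `I⁻` absorb any right factor of the same index. -/
theorem eulerComb_mul {n k l : ℕ} (hk : k ≤ n) (hl : l ≤ n) (a b c d a' b' c' d' : ℚ) :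
    eulerComb n a b c d k * eulerComb n a' b' c' d' l =
      if k = l then eulerComb n (a * (a' + b' + c' + d') + c * a' + d * b')
        (b * (a' + b' + c' + d') + c * b' + d * a') (c * c' + d * d') (c * d' + d * c') k
      else 0 := by
  simp only [eulerComb, add_mul, mul_add, smul_mul_smul_comm, eulerElem_mul n _ _ _ _ hk hl]
  by_cases h : k = l
  · simp only [h, if_true, Bool.false_eq_true, if_false, Bool.and_self, Bool.and_false,
      Bool.false_and, beq_self_eq_true, Bool.beq_eq_decide_eq, Bool.true_eq_false, decide_false]
    module
  · simp [h]

theorem toDescent_Iplusn (n k : ℕ) : toDescent n (Iplusn n k) = eulerComb n 1 0 0 0 k := by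
  change eulerElem n false false k = _
  simp [eulerComb]

theorem toDescent_Iminusn (n k : ℕ) : toDescent n (Iminusn n k) = eulerComb n 0 1 0 0 k := by
  change eulerElem n true false k = _
  simp [eulerComb]

theorem toDescent_Jplusn (n k : ℕ) : toDescent n (Jplusn n k) = eulerComb n 0 0 1 0 k := by
  change eulerElem n true true k = _
  simp [eulerComb]

theorem toDescent_Jplusn_sub_Iplusn (n k : ℕ) :
    toDescent n (Jplusn n k - Iplusn n k) = eulerComb n (-1) 0 1 0 k := by
  rw [map_sub]
  change eulerElem n true true k - eulerElem n false false k = _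
  rw [eulerComb]
  module

theorem toDescent_elemA (n k : ℕ) :
    toDescent n (elemA n k) = eulerComb n (1 / 2) (1 / 2) 0 0 k := by
  rw [elemA, map_smul, map_add]
  change (1 / 2 : ℚ) • (eulerElem n false false k + eulerElem n true false k) = _
  rw [eulerComb]
  module

theorem toDescent_elemB (n k : ℕ) :
    toDescent n (elemB n k) = eulerComb n (-1 / 2) (-1 / 2) (1 / 2) (1 / 2) k := by
  rw [elemB, map_smul, map_sub, map_sub, map_add]
  change (1 / 2 : ℚ) • (eulerElem n true true k + eulerElem n false true k -
    eulerElem n false false k - eulerElem n true false k) = _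
  rw [eulerComb]
  module

theorem toDescent_elemC (n k : ℕ) :
    toDescent n (elemC n k) = eulerComb n 0 0 (1 / 2) (-1 / 2) k := by
  rw [elemC, map_smul, map_sub]
  change (1 / 2 : ℚ) • (eulerElem n true true k - eulerElem n false true k) = _
  rw [eulerComb]
  module

theorem Idx.le {a b n : ℕ} (k : Idx a b n) : (k : ℕ) ≤ n := le_trans (Nat.le_add_right _ _) k.2.2.1

theorem orthogonalIdempotents_eulerComb (n x y : ℕ) {a b c d : ℚ}
    (h : a * (a + b + c + d) + c * a + d * b = a ∧ b * (a + b + c + d) + c * b + d * a = b ∧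
      c * c + d * d = c ∧ c * d + d * c = d) :
    OrthogonalIdempotents fun k : Idx x y n => eulerComb n a b c d k where
  idem k := by
    rw [IsIdempotentElem, eulerComb_mul k.le k.le, if_pos rfl, h.1, h.2.1, h.2.2.1, h.2.2.2]
  ortho k l hkl := by
    change eulerComb n a b c d k * eulerComb n a b c d l = 0
    rw [eulerComb_mul k.le l.le, if_neg fun h => hkl (Subtype.ext h)]

theorem eulerComb_mul_eq_zero {n k l : ℕ} (hk : k ≤ n) (hl : l ≤ n) {a b c d a' b' c' d' : ℚ}
    (h : a * (a' + b' + c' + d') + c * a' + d * b' = 0 ∧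
      b * (a' + b' + c' + d') + c * b' + d * a' = 0 ∧ c * c' + d * d' = 0 ∧ c * d' + d * c' = 0) :
    eulerComb n a b c d k * eulerComb n a' b' c' d' l = 0 := by
  rw [eulerComb_mul hk hl, h.1, h.2.1, h.2.2.1, h.2.2.2]
  simp [eulerComb]

theorem orthogonalIdempotents_sumElim {R ι κ : Type*} [Semiring R] {e : ι → R} {f : κ → R}
    (he : OrthogonalIdempotents e) (hf : OrthogonalIdempotents f) (hef : ∀ i j, e i * f j = 0)
    (hfe : ∀ i j, f i * e j = 0) : OrthogonalIdempotents (Sum.elim e f) where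
  idem
    | .inl i => he.idem i
    | .inr j => hf.idem j
  ortho
    | .inl _, .inl _ => fun h => he.ortho fun h' => h (congrArg _ h')
    | .inl i, .inr j => fun _ => hef i j
    | .inr i, .inl j => fun _ => hfe i j
    | .inr _, .inr _ => fun h => hf.ortho fun h' => h (congrArg _ h')

theorem linearIndependent_of_orthogonalIdempotents {n : ℕ} {ι : Type*} {e : ι → GroupAlg n}
    (he : OrthogonalIdempotents e) (h0 : ∀ i, e i ≠ 0) : LinearIndependent ℚ e := by
  classical
  rw [linearIndependent_iff']
  intro s g hg i hi
  have h := congrArg (fun x => e i * x) hg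
  simp only [mul_zero, Finset.mul_sum, mul_smul_comm] at h
  rw [Finset.sum_eq_single i] at h
  · rw [(he.idem i).eq] at h
    exact (smul_eq_zero.mp h).resolve_right (h0 i)
  · intro j _ hj
    rw [he.ortho hj.symm, smul_zero]
  · exact fun h => absurd hi h

/-- A criterion for a family of orthogonal idempotents to be a basis. -/
theorem isOrthIdemBasis_of_le_span {n : ℕ} {A : Submodule ℚ (GroupAlg n)} {ι : Type} [Finite ι]
    {e : ι → GroupAlg n} (he : OrthogonalIdempotents e) (h0 : ∀ i, e i ≠ 0) (hA : ∀ i, e i ∈ A)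
    (g : ι → GroupAlg n) (hg : A ≤ Submodule.span ℚ (Set.range g)) : IsOrthIdemBasis A e := by
  have hli := linearIndependent_of_orthogonalIdempotents he h0
  have := Fintype.ofFinite ι
  refine ⟨he, hli, ?_⟩
  have hle : Submodule.span ℚ (Set.range e) ≤ A := by
    rw [Submodule.span_le]
    rintro _ ⟨i, rfl⟩
    exact hA i
  have : FiniteDimensional ℚ (Submodule.span ℚ (Set.range g)) :=
    FiniteDimensional.span_of_finite ℚ (Set.finite_range g)
  have : FiniteDimensional ℚ A := Submodule.finiteDimensional_of_le hg
  -- The independent family `e` and the spanning family `g` have the same index set, so the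
  -- dimensions agree; `g` itself need not be independent.
  refine Submodule.eq_of_le_of_finrank_le hle ?_
  rw [finrank_span_eq_card hli]
  exact (Submodule.finrank_mono hg).trans (finrank_range_le_card g)

instance finite_idx (a b n : ℕ) : Finite (Idx a b n) :=
  Finite.of_injective (fun k : Idx a b n => (⟨k, Nat.lt_succ_of_le k.le⟩ : Fin (n + 1)))
    fun _ _ h => Subtype.ext (congrArg Fin.val h)

end
end RunAlgebra

namespace RunAlgebra
noncomputable section

/-! Membership in the spaces spanned by sums of fibres of a statistic. -/

/-- An element constant on the fibres of `st` is a combination of the fibre sums. The sum runs over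
permutations instead of values, so each fibre sum is divided by the size of the fibre. -/
theorem mem_of_forall_permSum_mem {n : ℕ} {κ : Type*} (st : Equiv.Perm (Fin n) → κ)
    {A : Submodule ℚ (GroupAlg n)} (hA : ∀ σ, permSum (fun τ => st τ = st σ) ∈ A) {y : GroupAlg n}
    (hy : ∀ σ τ, st σ = st τ → y.coeff σ = y.coeff τ) : y ∈ A := by
  classical
  have h : y = ∑ σ, (y.coeff σ / (Finset.univ.filter fun τ => st τ = st σ).card) •
      permSum (fun τ => st τ = st σ) := by
    refine MonoidAlgebra.coeff_injective (Finsupp.ext fun ρ => ?_)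
    rw [MonoidAlgebra.coeff_sum, Finsupp.finsetSum_apply]
    simp only [MonoidAlgebra.coeff_smul_apply, coeff_permSum, smul_eq_mul, mul_ite, mul_one,
      mul_zero]
    rw [← Finset.sum_filter]
    have hc : ((Finset.univ.filter fun τ => st τ = st ρ).card : ℚ) ≠ 0 :=
      Nat.cast_ne_zero.mpr (Finset.card_pos.mpr ⟨ρ, by simp⟩).ne'
    have h1 : ∀ σ ∈ Finset.univ.filter (fun σ => st ρ = st σ),
        y.coeff σ / ((Finset.univ.filter fun τ => st τ = st σ).card : ℚ) =
          y.coeff ρ / ((Finset.univ.filter fun τ => st τ = st ρ).card : ℚ) := fun σ hσ => by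
      have h2 := (Finset.mem_filter.mp hσ).2
      rw [hy ρ σ h2]
      simp only [h2]
    rw [Finset.sum_congr rfl h1, Finset.sum_const, nsmul_eq_mul]
    simp only [eq_comm (a := st ρ)]
    field_simp
  rw [h]
  exact Submodule.sum_mem _ fun σ _ => Submodule.smul_mem _ _ (hA σ)

/-- The last sign of `x :: w` is determined by `x` and the parity of the number of changes. Hence
appending `y` yields a function of that number, which is why left runs control both `I⁺` and `J⁺`.
-/
theorem changes_concat (x y : Bool) (w : List Bool) :
    changes x (w ++ [y]) = changes x w + if (Even (changes x w) ↔ x = y) then 0 else 1 := by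
  induction w generalizing x with
  | nil => cases x <;> cases y <;> simp [changes]
  | cons a w ih =>
    rw [List.cons_append, changes, changes, ih, add_assoc]
    congr 2
    by_cases h : x = a
    · simp [h]
    · have h' : x = !a := by cases x <;> cases a <;> simp_all
      have h2 : (Even (1 + changes a w) ↔ x = y) ↔ (Even (changes a w) ↔ a = y) := by
        rw [Nat.even_add, h']
        by_cases h1 : Even (changes a w) <;> cases a <;> cases y <;> simp [h1]
      rw [if_neg h, if_congr h2 rfl rfl]

theorem exists_coeff_eulerComb {n : ℕ} (hn : 0 < n) {k : ℕ} (hk : k ≤ n) :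
    ∃ φ ψ : ℕ → ℚ, ∀ (a b c d : ℚ) (σ : Equiv.Perm (Fin n)), (eulerComb n a b c d k).coeff σ =
      a * φ (changes true (letters σ ++ [false])) + b * φ (changes false (letters σ ++ [true])) +
      (c * ψ (changes true (letters σ ++ [true])) +
        d * ψ (changes false (letters σ ++ [false]))) := by
  obtain ⟨φ, hφ⟩ := exists_coeff_eulerElem hn false hk
  obtain ⟨ψ, hψ⟩ := exists_coeff_eulerElem hn true hk
  refine ⟨φ, ψ, fun a b c d σ => ?_⟩
  have h1 := hφ false σ
  have h2 := hφ true σ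
  have h3 := hψ true σ
  have h4 := hψ false σ
  rw [eulerComb, MonoidAlgebra.coeff_add, MonoidAlgebra.coeff_add, MonoidAlgebra.coeff_add,
    Finsupp.add_apply, Finsupp.add_apply, Finsupp.add_apply, MonoidAlgebra.coeff_smul_apply,
    MonoidAlgebra.coeff_smul_apply, MonoidAlgebra.coeff_smul_apply, MonoidAlgebra.coeff_smul_apply,
    h1, h2, h3, h4]
  rfl

/-! ### Membership in the five spaces. -/

theorem eulerComb_mem_peakAlg {n k : ℕ} (hn : 0 < n) (hk : k ≤ n) :
    eulerComb n 0 1 0 0 k ∈ peakAlg n := by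
  obtain ⟨φ, ψ, h⟩ := exists_coeff_eulerComb hn hk
  have hpk : ∀ σ : Equiv.Perm (Fin n), changes false (letters σ ++ [true]) = 2 * pk σ + 1 :=
    fun σ => by rw [changes_concat_true, pk_eq]; rfl
  refine mem_of_forall_permSum_mem pk (fun σ => Submodule.subset_span ?_) fun σ τ hστ => ?_
  · refine ⟨pk σ, ?_, rfl⟩
    have h1 := changes_le false (letters σ ++ [true])
    rw [hpk, List.length_append, length_letters, List.length_singleton] at h1
    omega
  · simp only [h, hpk, hστ, zero_mul]

theorem eulerComb_mem_leftPeakAlg {n k : ℕ} (hk : k ≤ n) :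
    eulerComb n 0 0 1 0 k ∈ leftPeakAlg n := by
  have hpk : ∀ σ : Equiv.Perm (Fin n), changes true (letters σ ++ [true]) = 2 * leftPk σ :=
    fun σ => by rw [changes_concat_true, leftPk_eq]; rfl
  refine mem_of_forall_permSum_mem leftPk (fun σ => Submodule.subset_span ?_) fun σ τ hστ => ?_
  · refine ⟨leftPk σ, ?_, rfl⟩
    have h1 := changes_le true (letters σ ++ [true])
    rw [hpk, List.length_append, length_letters, List.length_singleton] at h1
    omega
  · rcases Nat.eq_zero_or_pos n with rfl | hn
    · rw [Subsingleton.elim σ τ]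
    · obtain ⟨φ, ψ, h⟩ := exists_coeff_eulerComb hn hk
      simp only [h, hpk, hστ, zero_mul]

theorem eulerComb_mem_leftRunAlg {n k : ℕ} (hn : 0 < n) (hk : k ≤ n) (a c : ℚ) :
    eulerComb n a 0 c 0 k ∈ leftRunAlg n := by
  obtain ⟨φ, ψ, h⟩ := exists_coeff_eulerComb hn hk
  obtain ⟨m, rfl⟩ : ∃ m, n = m + 1 := ⟨n - 1, by omega⟩
  refine mem_of_forall_permSum_mem leftRun (fun σ => Submodule.subset_span ?_)
    fun σ τ hστ => ?_
  · refine ⟨leftRun σ, by rw [leftRun_eq]; omega, ?_, rfl⟩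
    have h1 := changes_le true (letters σ)
    rw [length_letters] at h1
    rw [leftRun_eq]
    omega
  · rw [leftRun_eq, leftRun_eq, add_right_inj] at hστ
    simp only [h, zero_mul, changes_concat, hστ]

/-- The sign changes of the letters of a permutation, in terms of its number of runs. -/
theorem changes_letters {m : ℕ} (σ : Equiv.Perm (Fin (m + 2))) (s y : Bool) :
    changes s (letters σ ++ [y]) + 1 = (if s = letter σ 0 then 0 else 1) + run σ +
      if (Odd (run σ) ↔ letter σ 0 = y) then 0 else 1 := by
  have h : Even (changes (letter σ 0) ((List.range' 1 m).map (letter σ))) ↔ Odd (run σ) := by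
    rw [run_eq, Nat.odd_add]
    simp
  rw [letters_eq_cons, List.cons_append, changes, changes_concat, if_congr (iff_congr h Iff.rfl) rfl rfl,
    run_eq]
  ring

theorem run_bounds {m : ℕ} (σ : Equiv.Perm (Fin (m + 2))) : 1 ≤ run σ ∧ run σ + 1 ≤ m + 2 := by
  have h := changes_le (letter σ 0) ((List.range' 1 m).map (letter σ))
  rw [List.length_map, List.length_range'] at h
  rw [run_eq]
  omega

theorem coeff_eulerComb_eq_of_run_eq {m k : ℕ} (hk : k ≤ m + 2) (a c : ℚ)
    {σ τ : Equiv.Perm (Fin (m + 2))} (hστ : run σ = run τ) :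
    (eulerComb (m + 2) a a c c k).coeff σ = (eulerComb (m + 2) a a c c k).coeff τ := by
  obtain ⟨φ, ψ, h⟩ := exists_coeff_eulerComb (Nat.succ_pos (m + 1)) hk
  have hch : ∀ (s y : Bool) (σ : Equiv.Perm (Fin (m + 2))), changes s (letters σ ++ [y]) =
      (if s = letter σ 0 then 0 else 1) + run σ +
        (if (Odd (run σ) ↔ letter σ 0 = y) then 0 else 1) - 1 := fun s y σ => by
    rw [← changes_letters]
    rfl
  rw [h, h]
  simp only [hch, hστ]
  -- For a given number of runs, flipping the first letter exchanges the two arguments of `φ` and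
  -- the two arguments of `ψ`, so the symmetric sums are unaffected.
  cases letter σ 0 <;> cases letter τ 0 <;> simp <;> ring

theorem coeff_eulerComb_eq_of_run_eq_of_letter_eq {m k : ℕ} (hk : k ≤ m + 2) (c : ℚ)
    {σ τ : Equiv.Perm (Fin (m + 2))} (hστ : run σ = run τ)
    (hl : Odd (run σ) → letter σ 0 = letter τ 0) :
    (eulerComb (m + 2) 0 0 c (-c) k).coeff σ = (eulerComb (m + 2) 0 0 c (-c) k).coeff τ := by
  obtain ⟨φ, ψ, h⟩ := exists_coeff_eulerComb (Nat.succ_pos (m + 1)) hk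
  have hch : ∀ (s y : Bool) (σ : Equiv.Perm (Fin (m + 2))), changes s (letters σ ++ [y]) =
      (if s = letter σ 0 then 0 else 1) + run σ +
        (if (Odd (run σ) ↔ letter σ 0 = y) then 0 else 1) - 1 := fun s y σ => by
    rw [← changes_letters]
    rfl
  rw [h, h]
  simp only [hch, hστ]
  by_cases ho : Odd (run σ)
  · rw [hl ho]
  · rw [hστ] at ho
    -- For an even number of runs the first and last letters differ, both borders yield the same
    -- number of changes, and the difference is zero whatever the first letter.
    cases letter σ 0 <;> cases letter τ 0 <;> simp [ho, add_comm]

theorem eulerComb_mem_runAlg {n k : ℕ} (hn : 2 ≤ n) (hk : k ≤ n) (a c : ℚ) :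
    eulerComb n a a c c k ∈ runAlg n := by
  obtain ⟨m, rfl⟩ : ∃ m, n = m + 2 := ⟨n - 2, by omega⟩
  refine mem_of_forall_permSum_mem run (fun σ => Submodule.subset_span ?_)
    fun σ τ hστ => coeff_eulerComb_eq_of_run_eq hk a c hστ
  exact ⟨run σ, (run_bounds σ).1, (run_bounds σ).2, rfl⟩

theorem permSum_congr {n : ℕ} {p q : Equiv.Perm (Fin n) → Prop} (h : ∀ σ, p σ ↔ q σ) :
    permSum p = permSum q := congrArg permSum (funext fun σ => propext (h σ))

theorem mem_commAlg_of_coeff_eq {m : ℕ} {y : GroupAlg (m + 2)}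
    (hy : ∀ σ τ : Equiv.Perm (Fin (m + 2)), run σ = run τ →
      (Odd (run σ) → letter σ 0 = letter τ 0) → y.coeff σ = y.coeff τ) : y ∈ commAlg (m + 2) := by
  classical
  refine mem_of_forall_permSum_mem
    (fun σ => (run σ, if Odd (run σ) then letter σ 0 else true)) (fun σ => ?_) fun σ τ hστ => ?_
  · obtain ⟨h1, h2⟩ := run_bounds σ
    rcases Nat.even_or_odd' (run σ) with ⟨j, hj | hj⟩
    · refine Submodule.mem_sup_left (Submodule.subset_span ⟨j, by omega, by omega, ?_⟩)
      refine permSum_congr fun τ => ?_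
      have hno : ¬ Odd (2 * j) := by simp
      rw [Prod.mk.injEq, hj]
      refine and_iff_left_of_imp fun h => ?_
      rw [h, if_neg hno, if_neg hno]
    · refine Submodule.mem_sup_right (Submodule.subset_span ⟨j + 1, by omega, by omega, ?_⟩)
      have hs : 2 * (j + 1) - 1 = run σ := by omega
      have ho : Odd (run σ) := ⟨j, hj⟩
      rw [hs]
      cases hl : letter σ 0
      · right
        refine permSum_congr fun τ => ?_
        rw [Prod.mk.injEq, firstRunDescending_iff]
        refine and_congr_right fun h => ?_
        simp [h, ho]
      · left
        refine permSum_congr fun τ => ?_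
        rw [Prod.mk.injEq, firstRunAscending_iff]
        refine and_congr_right fun h => ?_
        simp [h, ho]
  · rw [Prod.mk.injEq] at hστ
    refine hy σ τ hστ.1 fun ho => ?_
    have h := hστ.2
    rwa [← hστ.1, if_pos ho, if_pos ho] at h

theorem eulerComb_mem_commAlg {n k : ℕ} (hn : 2 ≤ n) (hk : k ≤ n) (a c : ℚ) :
    eulerComb n a a c c k ∈ commAlg n := by
  obtain ⟨m, rfl⟩ : ∃ m, n = m + 2 := ⟨n - 2, by omega⟩
  exact mem_commAlg_of_coeff_eq fun σ τ hστ _ => coeff_eulerComb_eq_of_run_eq hk a c hστ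

theorem eulerComb_neg_mem_commAlg {n k : ℕ} (hn : 2 ≤ n) (hk : k ≤ n) (c : ℚ) :
    eulerComb n 0 0 c (-c) k ∈ commAlg n := by
  obtain ⟨m, rfl⟩ : ∃ m, n = m + 2 := ⟨n - 2, by omega⟩
  exact mem_commAlg_of_coeff_eq fun σ τ => coeff_eulerComb_eq_of_run_eq_of_letter_eq hk c

end
end RunAlgebra

/-! ### The five bases. -/

namespace RunAlgebra
noncomputable section

theorem isOrthIdemBasis_runAlg {n : ℕ} (hn : 2 ≤ n) : IsOrthIdemBasis (runAlg n)
    (Sum.elim (fun k : Idx 1 0 n => toDescent n (elemA n k))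
      (fun l : Idx 0 4 n => toDescent n (elemB n l))) := by
  refine isOrthIdemBasis_of_le_span ?_ ?_ ?_
    -- The spanning sums are enumerated by the index set of the idempotents. The first family covers
    -- the odd numbers of runs and the second the even ones up to `n - 2`. The index `k = 1` exists
    -- only for odd `n`; it would give `n` runs, so it is used for the remaining even number `n -
    -- 1`.
    (Sum.elim (fun k => Wrun n (if (k : ℕ) = 1 then n - 1 else n + 1 - k))
      fun l => Wrun n (n - 2 - l)) ?_
  · simp only [toDescent_elemA, toDescent_elemB]
    exact orthogonalIdempotents_sumElim (orthogonalIdempotents_eulerComb _ _ _ (by norm_num))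
      (orthogonalIdempotents_eulerComb _ _ _ (by norm_num))
      (fun i j => eulerComb_mul_eq_zero i.le j.le (by norm_num))
      fun i j => eulerComb_mul_eq_zero i.le j.le (by norm_num)
  · rintro (k | k)
    · exact toDescent_elemA_ne_zero k
    · exact toDescent_elemB_ne_zero k
  · rintro (k | k)
    · rw [Sum.elim_inl, toDescent_elemA]
      exact eulerComb_mem_runAlg hn k.le _ _
    · rw [Sum.elim_inr, toDescent_elemB]
      exact eulerComb_mem_runAlg hn k.le _ _
  · refine Submodule.span_mono ?_
    rintro _ ⟨k, h1, h2, rfl⟩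
    rcases Nat.even_or_odd' k with ⟨j, rfl | rfl⟩
    · by_cases h : 2 * j + 2 ≤ n
      · refine ⟨.inr ⟨n - 2 * j - 2, by omega, by omega, by unfold Nat.ModEq; omega⟩, ?_⟩
        exact congrArg (Wrun n) (by change n - 2 - (n - 2 * j - 2) = _; omega)
      · refine ⟨.inl ⟨1, by omega, by omega, by unfold Nat.ModEq; omega⟩, ?_⟩
        exact congrArg (Wrun n) (by rw [if_pos rfl]; omega)
    · refine ⟨.inl ⟨n - 2 * j, by omega, by omega, by unfold Nat.ModEq; omega⟩, ?_⟩
      refine congrArg (Wrun n) ?_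
      change (if n - 2 * j = 1 then n - 1 else n + 1 - (n - 2 * j)) = _
      rw [if_neg (by omega)]
      omega

theorem isOrthIdemBasis_leftRunAlg (n : ℕ) : IsOrthIdemBasis (leftRunAlg n)
    (Sum.elim (fun k : Idx 1 0 n => toDescent n (Iplusn n k))
      (fun l : Idx 0 2 n => toDescent n (Jplusn n l - Iplusn n l))) := by
  refine isOrthIdemBasis_of_le_span ?_ ?_ ?_
    (Sum.elim (fun k => Wleft n (n + 1 - k)) fun l => Wleft n (n - l)) ?_
  · simp only [toDescent_Iplusn, toDescent_Jplusn_sub_Iplusn]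
    exact orthogonalIdempotents_sumElim (orthogonalIdempotents_eulerComb _ _ _ (by norm_num))
      (orthogonalIdempotents_eulerComb _ _ _ (by norm_num))
      (fun i j => eulerComb_mul_eq_zero i.le j.le (by norm_num))
      fun i j => eulerComb_mul_eq_zero i.le j.le (by norm_num)
  · rintro (k | k)
    · exact toDescent_Iplusn_ne_zero k
    · exact toDescent_Jplusn_sub_Iplusn_ne_zero k
  · rintro (k | k)
    · rw [Sum.elim_inl, toDescent_Iplusn]
      exact eulerComb_mem_leftRunAlg (lt_of_lt_of_le k.2.1 k.le) k.le _ _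
    · rw [Sum.elim_inr, toDescent_Jplusn_sub_Iplusn]
      exact eulerComb_mem_leftRunAlg (lt_of_lt_of_le two_pos (le_of_add_le_right k.2.2.1)) k.le _ _
  · refine Submodule.span_mono ?_
    rintro _ ⟨k, h1, h2, rfl⟩
    rcases Nat.even_or_odd' k with ⟨j, rfl | rfl⟩
    · refine ⟨.inr ⟨n - 2 * j, by omega, by omega, by unfold Nat.ModEq; omega⟩, ?_⟩
      exact congrArg (Wleft n) (by change n - (n - 2 * j) = _; omega)
    · refine ⟨.inl ⟨n - 2 * j, by omega, by omega, by unfold Nat.ModEq; omega⟩, ?_⟩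
      exact congrArg (Wleft n) (by change n + 1 - (n - 2 * j) = _; omega)

theorem isOrthIdemBasis_commAlg {n : ℕ} (hn : 2 ≤ n) : IsOrthIdemBasis (commAlg n)
    (Sum.elim (fun k : Idx 1 0 n => toDescent n (elemA n k))
      (Sum.elim (fun l : Idx 0 4 n => toDescent n (elemB n l))
        (fun m : Idx 0 2 n => toDescent n (elemC n m)))) := by
  refine isOrthIdemBasis_of_le_span ?_ ?_ ?_
    -- The enumeration is the one used for runs, with the odd numbers of runs split: ascending sums
    -- go to the first family and descending ones to the third.
    (Sum.elim (fun k => if (k : ℕ) = 1 then Wrun n (n - 1) else Wplus n (n + 1 - k))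
      (Sum.elim (fun l => Wrun n (n - 2 - l)) fun m => Wminus n (n - m - 1))) ?_
  · simp only [toDescent_elemA, toDescent_elemB, toDescent_elemC]
    refine orthogonalIdempotents_sumElim (orthogonalIdempotents_eulerComb _ _ _ (by norm_num))
      (orthogonalIdempotents_sumElim (orthogonalIdempotents_eulerComb _ _ _ (by norm_num))
        (orthogonalIdempotents_eulerComb _ _ _ (by norm_num))
        (fun i j => eulerComb_mul_eq_zero i.le j.le (by norm_num))
        fun i j => eulerComb_mul_eq_zero i.le j.le (by norm_num)) ?_ ?_
    · rintro i (j | j) <;> exact eulerComb_mul_eq_zero i.le j.le (by norm_num)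
    · rintro (i | i) j <;> exact eulerComb_mul_eq_zero i.le j.le (by norm_num)
  · rintro (k | k | k)
    · exact toDescent_elemA_ne_zero k
    · exact toDescent_elemB_ne_zero k
    · exact toDescent_elemC_ne_zero k
  · rintro (k | k | k)
    · rw [Sum.elim_inl, toDescent_elemA]
      exact eulerComb_mem_commAlg hn k.le _ _
    · rw [Sum.elim_inr, Sum.elim_inl, toDescent_elemB]
      exact eulerComb_mem_commAlg hn k.le _ _
    · rw [Sum.elim_inr, Sum.elim_inr, toDescent_elemC, neg_div]
      exact eulerComb_neg_mem_commAlg hn k.le _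
  · refine sup_le (Submodule.span_mono ?_) (Submodule.span_mono ?_)
    · rintro _ ⟨j, h1, h2, rfl⟩
      by_cases h : 2 * j + 2 ≤ n
      · refine ⟨.inr (.inl ⟨n - 2 * j - 2, by omega, by omega, by unfold Nat.ModEq; omega⟩), ?_⟩
        exact congrArg (Wrun n) (by change n - 2 - (n - 2 * j - 2) = _; omega)
      · refine ⟨.inl ⟨1, by omega, by omega, by unfold Nat.ModEq; omega⟩, ?_⟩
        rw [Sum.elim_inl, if_pos rfl, show n - 1 = 2 * j by omega]
    · rintro _ ⟨j, h1, h2, rfl | rfl⟩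
      · refine ⟨.inl ⟨n + 2 - 2 * j, by omega, by omega, by unfold Nat.ModEq; omega⟩, ?_⟩
        refine (if_neg (by change n + 2 - 2 * j ≠ 1; omega)).trans (congrArg (Wplus n) ?_)
        change n + 1 - (n + 2 - 2 * j) = _
        omega
      · refine ⟨.inr (.inr ⟨n - 2 * j, by omega, by omega, by unfold Nat.ModEq; omega⟩), ?_⟩
        exact congrArg (Wminus n) (by change n - (n - 2 * j) - 1 = _; omega)

theorem isOrthIdemBasis_peakAlg (n : ℕ) :
    IsOrthIdemBasis (peakAlg n) (fun k : Idx 1 0 n => toDescent n (Iminusn n k)) := by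
  refine isOrthIdemBasis_of_le_span ?_ toDescent_Iminusn_ne_zero (fun k => ?_)
    (fun k => Ppeak n ((n - k) / 2)) ?_
  · simp only [toDescent_Iminusn]
    exact orthogonalIdempotents_eulerComb _ _ _ (by norm_num)
  · rw [toDescent_Iminusn]
    exact eulerComb_mem_peakAlg (lt_of_lt_of_le k.2.1 k.le) k.le
  · refine Submodule.span_mono ?_
    rintro _ ⟨j, h, rfl⟩
    refine ⟨⟨n - 2 * j, by omega, by omega, by unfold Nat.ModEq; omega⟩, ?_⟩
    exact congrArg (Ppeak n) (by change (n - (n - 2 * j)) / 2 = _; omega)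

theorem isOrthIdemBasis_leftPeakAlg (n : ℕ) :
    IsOrthIdemBasis (leftPeakAlg n) (fun k : Idx 0 0 n => toDescent n (Jplusn n k)) := by
  refine isOrthIdemBasis_of_le_span ?_ toDescent_Jplusn_ne_zero (fun k => ?_)
    (fun k => Pleft n ((n - k) / 2)) ?_
  · simp only [toDescent_Jplusn]
    exact orthogonalIdempotents_eulerComb _ _ _ (by norm_num)
  · rw [toDescent_Jplusn]
    exact eulerComb_mem_leftPeakAlg k.le
  · refine Submodule.span_mono ?_
    rintro _ ⟨j, h, rfl⟩
    refine ⟨⟨n - 2 * j, by omega, by omega, by unfold Nat.ModEq; omega⟩, ?_⟩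
    exact congrArg (Pleft n) (by change (n - (n - 2 * j)) / 2 = _; omega)

end
end RunAlgebra

theorem mainTheorem4 (n : ℕ) :
    -- the algebra of runs
    (2 ≤ n →
      IsOrthIdemBasis (runAlg n)
        (Sum.elim (fun k : Idx 1 0 n => toDescent n (elemA n k))
          (fun l : Idx 0 4 n => toDescent n (elemB n l))) ∧
      (∀ k : Idx 1 0 n, Gam (elemA n k) = pSum n fun o e => o = k ∧ e = 0) ∧
      (∀ l : Idx 0 4 n, Gam (elemB n l) = pSum n fun o e => o = l ∧ 0 < e ∧ Even e)) ∧
    -- the algebra of left runs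
    (IsOrthIdemBasis (leftRunAlg n)
        (Sum.elim (fun k : Idx 1 0 n => toDescent n (Iplusn n k))
          (fun l : Idx 0 2 n => toDescent n (Jplusn n l - Iplusn n l))) ∧
      (∀ k : Idx 1 0 n, Gam (Iplusn n k) = pSum n fun o e => o = k ∧ e = 0) ∧
      (∀ l : Idx 0 2 n, Gam (Jplusn n l - Iplusn n l) = pSum n fun o e => o = l ∧ 0 < e)) ∧
    -- the largest commutative algebra
    (2 ≤ n →
      IsOrthIdemBasis (commAlg n)
        (Sum.elim (fun k : Idx 1 0 n => toDescent n (elemA n k))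
          (Sum.elim (fun l : Idx 0 4 n => toDescent n (elemB n l))
            (fun m : Idx 0 2 n => toDescent n (elemC n m)))) ∧
      (∀ k : Idx 1 0 n, Gam (elemA n k) = pSum n fun o e => o = k ∧ e = 0) ∧
      (∀ l : Idx 0 4 n, Gam (elemB n l) = pSum n fun o e => o = l ∧ 0 < e ∧ Even e) ∧
      (∀ m : Idx 0 2 n, Gam (elemC n m) = pSum n fun o e => o = m ∧ Odd e)) ∧
    -- the Eulerian peak algebra
    (IsOrthIdemBasis (peakAlg n) (fun k : Idx 1 0 n => toDescent n (Iminusn n k)) ∧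
      (∀ k : Idx 1 0 n, Gam (Iminusn n k) = pSum n fun o e => o = k ∧ e = 0)) ∧
    -- the Eulerian left peak algebra
    (IsOrthIdemBasis (leftPeakAlg n) (fun k : Idx 0 0 n => toDescent n (Jplusn n k)) ∧
      (∀ k : Idx 0 0 n, Gam (Jplusn n k) = pSum n fun o _ => o = k)) := by
  exact ⟨fun hn => ⟨isOrthIdemBasis_runAlg hn, fun k => Gam_elemA k.le, fun l => Gam_elemB l.le⟩,
    ⟨isOrthIdemBasis_leftRunAlg n, fun k => Gam_Iplusn k.le, fun l => Gam_Jplusn_sub_Iplusn l.le⟩,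
    fun hn => ⟨isOrthIdemBasis_commAlg hn, fun k => Gam_elemA k.le, fun l => Gam_elemB l.le,
      fun m => Gam_elemC m.le⟩,
    ⟨isOrthIdemBasis_peakAlg n, fun k => Gam_Iminusn k.le⟩,
    isOrthIdemBasis_leftPeakAlg n, fun k => Gam_Jplusn k.le⟩
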